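/- Let $G$ be a compact connected semisimple Lie group with Lie algebra $\mathfrak g$ and Killing form $B$, let $T\subset G$ be a maximal torus with Lie algebra $\mathfrak t$, and let $\mathfrak g=\mathfrak t\oplus\mathfrak p$ be the $B$-orthogonal decomposition. Let $\Delta$ be the root system of $\mathfrak g_{\mathbb C}$ relative to $\mathfrak t_{\mathbb C}$, $\Delta^+$ the positive roots relative to some base of simple roots, $\mathfrak p_\alpha=\mathfrak g\cap(\mathfrak g_\alpha\oplus\mathfrak g_{-\alpha})$ for $\alpha\in\Delta^+$, and $[\alpha\beta\gamma]=\sum_{i,j,k}B([X_i^\alpha,X_j^\beta],X_k^\gamma)^2$, the sum being over $(-B)$-orthonormal bases of $\mathfrak p_\alpha,\mathfrak p_\beta,\mathfrak p_\gamma$. Endow the full flag manifold $G/T$ with the standard metric $g_B=-B|_{\mathfrak p\times\mathfrak p}$. Identify the $G$-invariant symmetric $2$-tensors on $G/T$ with the space $\mathrm{Sym}(\mathfrak p)^T$ of symmetric endomorphisms of $\mathfrak p$ commuting with the isotropy representation; let $L_{\mathfrak p}$ be the Lichnerowicz Laplacian of $g_B$ acting on $\mathrm{Sym}(\mathfrak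 p)^T$, and let $\mathcal{TT}^G\subset\mathrm{Sym}(\mathfrak p)^T$ be the subspace of traceless, divergence-free tensors. For $\alpha\in\Delta^+$ let $I_\alpha\in\mathrm{Sym}(\mathfrak p)^T$ be $(\dim\mathfrak p_\alpha)^{-1/2}$ times the orthogonal projection onto $\mathfrak p_\alpha$. Let $A_{\mathfrak g}=[a_{\alpha,\beta}]_{\alpha,\beta\in\Delta^+}$ with $a_{\alpha,\beta}=1$ if $\alpha+\beta\in\Delta$ or $\alpha-\beta\in\Delta$, and $a_{\alpha,\beta}=0$ otherwise. Below, $\lambda^{(m)}$ means that $\lambda$ is repeated $m$ times. (1) Suppose that $\mathfrak g$ is $\mathfrak{su}(n)$ with $n\ge2$, $\mathfrak{so}(2n)$ with $n\ge3$, $\mathfrak e_6$, $\mathfrak e_7$ or $\mathfrak e_8$, i.e. has type $A_{n-1}$, $D_n$, $E_6$, $E_7$, $E_8$, and put respectively $$\kappa_{\mathfrak g}=2(n-2),\ 4(n-2),\ 20,\ 32,\ 56,\qquad b_{\mathfrak g}=\tfrac1n,\ \tfrac1{2(n-1)},\ \tfrac1{12},\ \tfrac1{18},\ \tfrac1{30}.$$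 Then $[\alpha\beta\gamma]=b_{\mathfrak g}$ if one of $\alpha,\beta,\gamma\in\Delta^+$ is the sum of the other two, and $[\alpha\beta\gamma]=0$ otherwise; every row of $A_{\mathfrak g}$ has exactly $\kappa_{\mathfrak g}$ entries equal to $1$; and $\{I_\alpha\}_{\alpha\in\Delta^+}$ is a basis of $\mathrm{Sym}(\mathfrak p)^T$, orthonormal for $\langle A,B\rangle=\operatorname{tr}AB$, in which the matrix of $L_{\mathfrak p}$ is $$[L_{\mathfrak p}]=\tfrac{b_{\mathfrak g}}2\,(\kappa_{\mathfrak g}I-A_{\mathfrak g}).$$ (2) The spectrum of $A_{\mathfrak g}$, with multiplicities, is - $\{2,(-1)^{(2)}\}$ for $\mathfrak{su}(3)$; - $\{2(n-2),\ (n-4)^{(n-1)},\ (-2)^{(n(n-3)/2)}\}$ for $\mathfrak{su}(n)$, $n\ge4$; - $\{4,(-2)^{(2)},0^{(3)}\}$ for $\mathfrak{so}(6)$; - $\{4(n-2),\ (2(n-4))^{(n-1)},\ (-4)^{(n(n-3)/2)},\ 0^{(n(n-1)/2)}\}$ for $\mathfrak{so}(2n)$, $n\ge4$; - $\{20,2^{(20)},(-4)^{(15)}\}$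 for $\mathfrak e_6$; - $\{32,4^{(27)},(-4)^{(35)}\}$ for $\mathfrak e_7$; - $\{56,8^{(35)},(-4)^{(84)}\}$ for $\mathfrak e_8$. (3) In the cases of (2), $L_{\mathfrak p}$ preserves $\mathcal{TT}^G$ and is diagonalizable there, and its spectrum on $\mathcal{TT}^G$, with multiplicities, is - $\{(\tfrac12)^{(2)}\}$ for $\mathrm{SU}(3)/T^2$; - $\{(\tfrac12)^{(n-1)},(\tfrac{n-1}n)^{(n(n-3)/2)}\}$ for $\mathrm{SU}(n)/T^{n-1}$, $n\ge4$; - $\{(\tfrac12)^{(3)},(\tfrac34)^{(2)}\}$ for $\mathrm{SO}(6)/T^3$; - $\{(\tfrac n{2(n-1)})^{(n-1)},(\tfrac{n-2}{n-1})^{(n(n-1)/2)},1^{(n(n-3)/2)}\}$ for $\mathrm{SO}(2n)/T^n$, $n\ge4$; - $\{(\tfrac34)^{(20)},1^{(15)}\}$ for $E_6/T^6$; - $\{(\tfrac79)^{(27)},1^{(35)}\}$ for $E_7/T^7$; - $\{(\tfrac45)^{(35)},1^{(84)}\}$ for $E_8/T^8$. Consequently the smallest eigenvalue $\lambda_{\mathfrak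 p}$ and the largest eigenvalue $\lambda_{\mathfrak p}^{\max}$ of $L_{\mathfrak p}$ on $\mathcal{TT}^G$ are, in this order of the spaces, $(\lambda_{\mathfrak p},\lambda_{\mathfrak p}^{\max})=(\tfrac12,\tfrac12)$, $(\tfrac12,\tfrac{n-1}n)$, $(\tfrac12,\tfrac34)$, $(\tfrac n{2(n-1)},1)$, $(\tfrac34,1)$, $(\tfrac79,1)$, $(\tfrac45,1)$. -/

import Mathlib

open scoped TensorProduct

noncomputable section

namespace FullFlag

open Module

/-! ### Compact semisimple Lie algebras and their maximal tori -/

/-- The Lie algebra of a compact semisimple Lie group: a finite-dimensional real Lie algebra whose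
Killing form is negative definite. -/
class IsCompactSemisimple (𝔤 : Type*) [LieRing 𝔤] [LieAlgebra ℝ 𝔤] : Prop where
  killing_neg : ∀ x : 𝔤, x ≠ 0 → killingForm ℝ 𝔤 x x < 0

/-- The Lie algebra of a maximal torus: a maximal abelian subalgebra. -/
class IsMaximalTorus {𝔤 : Type*} [LieRing 𝔤] [LieAlgebra ℝ 𝔤] (𝔱 : LieSubalgebra ℝ 𝔤) : Prop where
  abelian : ∀ x ∈ 𝔱, ∀ y ∈ 𝔱, ⁅x, y⁆ = 0
  maximal : ∀ x : 𝔤, (∀ y ∈ 𝔱, ⁅x, y⁆ = 0) → x ∈ 𝔱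

variable {𝔤 : Type*} [LieRing 𝔤] [LieAlgebra ℝ 𝔤]

/-! ### The Killing metric, orthogonal projections and orthonormal bases -/

variable (𝔤) in
/-- The bi-invariant inner product on `𝔤`, minus the Killing form. -/
def ip : LinearMap.BilinForm ℝ 𝔤 := -killingForm ℝ 𝔤

lemma ip_symm (x y : 𝔤) : ip 𝔤 x y = ip 𝔤 y x := by
  simp [ip, LieModule.traceForm_comm ℝ 𝔤 𝔤 x y]

/-- The inner product is invariant under the adjoint action. -/
lemma ip_lie (x y z : 𝔤) : ip 𝔤 ⁅x, y⁆ z = -ip 𝔤 y ⁅x, z⁆ := by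
  have h := LieModule.traceForm_apply_lie_apply ℝ 𝔤 𝔤 y x z
  rw [← lie_skew, map_neg, LinearMap.neg_apply]
  simp only [ip, LinearMap.neg_apply]
  rw [h]

section Compact

variable [IsCompactSemisimple 𝔤]

lemma ip_pos (x : 𝔤) (hx : x ≠ 0) : 0 < ip 𝔤 x x := by
  simpa [ip] using IsCompactSemisimple.killing_neg x hx

lemma eq_zero_of_ip (x : 𝔤) (hx : ip 𝔤 x x = 0) : x = 0 := by
  by_contra h
  exact (ip_pos x h).ne' hx

variable [FiniteDimensional ℝ 𝔤]

lemma isCompl_orthogonal (W : Submodule ℝ 𝔤) : IsCompl W ((ip 𝔤).orthogonal W) := by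
  have hr : (ip 𝔤).IsRefl := fun x y h => by rw [ip_symm]; exact h
  refine (LinearMap.BilinForm.isCompl_orthogonal_iff_disjoint hr).2 ?_
  rw [Submodule.disjoint_def]
  intro x hx hx'
  exact eq_zero_of_ip x (hx' x hx)

/-- The orthogonal projection onto a subspace of `𝔤`. -/
def proj (W : Submodule ℝ 𝔤) : 𝔤 →ₗ[ℝ] W :=
  Submodule.projectionOnto W _ (isCompl_orthogonal W)

lemma exists_onb (W : Submodule ℝ 𝔤) :
    ∃ e : Basis (Fin (finrank ℝ W)) ℝ W,
      ∀ i j, ip 𝔤 (e i) (e j) = if i = j then 1 else 0 := by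
  let c : InnerProductSpace.Core ℝ W :=
    { inner := fun x y => ip 𝔤 x y
      conj_inner_symm := fun x y => by simpa using ip_symm _ _
      re_inner_nonneg := fun x => by
        by_cases h : (x : 𝔤) = 0
        · simp [h]
        · simpa using (ip_pos (x : 𝔤) h).le
      add_left := fun x y z => by simp
      smul_left := fun x y r => by simp
      definite := fun x hx => Subtype.ext (eq_zero_of_ip (x : 𝔤) hx) }
  let _ : NormedAddCommGroup W := c.toNormedAddCommGroup
  let _ : InnerProductSpace ℝ W := InnerProductSpace.ofCore c.toCore
  refine ⟨(stdOrthonormalBasis ℝ W).toBasis, fun i j => ?_⟩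
  have h := orthonormal_iff_ite.1 (stdOrthonormalBasis ℝ W).orthonormal i j
  rw [OrthonormalBasis.coe_toBasis]
  exact h

/-- An orthonormal basis of a subspace of `𝔤`. -/
def onb (W : Submodule ℝ 𝔤) : Basis (Fin (finrank ℝ W)) ℝ W := (exists_onb W).choose

lemma ip_onb (W : Submodule ℝ 𝔤) (i j : Fin (finrank ℝ W)) :
    ip 𝔤 (onb W i) (onb W j) = if i = j then 1 else 0 := (exists_onb W).choose_spec i j


/-! ### The reductive decomposition and the Levi-Civita connection of `G/T` -/

variable (𝔱 : LieSubalgebra ℝ 𝔤)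

/-- The reductive complement `𝔭 ≅ T_o(G/T)`, the Killing-orthogonal complement of `𝔱`. -/
abbrev 𝔭 : Submodule ℝ 𝔤 := (ip 𝔤).orthogonal 𝔱.toSubmodule

/-- For `X : 𝔤`, the endomorphism `Y ↦ [X, Y]_𝔭` of `𝔭`. For `X ∈ 𝔱` it is the isotropy
representation; for `X ∈ 𝔭` it is `ad_𝔭 X`. -/
def adP : 𝔤 →ₗ[ℝ] End ℝ (𝔭 𝔱) where
  toFun X := proj (𝔭 𝔱) ∘ₗ (LieAlgebra.ad ℝ 𝔤 X : End ℝ 𝔤) ∘ₗ (𝔭 𝔱).subtype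
  map_add' X Y := by ext; simp
  map_smul' r X := by ext; simp

/-- The commutator of endomorphisms. -/
def comm (A B : End ℝ (𝔭 𝔱)) : End ℝ (𝔭 𝔱) := A * B - B * A

/-- The Levi-Civita connection of the standard metric `g_B = -B|𝔭` at the origin, acting on
invariant fields: `Λ(X)Y = ½[X, Y]_𝔭`. The covariant derivative of the invariant tensor field
determined by a tensor `T` on `𝔭` is, in the direction `X`, the one determined by `Λ(X)·T`. -/
def levi : 𝔭 𝔱 →ₗ[ℝ] End ℝ (𝔭 𝔱) := (1 / 2 : ℝ) • (adP 𝔱 ∘ₗ (𝔭 𝔱).subtype)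

/-- The connection is torsion-free. -/
lemma levi_torsion (X Y : 𝔭 𝔱) : levi 𝔱 X Y - levi 𝔱 Y X = adP 𝔱 X Y := by
  have h : adP 𝔱 Y X = -adP 𝔱 X Y := by
    simp only [adP, LinearMap.coe_mk, AddHom.coe_mk, LinearMap.comp_apply, Submodule.subtype_apply,
      LieAlgebra.ad_apply]
    rw [← lie_skew, map_neg]
  simp only [levi, LinearMap.smul_apply, LinearMap.comp_apply, Submodule.subtype_apply]
  rw [h, ← smul_sub, sub_neg_eq_add, ← two_smul ℝ (adP 𝔱 X Y), smul_smul]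
  norm_num

lemma ip_proj (W : Submodule ℝ 𝔤) (x : 𝔤) (y : W) : ip 𝔤 (proj W x) y = ip 𝔤 x y := by
  have h := Submodule.sub_projection_mem (isCompl_orthogonal W) x y y.2
  change ip 𝔤 y (x - (proj W x : 𝔤)) = 0 at h
  rw [map_sub, sub_eq_zero] at h
  rw [ip_symm, ← h, ip_symm]

/-- The connection is compatible with the metric. -/
lemma levi_metric (X Y Z : 𝔭 𝔱) : ip 𝔤 (levi 𝔱 X Y) Z = -ip 𝔤 Y (levi 𝔱 X Z) := by
  have h : ∀ Y Z : 𝔭 𝔱, ip 𝔤 (adP 𝔱 X Y) Z = ip 𝔤 ⁅(X : 𝔤), (Y : 𝔤)⁆ Z :=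
    fun Y Z => ip_proj (𝔭 𝔱) _ Z
  simp only [levi, LinearMap.smul_apply, LinearMap.comp_apply, Submodule.subtype_apply,
    Submodule.coe_smul, map_smul]
  rw [ip_symm (Y : 𝔤) (adP 𝔱 (X : 𝔤) Z), h, h, ip_lie (X : 𝔤) Y Z,
    ip_symm (Y : 𝔤) ⁅(X : 𝔤), (Z : 𝔤)⁆, smul_neg]

/-- The curvature tensor of `g_B` at the origin,
`R(X, Y) = [Λ(X), Λ(Y)] - Λ([X, Y]_𝔭) - ad([X, Y]_𝔱)`. -/
def curv (X Y : 𝔭 𝔱) : End ℝ (𝔭 𝔱) :=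
  comm 𝔱 (levi 𝔱 X) (levi 𝔱 Y) - levi 𝔱 (adP 𝔱 X Y) -
    adP 𝔱 (proj 𝔱.toSubmodule ⁅(X : 𝔤), (Y : 𝔤)⁆ : 𝔤)

/-- The Ricci operator of `g_B` at the origin, `Ric(Y) = ∑ R(Y, Xᵢ)Xᵢ`. -/
def ric : End ℝ (𝔭 𝔱) where
  toFun Y := ∑ i, curv 𝔱 Y (onb (𝔭 𝔱) i) (onb (𝔭 𝔱) i)
  map_add' Y Z := by
    rw [← Finset.sum_add_distrib]
    refine Finset.sum_congr rfl fun i _ => ?_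
    simp [curv, comm]
    abel
  map_smul' r Y := by
    simp [curv, comm, smul_sub, Finset.smul_sum]

/-- The action of the curvature on symmetric endomorphisms, `(R°A)(Y) = ∑ R(Y, Xᵢ)(A Xᵢ)`; in
terms of bilinear forms, `(R°h)(Y, Z) = ∑ h(R(Xᵢ, Y)Z, Xᵢ)`. -/
def curvAct (A : End ℝ (𝔭 𝔱)) : End ℝ (𝔭 𝔱) where
  toFun Y := ∑ i, curv 𝔱 Y (onb (𝔭 𝔱) i) (A (onb (𝔭 𝔱) i))
  map_add' Y Z := by
    rw [← Finset.sum_add_distrib]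
    refine Finset.sum_congr rfl fun i _ => ?_
    simp [curv, comm]
    abel
  map_smul' r Y := by
    simp [curv, comm, smul_sub, Finset.smul_sum]

/-- The rough Laplacian `∇^*∇ = -∑ ∇²_{Xᵢ, Xᵢ}` on invariant `2`-tensors, written in terms of
endomorphisms of `𝔭`; here `∇²_{X, Y} = Λ(X)·Λ(Y)· - Λ(Λ(X)Y)·` and `Λ(X)·A = [Λ(X), A]`. -/
def roughLaplacian (A : End ℝ (𝔭 𝔱)) : End ℝ (𝔭 𝔱) :=
  -∑ i, (comm 𝔱 (levi 𝔱 (onb (𝔭 𝔱) i)) (comm 𝔱 (levi 𝔱 (onb (𝔭 𝔱) i)) A) -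
    comm 𝔱 (levi 𝔱 (levi 𝔱 (onb (𝔭 𝔱) i) (onb (𝔭 𝔱) i))) A)

/-- The Lichnerowicz Laplacian `Δ_L h = ∇^*∇h + Ric∘h + h∘Ric - 2R°h` of `(G/T, g_B)` on
invariant symmetric `2`-tensors `h = ⟨A·, ·⟩`, written in terms of `A`. -/
def lichnerowicz : End ℝ (End ℝ (𝔭 𝔱)) where
  toFun A := roughLaplacian 𝔱 A + ric 𝔱 * A + A * ric 𝔱 - (2 : ℝ) • curvAct 𝔱 A
  map_add' A B := by
    have h₁ : roughLaplacian 𝔱 (A + B) = roughLaplacian 𝔱 A + roughLaplacian 𝔱 B := by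
      simp only [roughLaplacian]
      rw [← neg_add, ← Finset.sum_add_distrib]
      congr 1
      refine Finset.sum_congr rfl fun i _ => ?_
      simp only [comm, mul_add, add_mul, mul_sub, sub_mul]
      abel
    have h₂ : curvAct 𝔱 (A + B) = curvAct 𝔱 A + curvAct 𝔱 B := by
      ext Y
      simp [curvAct, Finset.sum_add_distrib]
    rw [h₁, h₂, mul_add, add_mul, smul_add]
    abel
  map_smul' r A := by
    have h₁ : roughLaplacian 𝔱 (r • A) = r • roughLaplacian 𝔱 A := by
      simp only [roughLaplacian, comm, smul_neg, Finset.smul_sum, smul_sub, mul_smul_comm,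
        smul_mul_assoc, mul_sub, sub_mul]
    have h₂ : curvAct 𝔱 (r • A) = r • curvAct 𝔱 A := by
      ext Y
      simp [curvAct, Finset.smul_sum]
    rw [h₁, h₂, mul_smul_comm, smul_mul_assoc, smul_comm (2 : ℝ) r]
    simp only [smul_add, smul_sub, RingHom.id_apply]

/-- `Sym(𝔭)^T`, the `g_B`-symmetric endomorphisms of `𝔭` commuting with the isotropy
representation; it is identified with the `G`-invariant symmetric `2`-tensors on `G/T`. -/
def symInv : Submodule ℝ (End ℝ (𝔭 𝔱)) where
  carrier := {A | (∀ X Y : 𝔭 𝔱, ip 𝔤 (A X) Y = ip 𝔤 X (A Y)) ∧ ∀ Z ∈ 𝔱, comm 𝔱 (adP 𝔱 Z) A = 0}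
  add_mem' := by
    rintro A B ⟨hA, hA'⟩ ⟨hB, hB'⟩
    exact ⟨fun X Y => by simp [hA, hB], fun Z hZ => by
      have h : comm 𝔱 (adP 𝔱 Z) (A + B) = comm 𝔱 (adP 𝔱 Z) A + comm 𝔱 (adP 𝔱 Z) B := by
        simp only [comm, mul_add, add_mul]
        abel
      rw [h, hA' Z hZ, hB' Z hZ, add_zero]⟩
  zero_mem' := ⟨fun X Y => by simp, fun Z _ => by simp [comm]⟩
  smul_mem' := by
    rintro r A ⟨hA, hA'⟩
    exact ⟨fun X Y => by simp [hA], fun Z hZ => by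
      have h : comm 𝔱 (adP 𝔱 Z) (r • A) = r • comm 𝔱 (adP 𝔱 Z) A := by
        simp only [comm, mul_smul_comm, smul_mul_assoc, smul_sub]
      rw [h, hA' Z hZ, smul_zero]⟩

/-- The divergence of the invariant symmetric `2`-tensor `⟨A·, ·⟩` at the origin, as a vector of `𝔭`:
`div A = ∑ (∇_{Xᵢ}A)(Xᵢ) = ∑ [Λ(Xᵢ), A](Xᵢ)`. -/
def diverg : End ℝ (𝔭 𝔱) →ₗ[ℝ] 𝔭 𝔱 where
  toFun A := ∑ i, comm 𝔱 (levi 𝔱 (onb (𝔭 𝔱) i)) A (onb (𝔭 𝔱) i)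
  map_add' A B := by
    rw [← Finset.sum_add_distrib]
    refine Finset.sum_congr rfl fun i _ => ?_
    simp [comm]
    abel
  map_smul' r A := by
    simp [comm, smul_sub, Finset.smul_sum]

/-- The `G`-invariant TT-tensors of `(G/T, g_B)`: the elements of `Sym(𝔭)^T` which are traceless
and divergence-free. -/
def ttInv : Submodule ℝ (End ℝ (𝔭 𝔱)) :=
  symInv 𝔱 ⊓ LinearMap.ker (LinearMap.trace ℝ (𝔭 𝔱)) ⊓ LinearMap.ker (diverg 𝔱)

/-- The eigenvalues of the Lichnerowicz Laplacian on the invariant TT-tensors. -/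
def ttEigenvalues : Set ℝ := {μ | ∃ A ∈ ttInv 𝔱, A ≠ 0 ∧ lichnerowicz 𝔱 A = μ • A}

/-- The Lichnerowicz Laplacian preserves the invariant TT-tensors and has spectrum `S` there,
the eigenvalues being listed with their multiplicities. -/
def HasTTSpectrum (S : Multiset ℝ) : Prop :=
  (∀ A ∈ ttInv 𝔱, lichnerowicz 𝔱 A ∈ ttInv 𝔱) ∧
  finrank ℝ (ttInv 𝔱) = Multiset.card S ∧
  ∀ μ : ℝ, finrank ℝ (ttInv 𝔱 ⊓ End.eigenspace (lichnerowicz 𝔱) μ : Submodule ℝ _) = S.count μ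

end Compact

/-! ### The root system -/

/-- The complexification `𝔱_ℂ` as a subalgebra of `𝔤_ℂ`. -/
def cartan (𝔱 : LieSubalgebra ℝ 𝔤) : LieSubalgebra ℂ (ℂ ⊗[ℝ] 𝔤) where
  __ := 𝔱.toSubmodule.baseChange ℂ
  lie_mem' := by
    intro x y hx hy
    change x ∈ 𝔱.toSubmodule.baseChange ℂ at hx
    change y ∈ 𝔱.toSubmodule.baseChange ℂ at hy
    change ⁅x, y⁆ ∈ 𝔱.toSubmodule.baseChange ℂ
    rw [Submodule.baseChange_eq_span] at hx hy
    induction hx, hy using Submodule.span_induction₂ with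
    | mem_mem x y hx hy =>
      obtain ⟨a, ha, rfl⟩ := hx
      obtain ⟨b, hb, rfl⟩ := hy
      have h := LieAlgebra.ExtendScalars.bracket_tmul ℝ ℂ 𝔤 𝔤 1 1 a b
      rw [mul_one] at h
      exact (congrArg (· ∈ 𝔱.toSubmodule.baseChange ℂ) h).mpr
        (Submodule.tmul_mem_baseChange_of_mem (A := ℂ) (1 : ℂ) (𝔱.lie_mem ha hb))
    | zero_left y hy => rw [zero_lie]; exact zero_mem _
    | zero_right x hx =>
      exact (congrArg (· ∈ 𝔱.toSubmodule.baseChange ℂ) (lie_zero x)).mpr (zero_mem _)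
    | add_left x y z _ _ _ h h' => rw [LieRing.add_lie]; exact add_mem h h'
    | add_right x y z _ _ _ h h' => rw [LieRing.lie_add]; exact add_mem h h'
    | smul_left r x y _ _ h => rw [smul_lie]; exact Submodule.smul_mem _ r h
    | smul_right r x y _ _ h =>
      exact (congrArg (· ∈ 𝔱.toSubmodule.baseChange ℂ) (LieAlgebra.lie_smul r x y)).mpr
        (Submodule.smul_mem _ r h)

lemma mem_cartan {𝔱 : LieSubalgebra ℝ 𝔤} {z : ℂ ⊗[ℝ] 𝔤} :
    z ∈ cartan 𝔱 ↔ z ∈ 𝔱.toSubmodule.baseChange ℂ := Iff.rfl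

variable (𝔤) in
/-- Real part of an element of `𝔤_ℂ`. -/
def rePart : ℂ ⊗[ℝ] 𝔤 →ₗ[ℝ] 𝔤 := TensorProduct.lid ℝ 𝔤 ∘ₗ Complex.reLm.rTensor 𝔤

variable (𝔤) in
/-- Imaginary part of an element of `𝔤_ℂ`. -/
def imPart : ℂ ⊗[ℝ] 𝔤 →ₗ[ℝ] 𝔤 := TensorProduct.lid ℝ 𝔤 ∘ₗ Complex.imLm.rTensor 𝔤

@[simp] lemma rePart_tmul (a : ℂ) (x : 𝔤) : rePart 𝔤 (a ⊗ₜ x) = a.re • x := by simp [rePart]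

@[simp] lemma imPart_tmul (a : ℂ) (x : 𝔤) : imPart 𝔤 (a ⊗ₜ x) = a.im • x := by simp [imPart]

lemma eq_re_add_im (z : ℂ ⊗[ℝ] 𝔤) :
    z = (1 : ℂ) ⊗ₜ[ℝ] rePart 𝔤 z + Complex.I ⊗ₜ[ℝ] imPart 𝔤 z := by
  induction z with
  | zero => simp
  | tmul a x =>
    rw [rePart_tmul, imPart_tmul, TensorProduct.tmul_smul, TensorProduct.tmul_smul,
      TensorProduct.smul_tmul', TensorProduct.smul_tmul', ← TensorProduct.add_tmul]
    congr 1
    apply Complex.ext <;> simp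
  | add x y hx hy =>
    rw [map_add, map_add, TensorProduct.tmul_add, TensorProduct.tmul_add]
    nth_rewrite 1 [hx, hy]
    abel

lemma parts_mem (𝔱 : LieSubalgebra ℝ 𝔤) (z : ℂ ⊗[ℝ] 𝔤) (hz : z ∈ cartan 𝔱) :
    rePart 𝔤 z ∈ 𝔱 ∧ imPart 𝔤 z ∈ 𝔱 := by
  obtain ⟨w, rfl⟩ := hz
  induction w with
  | zero => simp
  | tmul a x =>
    have h : (𝔱.toSubmodule.subtype.baseChange ℂ) (a ⊗ₜ[ℝ] x) = a ⊗ₜ[ℝ] (x : 𝔤) := rfl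
    exact ⟨by simpa [h] using 𝔱.smul_mem a.re x.2, by simpa [h] using 𝔱.smul_mem a.im x.2⟩
  | add x y hx hy =>
    rw [map_add, map_add, map_add]
    exact ⟨𝔱.add_mem hx.1 hy.1, 𝔱.add_mem hx.2 hy.2⟩

/-- The complexification of a compact semisimple Lie algebra has non-degenerate Killing form. -/
instance [FiniteDimensional ℝ 𝔤] [IsCompactSemisimple 𝔤] :
    LieAlgebra.IsKilling ℂ (ℂ ⊗[ℝ] 𝔤) where
  killingCompl_top_eq_bot := by
    rw [eq_bot_iff]
    intro z hz
    rw [LieIdeal.mem_killingCompl] at hz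
    have key : ∀ u x y : 𝔤, killingForm ℂ (ℂ ⊗[ℝ] 𝔤) ((1 : ℂ) ⊗ₜ[ℝ] u)
        ((1 : ℂ) ⊗ₜ[ℝ] x + Complex.I ⊗ₜ[ℝ] y) =
          (killingForm ℝ 𝔤 u x : ℂ) + Complex.I * (killingForm ℝ 𝔤 u y : ℂ) := by
      intro u x y
      have h := LieModule.traceForm_baseChange ℝ 𝔤 𝔤 ℂ
      rw [map_add]
      change LieModule.traceForm ℂ (ℂ ⊗[ℝ] 𝔤) (ℂ ⊗[ℝ] 𝔤) _ _ +
        LieModule.traceForm ℂ (ℂ ⊗[ℝ] 𝔤) (ℂ ⊗[ℝ] 𝔤) _ _ = _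
      rw [h]
      simp [mul_comm]
    rw [eq_re_add_im z] at hz ⊢
    have h₀ : ∀ u : 𝔤, killingForm ℝ 𝔤 u (rePart 𝔤 z) = 0 ∧
        killingForm ℝ 𝔤 u (imPart 𝔤 z) = 0 := by
      intro u
      have h := hz ((1 : ℂ) ⊗ₜ[ℝ] u) trivial
      rw [key] at h
      have h1 := congrArg Complex.re h
      have h2 := congrArg Complex.im h
      simp only [Complex.add_re, Complex.add_im, Complex.mul_re, Complex.mul_im, Complex.ofReal_re,
        Complex.ofReal_im, Complex.I_re, Complex.I_im, Complex.zero_re, Complex.zero_im] at h1 h2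
      exact ⟨by linarith, by linarith⟩
    have h1 := eq_zero_of_ip (rePart 𝔤 z) (by simp [ip, (h₀ _).1])
    have h2 := eq_zero_of_ip (imPart 𝔤 z) (by simp [ip, (h₀ _).2])
    rw [h1, h2]
    simp

lemma mem_of_normalizes [IsCompactSemisimple 𝔤] (𝔱 : LieSubalgebra ℝ 𝔤) [IsMaximalTorus 𝔱]
    (x : 𝔤) (hx : ∀ y ∈ 𝔱, ⁅x, y⁆ ∈ 𝔱) : x ∈ 𝔱 := by
  refine IsMaximalTorus.maximal x fun y hy => eq_zero_of_ip _ ?_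
  have h : ⁅y, ⁅y, x⁆⁆ = 0 := by
    rw [← lie_skew y x, lie_neg, IsMaximalTorus.abelian y hy _ (hx y hy), neg_zero]
  rw [← lie_skew]
  simp only [map_neg, LinearMap.neg_apply, neg_neg]
  rw [ip_lie, h, map_zero, neg_zero]

/-- The complexification of a maximal torus is a Cartan subalgebra. -/
instance [IsCompactSemisimple 𝔤] (𝔱 : LieSubalgebra ℝ 𝔤) [IsMaximalTorus 𝔱] :
    (cartan 𝔱).IsCartanSubalgebra where
  nilpotent := by
    have hab : ∀ x ∈ cartan 𝔱, ∀ y ∈ cartan 𝔱, ⁅x, y⁆ = 0 := by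
      intro x hx y hy
      rw [mem_cartan, Submodule.baseChange_eq_span] at hx hy
      induction hx, hy using Submodule.span_induction₂ with
      | mem_mem x y hx hy =>
        obtain ⟨a, ha, rfl⟩ := hx
        obtain ⟨b, hb, rfl⟩ := hy
        have h := LieAlgebra.ExtendScalars.bracket_tmul ℝ ℂ 𝔤 𝔤 1 1 a b
        rw [IsMaximalTorus.abelian a ha b hb, TensorProduct.tmul_zero] at h
        exact h
      | zero_left y hy => exact zero_lie y
      | zero_right x hx => exact lie_zero x
      | add_left x y z _ _ _ h h' => rw [LieRing.add_lie, h, h', add_zero]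
      | add_right x y z _ _ _ h h' => rw [LieRing.lie_add, h, h', add_zero]
      | smul_left r x y _ _ h => rw [smul_lie, h, smul_zero]
      | smul_right r x y _ _ h => exact (LieAlgebra.lie_smul r x y).trans (by rw [h, smul_zero])
    have : IsLieAbelian (cartan 𝔱) := ⟨fun x y => Subtype.ext (hab x x.2 y y.2)⟩
    infer_instance
  self_normalizing := by
    refine le_antisymm ?_ (LieSubalgebra.le_normalizer _)
    intro z hz
    rw [LieSubalgebra.mem_normalizer_iff] at hz
    have key : ∀ y ∈ 𝔱, ⁅rePart 𝔤 z, y⁆ ∈ 𝔱 ∧ ⁅imPart 𝔤 z, y⁆ ∈ 𝔱 := by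
      intro y hy
      have h := hz ((1 : ℂ) ⊗ₜ[ℝ] y) (Submodule.tmul_mem_baseChange_of_mem (A := ℂ) (1 : ℂ) hy)
      have h' : ⁅z, (1 : ℂ) ⊗ₜ[ℝ] y⁆ =
          (1 : ℂ) ⊗ₜ[ℝ] ⁅rePart 𝔤 z, y⁆ + Complex.I ⊗ₜ[ℝ] ⁅imPart 𝔤 z, y⁆ := by
        nth_rewrite 1 [eq_re_add_im z]
        rw [LieRing.add_lie]
        have h1 := LieAlgebra.ExtendScalars.bracket_tmul ℝ ℂ 𝔤 𝔤 1 1 (rePart 𝔤 z) y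
        have h2 := LieAlgebra.ExtendScalars.bracket_tmul ℝ ℂ 𝔤 𝔤 Complex.I 1 (imPart 𝔤 z) y
        rw [mul_one] at h1 h2
        exact congrArg₂ (· + ·) h1 h2
      rw [h'] at h
      have h3 := parts_mem 𝔱 _ h
      simpa using h3
    rw [eq_re_add_im z]
    exact add_mem
      (Submodule.tmul_mem_baseChange_of_mem (A := ℂ) (1 : ℂ)
        (mem_of_normalizes 𝔱 _ fun y hy => (key y hy).1))
      (Submodule.tmul_mem_baseChange_of_mem (A := ℂ) Complex.I
        (mem_of_normalizes 𝔱 _ fun y hy => (key y hy).2))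

section Roots

variable [FiniteDimensional ℝ 𝔤] [IsCompactSemisimple 𝔤]
variable (𝔱 : LieSubalgebra ℝ 𝔤) [IsMaximalTorus 𝔱]

/-- The root system `Δ` of `𝔤_ℂ` relative to `𝔱_ℂ`. -/
abbrev roots : RootPairing (cartan 𝔱).root ℂ (Dual ℂ (cartan 𝔱)) (cartan 𝔱) :=
  LieAlgebra.IsKilling.rootSystem (cartan 𝔱)

variable {𝔱}

/-- The Cartan matrix of a base of simple roots equals `C`, up to the numbering of the simple
roots. -/
def HasCartanMatrix (b : (roots 𝔱).Base) {l : ℕ} (C : Matrix (Fin l) (Fin l) ℤ) : Prop :=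
  ∃ e : b.support ≃ Fin l, ∀ i j, b.cartanMatrix i j = C (e i) (e j)

/-- The set `Δ⁺` of positive roots relative to a base of simple roots. -/
abbrev PosRoot (b : (roots 𝔱).Base) : Type _ := {α : (cartan 𝔱).root // b.IsPos α}

instance (b : (roots 𝔱).Base) : Fintype (PosRoot b) := Fintype.ofFinite _

instance (b : (roots 𝔱).Base) : DecidableEq (PosRoot b) := Classical.decEq _

variable {b : (roots 𝔱).Base}

/-- A positive root as a linear form on `𝔱_ℂ`. -/
def PosRoot.form (α : PosRoot b) : Dual ℂ (cartan 𝔱) := (roots 𝔱).root α.1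

/-- The real subspace `𝔭_α = 𝔤 ∩ (𝔤_α ⊕ 𝔤_{-α})` of `𝔤`. -/
def PosRoot.space (α : PosRoot b) : Submodule ℝ 𝔤 :=
  ((LieAlgebra.rootSpace (cartan 𝔱) α.form ⊔
    LieAlgebra.rootSpace (cartan 𝔱) (-α.form)).toSubmodule.restrictScalars ℝ).comap
      (TensorProduct.mk ℝ ℂ 𝔤 1)

/-- The structural constant `[αβγ] = ∑ ⟨[Xᵢ^α, Xⱼ^β], Xₖ^γ⟩²`, the sum being over orthonormal bases
of `𝔭_α`, `𝔭_β` and `𝔭_γ`. -/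
def structConst (α β γ : PosRoot b) : ℝ :=
  ∑ i, ∑ j, ∑ k, ip 𝔤 ⁅(onb α.space i : 𝔤), (onb β.space j : 𝔤)⁆ (onb γ.space k) ^ 2

/-- `α + β ∈ Δ` or `α - β ∈ Δ`. -/
def RootAdj (α β : PosRoot b) : Prop :=
  α.form + β.form ∈ Set.range (roots 𝔱).root ∨ α.form - β.form ∈ Set.range (roots 𝔱).root

open Classical in
/-- The root-adjacency matrix `A_𝔤 = [a_{α,β}]`. -/
def rootAdjMatrix (b : (roots 𝔱).Base) : Matrix (PosRoot b) (PosRoot b) ℝ :=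
  Matrix.of fun α β => if RootAdj α β then 1 else 0

/-- The endomorphism `I_α` of `𝔭`, which is `1/√d_α` times the identity on `𝔭_α`, `d_α = dim 𝔭_α`,
and is zero on the orthogonal complement of `𝔭_α`. -/
def PosRoot.blockId (α : PosRoot b) : End ℝ (𝔭 𝔱) :=
  (1 / √(finrank ℝ α.space : ℝ)) •
    (proj (𝔭 𝔱) ∘ₗ α.space.subtype ∘ₗ proj α.space ∘ₗ (𝔭 𝔱).subtype)

/-- All nonzero structural constants of `G/T` are those of the triples of positive roots one of
which is the sum of the other two, and they are equal to `c`. -/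
def HasStructConst (b : (roots 𝔱).Base) (c : ℝ) : Prop :=
  ∀ α β γ : PosRoot b,
    ((γ.form = α.form + β.form ∨ α.form = β.form + γ.form ∨ β.form = α.form + γ.form) →
      structConst α β γ = c) ∧
    (¬ (γ.form = α.form + β.form ∨ α.form = β.form + γ.form ∨ β.form = α.form + γ.form) →
      structConst α β γ = 0)

/-- Every positive root `α` has exactly `κ` positive roots `β` with `α + β ∈ Δ` or `α - β ∈ Δ`. -/
def HasValency (b : (roots 𝔱).Base) (κ : ℕ) : Prop :=
  ∀ α : PosRoot b, Nat.card {β : PosRoot b // RootAdj α β} = κ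

/-- The `I_α`, `α ∈ Δ⁺`, form a basis of `Sym(𝔭)^T`, orthonormal for `⟨A, B⟩ = tr AB`, and `M` is
the matrix of the Lichnerowicz Laplacian of `(G/T, g_B)` in this basis. -/
def HasLichnerowiczMatrix (b : (roots 𝔱).Base) (M : Matrix (PosRoot b) (PosRoot b) ℝ) : Prop :=
  (∀ α β : PosRoot b,
    LinearMap.trace ℝ (𝔭 𝔱) (α.blockId * β.blockId) = if α = β then 1 else 0) ∧
  Submodule.span ℝ (Set.range fun α : PosRoot b => α.blockId) = symInv 𝔱 ∧
  ∀ α : PosRoot b, lichnerowicz 𝔱 α.blockId = ∑ β, M β α • β.blockId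

/-- The Lichnerowicz Laplacian of `(G/T, g_B)` on invariant symmetric `2`-tensors has matrix
`(c/2)(κ I - A_𝔤)`, where `c` is the common value of the nonzero structural constants and `κ` is the
number of `β ∈ Δ⁺` with `α ± β ∈ Δ` for some choice of the sign, which is the same for all `α`. -/
def HasLichnerowiczFormula (b : (roots 𝔱).Base) (c : ℝ) (κ : ℕ) : Prop :=
  HasStructConst b c ∧ HasValency b κ ∧
  HasLichnerowiczMatrix b ((c / 2) • ((κ : ℝ) • (1 : Matrix _ _ ℝ) - rootAdjMatrix b))

end Roots

end FullFlag
end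

/-! ### Contractions over orthonormal bases -/

noncomputable section
namespace FullFlag
open Module

section LinearAlgebra

variable {𝔤 : Type*} [LieRing 𝔤] [LieAlgebra ℝ 𝔤] [FiniteDimensional ℝ 𝔤] [IsCompactSemisimple 𝔤]

/-! On invariant tensors everything is algebra on `𝔭`. Put C_A = -∑ ad_𝔭(A Xᵢ) ad_𝔭(Xᵢ). The rough
Laplacian, the Ricci operator and the curvature action are combinations of such operators and of
terms D_A coming from the 𝔱-components of brackets. Since A commutes with the isotropy
representation, D_A = D_1 A = A D_1, the torus terms cancel, and Δ_L A = ½(C_1 A + A C_1) - C_A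
(`lichnerowicz_eq`).

Each 𝔭_α is a plane on which 𝔱 acts by rotations, and different planes are inequivalent, so Sym(𝔭)^T
is spanned by the I_α (`exists_scalar`, `span_blockId`). If all pairings are symmetric, then ⟨β,α⟩ ∈
{0, ±1} for β ≠ ±α, at most one of α ± β is a root, and the Casimir operator of 𝔭_α acts on 𝔭_β by
-(c/2)⟨β,α⟩², with c the squared root length (`casimir_space`). This yields both the structural
constants and the matrix (c/2)(κ I - A). The length follows from |α|² ∑ ⟨β,α⟩² = 4: the sum over all
roots is 2(κ + 4), so c = 2/(κ + 4).

The adjacency matrix is A = W - 4I with W = (⟨α,β⟩²). The Cartan matrix alone identifies the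
positive roots with explicit vectors (`exists_equiv_of_isModel`). Second and fourth moments of these
vectors give a relation P(t) v = c (∑ v) 1 for every eigenvector v with eigenvalue t, where P is
quadratic for A, E and D₄ and cubic for the other D. Hence κ is a simple eigenvalue with the
constants as eigenvectors, all others are zeros of P, and their multiplicities are determined by the
order of A, its trace and, for a cubic P, the trace of A² (`roots_eq_two`, `roots_eq_three`).

Finally Λ(X)X = 0 makes every element of Sym(𝔭)^T divergence-free (`diverg_eq_zero`). So the
invariant TT-tensors form the hyperplane orthogonal to the constants: the eigenvalue κ drops out and
every other r becomes (κ - r)/(κ + 4) (`HasLichnerowiczFormula.hasTTSpectrum`). -/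

lemma eq_of_ip_eq (W : Submodule ℝ 𝔤) (u v : W) (h : ∀ w : W, ip 𝔤 (u : 𝔤) w = ip 𝔤 (v : 𝔤) w) :
    u = v := by
  have h' := eq_zero_of_ip ((u - v : W) : 𝔤) (by
    have := h (u - v)
    rw [Submodule.coe_sub] at this ⊢
    rw [LinearMap.BilinForm.sub_left, this, sub_self])
  exact sub_eq_zero.1 (Subtype.ext h')

lemma sum_ip_onb (W : Submodule ℝ 𝔤) (v : W) :
    ∑ i, ip 𝔤 (v : 𝔤) (onb W i) • onb W i = v := by
  have h : ∀ j, (onb W).repr v j = ip 𝔤 (v : 𝔤) (onb W j) := by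
    intro j
    have hv : ip 𝔤 (v : 𝔤) (onb W j) =
        ip 𝔤 ((∑ i, (onb W).repr v i • onb W i : W) : 𝔤) (onb W j) := by rw [(onb W).sum_repr]
    rw [hv, Submodule.coe_sum, map_sum, LinearMap.sum_apply]
    simp only [Submodule.coe_smul, map_smul, LinearMap.smul_apply, ip_onb]
    simp
  simp_rw [← h]
  exact (onb W).sum_repr v

lemma sum_ip_onb_coe (W : Submodule ℝ 𝔤) (v : 𝔤) (hv : v ∈ W) :
    ∑ i, ip 𝔤 v (onb W i) • (onb W i : 𝔤) = v := by
  have h := congrArg (Subtype.val) (sum_ip_onb W ⟨v, hv⟩)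
  simpa [Submodule.coe_sum] using h

/-- Parseval's identity. -/
lemma sum_ip_mul_ip (W : Submodule ℝ 𝔤) (v w : 𝔤) (hv : v ∈ W) :
    ∑ i, ip 𝔤 v (onb W i) * ip 𝔤 w (onb W i) = ip 𝔤 v w := by
  conv_rhs => rw [← sum_ip_onb_coe W v hv]
  simp only [map_sum, LinearMap.sum_apply, map_smul, LinearMap.smul_apply, smul_eq_mul]
  exact Finset.sum_congr rfl fun i _ => by rw [ip_symm w]

/-- The contraction of a bilinear map with the metric of a subspace does not depend on the
orthonormal basis. -/
lemma sum_onb_eq {F ι : Type*} [AddCommGroup F] [Module ℝ F] [Fintype ι] (W : Submodule ℝ 𝔤)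
    (f : 𝔤 →ₗ[ℝ] 𝔤 →ₗ[ℝ] F) (u : ι → 𝔤) (hu : ∀ k, u k ∈ W)
    (hW : ∀ w ∈ W, ∑ k, ip 𝔤 w (u k) • u k = w) :
    ∑ j, f (onb W j) (onb W j) = ∑ k, f (u k) (u k) := by
  calc ∑ j, f (onb W j) (onb W j)
      = ∑ j, ∑ k, ip 𝔤 (onb W j : 𝔤) (u k) • f (onb W j) (u k) := by
        refine Finset.sum_congr rfl fun j _ => ?_
        conv_lhs => rw [← hW (onb W j) (onb W j).2]
        rw [map_sum]
        simp_rw [map_smul]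
        rw [hW (onb W j) (onb W j).2]
    _ = ∑ k, f (u k) (u k) := by
        rw [Finset.sum_comm]
        refine Finset.sum_congr rfl fun k _ => ?_
        have hk : f (u k) (u k) = f (∑ j, ip 𝔤 (u k) (onb W j) • (onb W j : 𝔤)) (u k) := by
          rw [sum_ip_onb_coe W (u k) (hu k)]
        rw [hk, map_sum, LinearMap.sum_apply]
        simp_rw [map_smul, LinearMap.smul_apply]
        exact Finset.sum_congr rfl fun j _ => by rw [ip_symm]

/-- Contraction of a bilinear map with a symmetric tensor. -/
lemma sum_onb_symm {F : Type*} [AddCommGroup F] [Module ℝ F] (W : Submodule ℝ 𝔤)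
    (f : W →ₗ[ℝ] W →ₗ[ℝ] F) (A : End ℝ W)
    (hA : ∀ X Y : W, ip 𝔤 (A X : 𝔤) Y = ip 𝔤 (X : 𝔤) (A Y)) :
    ∑ i, f (onb W i) (A (onb W i)) = ∑ i, f (A (onb W i)) (onb W i) := by
  have h₁ : ∀ i, A (onb W i) = ∑ j, ip 𝔤 (A (onb W i) : 𝔤) (onb W j) • onb W j :=
    fun i => (sum_ip_onb W _).symm
  calc ∑ i, f (onb W i) (A (onb W i))
      = ∑ i, ∑ j, ip 𝔤 (A (onb W i) : 𝔤) (onb W j) • f (onb W i) (onb W j) := by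
        refine Finset.sum_congr rfl fun i _ => ?_
        conv_lhs => rw [h₁ i]
        simp only [map_sum, map_smul]
    _ = ∑ i, f (A (onb W i)) (onb W i) := by
        rw [Finset.sum_comm]
        refine Finset.sum_congr rfl fun i _ => ?_
        conv_rhs => rw [h₁ i]
        simp only [map_sum, map_smul, LinearMap.sum_apply, LinearMap.smul_apply]
        exact Finset.sum_congr rfl fun j _ => by rw [hA, ip_symm]

end LinearAlgebra

/-! ### The Lichnerowicz Laplacian in terms of the operators C_A -/

section Lichnerowicz

variable {𝔤 : Type*} [LieRing 𝔤] [LieAlgebra ℝ 𝔤] [FiniteDimensional ℝ 𝔤] [IsCompactSemisimple 𝔤]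
  (𝔱 : LieSubalgebra ℝ 𝔤)

lemma adP_apply (X : 𝔤) (Y : 𝔭 𝔱) : adP 𝔱 X Y = proj (𝔭 𝔱) ⁅X, (Y : 𝔤)⁆ := rfl

lemma ip_adP (X : 𝔤) (Y Z : 𝔭 𝔱) : ip 𝔤 (adP 𝔱 X Y : 𝔤) Z = ip 𝔤 ⁅X, (Y : 𝔤)⁆ Z :=
  ip_proj _ _ _

lemma adP_swap (X Y : 𝔭 𝔱) : adP 𝔱 (X : 𝔤) Y = -adP 𝔱 (Y : 𝔤) X := by
  rw [adP_apply, adP_apply, ← lie_skew, map_neg]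

lemma adP_self (X : 𝔭 𝔱) : adP 𝔱 (X : 𝔤) X = 0 := by
  rw [adP_apply, lie_self, map_zero]

/-- Invariance of the Killing form. Together with `adP_swap` it makes ⟨[X, Y]_𝔭, Z⟩ totally skew on
𝔭. -/
lemma ip_adP_skew (X : 𝔤) (Y Z : 𝔭 𝔱) :
    ip 𝔤 (adP 𝔱 X Y : 𝔤) Z = -ip 𝔤 (Y : 𝔤) (adP 𝔱 X Z : 𝔤) := by
  rw [ip_adP, ip_lie, ip_symm (Y : 𝔤) (adP 𝔱 X Z : 𝔤), ip_adP, ip_symm]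

/-- `C_A = -∑ ad_𝔭(A Xᵢ) ad_𝔭(Xᵢ)`. -/
def casP (A : End ℝ (𝔭 𝔱)) : End ℝ (𝔭 𝔱) :=
  -∑ i, adP 𝔱 (A (onb (𝔭 𝔱) i) : 𝔤) * adP 𝔱 (onb (𝔭 𝔱) i : 𝔤)

/-- `D_A(Y) = ∑ [[Xᵢ, Y]_𝔱, A Xᵢ]`. -/
def torP (A : End ℝ (𝔭 𝔱)) : End ℝ (𝔭 𝔱) where
  toFun Y := ∑ i, adP 𝔱 (proj 𝔱.toSubmodule ⁅(onb (𝔭 𝔱) i : 𝔤), (Y : 𝔤)⁆ : 𝔤) (A (onb (𝔭 𝔱) i))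
  map_add' Y Z := by simp [Finset.sum_add_distrib]
  map_smul' r Y := by simp [Finset.smul_sum]

/-- The bilinear map `(X, Y) ↦ ad_𝔭(X) ad_𝔭(Y)`. -/
def adMul : 𝔤 →ₗ[ℝ] 𝔤 →ₗ[ℝ] End ℝ (𝔭 𝔱) :=
  (LinearMap.mul ℝ (End ℝ (𝔭 𝔱))).compl₁₂ (adP 𝔱) (adP 𝔱)

variable {𝔱}

lemma casP_eq_symm {A : End ℝ (𝔭 𝔱)}
    (hA : ∀ X Y : 𝔭 𝔱, ip 𝔤 (A X : 𝔤) Y = ip 𝔤 (X : 𝔤) (A Y)) :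
    casP 𝔱 A = -∑ i, adP 𝔱 (onb (𝔭 𝔱) i : 𝔤) * adP 𝔱 (A (onb (𝔭 𝔱) i) : 𝔤) := by
  have h := sum_onb_symm (𝔭 𝔱) ((adMul 𝔱).domRestrict₁₂ (𝔭 𝔱) (𝔭 𝔱)) A hA
  exact congrArg Neg.neg h.symm

/-- The part of R led by ad_𝔭(Y) contracts to ad_𝔭(Y) of a vanishing vector. The two remaining
𝔭-parts give -¼C_A and ½C_A, and the 𝔱-part gives D_A. -/
lemma curvAct_eq {A : End ℝ (𝔭 𝔱)}
    (hA : ∀ X Y : 𝔭 𝔱, ip 𝔤 (A X : 𝔤) Y = ip 𝔤 (X : 𝔤) (A Y)) :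
    curvAct 𝔱 A = (1 / 4 : ℝ) • casP 𝔱 A + torP 𝔱 A := by
  -- This vector equals its own negative: moving A to the other slot leaves the sum unchanged, while
  -- exchanging the two arguments of the bracket changes its sign.
  have h₀ : ∑ i, adP 𝔱 (onb (𝔭 𝔱) i : 𝔤) (A (onb (𝔭 𝔱) i)) = 0 := by
    have h := sum_onb_symm (𝔭 𝔱) (adP 𝔱 ∘ₗ (𝔭 𝔱).subtype) A hA
    simp only [LinearMap.comp_apply, Submodule.subtype_apply] at h
    have h' : ∑ i, adP 𝔱 (A (onb (𝔭 𝔱) i) : 𝔤) (onb (𝔭 𝔱) i) =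
        -∑ i, adP 𝔱 (onb (𝔭 𝔱) i : 𝔤) (A (onb (𝔭 𝔱) i)) := by
      rw [← Finset.sum_neg_distrib]
      exact Finset.sum_congr rfl fun i _ => adP_swap 𝔱 _ _
    rw [h'] at h
    rw [eq_neg_iff_add_eq_zero, ← two_smul ℝ] at h
    exact (smul_eq_zero.1 h).resolve_left two_ne_zero
  ext1 Y
  have h₁ : ∑ i, adP 𝔱 (onb (𝔭 𝔱) i : 𝔤) (adP 𝔱 (Y : 𝔤) (A (onb (𝔭 𝔱) i))) = casP 𝔱 A Y := by
    rw [casP_eq_symm hA, LinearMap.neg_apply, LinearMap.sum_apply, ← Finset.sum_neg_distrib]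
    refine Finset.sum_congr rfl fun i _ => ?_
    rw [Module.End.mul_apply, adP_swap 𝔱 Y, map_neg]
  have h₂ : ∑ i, adP 𝔱 (adP 𝔱 (Y : 𝔤) (onb (𝔭 𝔱) i) : 𝔤) (A (onb (𝔭 𝔱) i)) = -casP 𝔱 A Y := by
    rw [casP, LinearMap.neg_apply, LinearMap.sum_apply, neg_neg]
    refine Finset.sum_congr rfl fun i _ => ?_
    rw [Module.End.mul_apply, adP_swap 𝔱 (adP 𝔱 (Y : 𝔤) (onb (𝔭 𝔱) i)), adP_swap 𝔱 Y, map_neg,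
      neg_neg]
  have h₃ : ∑ i, adP 𝔱 (proj 𝔱.toSubmodule ⁅(Y : 𝔤), (onb (𝔭 𝔱) i : 𝔤)⁆ : 𝔤)
      (A (onb (𝔭 𝔱) i)) = -torP 𝔱 A Y := by
    simp only [torP, LinearMap.coe_mk, AddHom.coe_mk]
    rw [← Finset.sum_neg_distrib]
    refine Finset.sum_congr rfl fun i _ => ?_
    rw [← lie_skew, map_neg, Submodule.coe_neg, map_neg, LinearMap.neg_apply]
  have h₄ : curvAct 𝔱 A Y =
      (1 / 4 : ℝ) • adP 𝔱 (Y : 𝔤) (∑ i, adP 𝔱 (onb (𝔭 𝔱) i : 𝔤) (A (onb (𝔭 𝔱) i))) -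
      (1 / 4 : ℝ) • ∑ i, adP 𝔱 (onb (𝔭 𝔱) i : 𝔤) (adP 𝔱 (Y : 𝔤) (A (onb (𝔭 𝔱) i))) -
      (1 / 2 : ℝ) • ∑ i, adP 𝔱 (adP 𝔱 (Y : 𝔤) (onb (𝔭 𝔱) i) : 𝔤) (A (onb (𝔭 𝔱) i)) -
      ∑ i, adP 𝔱 (proj 𝔱.toSubmodule ⁅(Y : 𝔤), (onb (𝔭 𝔱) i : 𝔤)⁆ : 𝔤) (A (onb (𝔭 𝔱) i)) := by
    change ∑ i, curv 𝔱 Y (onb (𝔭 𝔱) i) (A (onb (𝔭 𝔱) i)) = _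
    rw [map_sum, Finset.smul_sum, Finset.smul_sum, Finset.smul_sum, ← Finset.sum_sub_distrib,
      ← Finset.sum_sub_distrib, ← Finset.sum_sub_distrib]
    refine Finset.sum_congr rfl fun i _ => ?_
    simp only [curv, comm, levi, LinearMap.sub_apply, Module.End.mul_apply, LinearMap.smul_apply,
      LinearMap.comp_apply, Submodule.subtype_apply, map_smul, smul_smul]
    norm_num
  rw [h₄, h₀, h₁, h₂, h₃, map_zero, LinearMap.add_apply, LinearMap.smul_apply]
  module

lemma ric_eq : ric 𝔱 = (1 / 4 : ℝ) • casP 𝔱 1 + torP 𝔱 1 := by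
  rw [← curvAct_eq (A := (1 : End ℝ (𝔭 𝔱))) fun X Y => rfl]
  rfl

lemma ip_sum_left {ι : Type*} (s : Finset ι) (f : ι → 𝔭 𝔱) (Z : 𝔤) :
    ip 𝔤 ((∑ i ∈ s, f i : 𝔭 𝔱) : 𝔤) Z = ∑ i ∈ s, ip 𝔤 (f i : 𝔤) Z := by
  rw [Submodule.coe_sum, map_sum, LinearMap.sum_apply]

lemma ip_adP_rot (X Y Z : 𝔭 𝔱) :
    ip 𝔤 (adP 𝔱 (X : 𝔤) Y : 𝔤) Z = ip 𝔤 (adP 𝔱 (Y : 𝔤) Z : 𝔤) X := by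
  rw [adP_swap, Submodule.coe_neg, map_neg, LinearMap.neg_apply, ip_adP_skew, neg_neg, ip_symm]

/-- Both sides contract two copies of the totally skew tensor ⟨[X, Y]_𝔭, Z⟩ with A and with the
metric. Cyclic symmetry and Parseval in two different indices decide which index carries A. -/
lemma sum_adP_mul_adP {A : End ℝ (𝔭 𝔱)}
    (hA : ∀ X Y : 𝔭 𝔱, ip 𝔤 (A X : 𝔤) Y = ip 𝔤 (X : 𝔤) (A Y)) :
    ∑ i, adP 𝔱 (onb (𝔭 𝔱) i : 𝔤) * A * adP 𝔱 (onb (𝔭 𝔱) i : 𝔤) = -casP 𝔱 A := by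
  rw [casP_eq_symm hA, neg_neg]
  ext1 Y
  refine eq_of_ip_eq _ _ _ fun W => ?_
  rw [LinearMap.sum_apply, LinearMap.sum_apply, ip_sum_left, ip_sum_left]
  have hp : ∀ u v : 𝔭 𝔱, ∑ j, ip 𝔤 (u : 𝔤) (onb (𝔭 𝔱) j) * ip 𝔤 (v : 𝔤) (onb (𝔭 𝔱) j) =
      ip 𝔤 (u : 𝔤) v := fun u v => sum_ip_mul_ip (𝔭 𝔱) u v u.2
  calc ∑ i, ip 𝔤 (((adP 𝔱 (onb (𝔭 𝔱) i : 𝔤) * A * adP 𝔱 (onb (𝔭 𝔱) i : 𝔤)) Y : 𝔭 𝔱) : 𝔤) W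
      -- The inserted index j resolves the slot on which A acts; the original index i is then summed
      -- away by Parseval.
      = ∑ i, ∑ j, -(ip 𝔤 (adP 𝔱 (Y : 𝔤) (A (onb (𝔭 𝔱) j)) : 𝔤) (onb (𝔭 𝔱) i) *
          ip 𝔤 (adP 𝔱 (W : 𝔤) (onb (𝔭 𝔱) j) : 𝔤) (onb (𝔭 𝔱) i)) := by
        refine Finset.sum_congr rfl fun i _ => ?_
        rw [Module.End.mul_apply, Module.End.mul_apply, ip_adP_skew, ← hp,
          ← Finset.sum_neg_distrib]
        refine Finset.sum_congr rfl fun j _ => ?_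
        rw [hA, ip_adP_rot (onb (𝔭 𝔱) i) Y, ip_adP_rot (onb (𝔭 𝔱) i) W]
    _ = ∑ j, -(ip 𝔤 (adP 𝔱 (Y : 𝔤) (A (onb (𝔭 𝔱) j)) : 𝔤)
          (adP 𝔱 (W : 𝔤) (onb (𝔭 𝔱) j))) := by
        rw [Finset.sum_comm]
        refine Finset.sum_congr rfl fun j _ => ?_
        rw [Finset.sum_neg_distrib, hp]
    _ = _ := by
        refine Finset.sum_congr rfl fun j _ => ?_
        rw [Module.End.mul_apply, ip_adP_skew 𝔱 (onb (𝔭 𝔱) j : 𝔤) _ W,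
          adP_swap 𝔱 Y, adP_swap 𝔱 W]
        simp

/-- Paired with Z ∈ 𝔱, the left side is ⟨[Z, AX], Y⟩ = ⟨A[Z, X], Y⟩ = ⟨[Z, X], AY⟩, because A
commutes with ad Z and is symmetric. -/
lemma proj_lie_symm {A : End ℝ (𝔭 𝔱)} (hA : A ∈ symInv 𝔱) (X Y : 𝔭 𝔱) :
    proj 𝔱.toSubmodule ⁅(A X : 𝔤), (Y : 𝔤)⁆ = proj 𝔱.toSubmodule ⁅(X : 𝔤), (A Y : 𝔤)⁆ := by
  refine eq_of_ip_eq _ _ _ fun Z => ?_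
  have hZ : adP 𝔱 (Z : 𝔤) (A X) = A (adP 𝔱 (Z : 𝔤) X) := by
    have := LinearMap.congr_fun (hA.2 Z Z.2) X
    simpa [comm, sub_eq_zero] using this
  have h : ∀ U V : 𝔭 𝔱, ip 𝔤 ⁅(U : 𝔤), (V : 𝔤)⁆ (Z : 𝔤) = ip 𝔤 (adP 𝔱 (Z : 𝔤) U : 𝔤) V := by
    intro U V
    rw [ip_adP, ip_lie, ip_symm, ← lie_skew, map_neg, LinearMap.neg_apply, neg_neg]
  rw [ip_proj, ip_proj, h, h, hZ, hA.1]

/-- A moves from the vector Xᵢ into the bracket by symmetry of the contraction, and then onto Y by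
`proj_lie_symm`. With `torP_eq_mul'` this gives D_1 A + A D_1 - 2D_A = 0. -/
lemma torP_eq_mul {A : End ℝ (𝔭 𝔱)} (hA : A ∈ symInv 𝔱) : torP 𝔱 A = torP 𝔱 1 * A := by
  ext1 Y
  let f : 𝔭 𝔱 →ₗ[ℝ] 𝔭 𝔱 →ₗ[ℝ] 𝔭 𝔱 := LinearMap.mk₂ ℝ
    (fun U V => adP 𝔱 (proj 𝔱.toSubmodule ⁅(U : 𝔤), (Y : 𝔤)⁆ : 𝔤) V)
    (by simp) (by simp) (by simp) (by simp)
  have h := sum_onb_symm (𝔭 𝔱) f A hA.1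
  simp only [f, LinearMap.mk₂_apply] at h
  simp only [torP, LinearMap.coe_mk, AddHom.coe_mk, Module.End.mul_apply, Module.End.one_apply]
  rw [h]
  exact Finset.sum_congr rfl fun i _ => by rw [proj_lie_symm hA]

lemma torP_eq_mul' {A : End ℝ (𝔭 𝔱)} (hA : A ∈ symInv 𝔱) : torP 𝔱 A = A * torP 𝔱 1 := by
  ext1 Y
  simp only [torP, LinearMap.coe_mk, AddHom.coe_mk, Module.End.mul_apply, Module.End.one_apply,
    map_sum]
  refine Finset.sum_congr rfl fun i _ => ?_
  have := LinearMap.congr_fun (hA.2 (proj 𝔱.toSubmodule ⁅(onb (𝔭 𝔱) i : 𝔤), (Y : 𝔤)⁆)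
    (Subtype.property _)) (onb (𝔭 𝔱) i)
  simpa [comm, sub_eq_zero] using this

/-- Λ(X)X = 0 removes the correction term of ∇², leaving -¼ ∑ [ad Xᵢ, [ad Xᵢ, A]]. The mixed
products ad Xᵢ A ad Xᵢ are summed by `sum_adP_mul_adP`. -/
lemma roughLaplacian_eq {A : End ℝ (𝔭 𝔱)}
    (hA : ∀ X Y : 𝔭 𝔱, ip 𝔤 (A X : 𝔤) Y = ip 𝔤 (X : 𝔤) (A Y)) :
    roughLaplacian 𝔱 A =
      (1 / 4 : ℝ) • (casP 𝔱 1 * A + A * casP 𝔱 1) - (1 / 2 : ℝ) • casP 𝔱 A := by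
  have hn₁ : ∀ X Y : End ℝ (𝔭 𝔱), (-X) * Y = -(X * Y) := fun X Y => by ext1 v; simp
  have hn₂ : ∀ X Y : End ℝ (𝔭 𝔱), X * (-Y) = -(X * Y) := fun X Y => by ext1 v; simp
  have h₁ : casP 𝔱 1 * A + A * casP 𝔱 1 = -∑ i, (adP 𝔱 (onb (𝔭 𝔱) i : 𝔤) *
      adP 𝔱 (onb (𝔭 𝔱) i : 𝔤) * A + A * (adP 𝔱 (onb (𝔭 𝔱) i : 𝔤) * adP 𝔱 (onb (𝔭 𝔱) i : 𝔤))) := by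
    rw [casP, hn₁, hn₂, Finset.sum_mul, Finset.mul_sum, Finset.sum_add_distrib, neg_add]
    rfl
  have h₂ : casP 𝔱 A = -∑ i, adP 𝔱 (onb (𝔭 𝔱) i : 𝔤) * A * adP 𝔱 (onb (𝔭 𝔱) i : 𝔤) := by
    rw [sum_adP_mul_adP hA, neg_neg]
  rw [h₁, h₂, roughLaplacian, smul_neg, smul_neg, Finset.smul_sum, Finset.smul_sum,
    ← Finset.sum_neg_distrib, ← Finset.sum_neg_distrib, ← Finset.sum_neg_distrib,
    ← Finset.sum_sub_distrib]
  refine Finset.sum_congr rfl fun i _ => ?_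
  have h₃ : levi 𝔱 (levi 𝔱 (onb (𝔭 𝔱) i) (onb (𝔭 𝔱) i)) = 0 := by
    have : levi 𝔱 (onb (𝔭 𝔱) i) (onb (𝔭 𝔱) i) = 0 := by
      simp [levi, adP_self]
    rw [this, map_zero]
  have h₄ : levi 𝔱 (onb (𝔭 𝔱) i) = (1 / 2 : ℝ) • adP 𝔱 (onb (𝔭 𝔱) i : 𝔤) := rfl
  rw [h₃, h₄]
  simp only [comm, zero_mul, mul_zero, sub_zero, smul_mul_assoc, mul_smul_comm, mul_sub, sub_mul,
    smul_sub, smul_smul, mul_assoc, smul_add]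
  module

/-- The Lichnerowicz Laplacian on `Sym(𝔭)^T`. -/
theorem lichnerowicz_eq {A : End ℝ (𝔭 𝔱)} (hA : A ∈ symInv 𝔱) :
    lichnerowicz 𝔱 A = (1 / 2 : ℝ) • (casP 𝔱 1 * A + A * casP 𝔱 1) - casP 𝔱 A := by
  have h : lichnerowicz 𝔱 A =
    roughLaplacian 𝔱 A + ric 𝔱 * A + A * ric 𝔱 - (2 : ℝ) • curvAct 𝔱 A := rfl
  -- The rough Laplacian and the curvature action contribute -½C_A each; the rough Laplacian and the
  -- Ricci terms contribute ¼(C_1 A + A C_1) each.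
  rw [h, roughLaplacian_eq hA.1, curvAct_eq hA.1, ric_eq, add_mul, mul_add, ← torP_eq_mul hA,
    ← torP_eq_mul' hA, smul_mul_assoc, mul_smul_comm]
  module

end Lichnerowicz
end FullFlag
end

noncomputable section
namespace FullFlag
open Module

/-! ### Simply laced root pairings -/

section SimplyLaced

variable {ι R M N : Type*} [Finite ι] [Field R] [CharZero R] [AddCommGroup M] [Module R M]
  [AddCommGroup N] [Module R N] (P : RootPairing ι R M N) [P.IsCrystallographic] [P.IsReduced]

/-- All pairings are symmetric, i.e. all roots have the same length in each component. -/
def IsSimplyLaced : Prop := ∀ i j, P.pairingIn ℤ i j = P.pairingIn ℤ j i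

variable {P}

namespace IsSimplyLaced

variable (hP : IsSimplyLaced P)

include hP

/-- When both pairings of a pair agree, the finite list of pairs allowed in a reduced
crystallographic system leaves 0, ±1 and ±2, and ±2 occurs only for equal or opposite roots. -/
lemma pairing_cases (i j : ι) :
    i = j ∧ P.pairingIn ℤ i j = 2 ∨ P.root i = -P.root j ∧ P.pairingIn ℤ i j = -2 ∨
      (i ≠ j ∧ P.root i ≠ -P.root j ∧
        (P.pairingIn ℤ i j = 0 ∨ P.pairingIn ℤ i j = 1 ∨ P.pairingIn ℤ i j = -1)) := by
  have : Module.IsReflexive R M := .of_isPerfPair P.toLinearMap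
  have h := P.pairingIn_pairingIn_mem_set_of_isCrystal_of_isRed i j
  have h₁ := P.pairingIn_two_two_iff ℤ i j
  have h₂ := P.pairingIn_neg_two_neg_two_iff ℤ i j
  rw [← hP i j] at h h₁ h₂
  simp only [Set.mem_insert_iff, Set.mem_singleton_iff, Prod.mk.injEq] at h
  rw [and_self] at h₁ h₂
  have h₃ : P.pairingIn ℤ i j = 2 ∨ P.pairingIn ℤ i j = -2 ∨
      (P.pairingIn ℤ i j = 0 ∨ P.pairingIn ℤ i j = 1 ∨ P.pairingIn ℤ i j = -1) := by omega
  rcases h₃ with h₃ | h₃ | h₃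
  · exact Or.inl ⟨h₁.1 h₃, h₃⟩
  · exact Or.inr (Or.inl ⟨h₂.1 h₃, h₃⟩)
  · refine Or.inr (Or.inr ⟨fun e => ?_, fun e => ?_, h₃⟩)
    · have := h₁.2 e
      omega
    · have := h₂.2 e
      omega

/-- Since ⟨k,j⟩ = ⟨i,j⟩ + 2 is at most 2, ⟨i,j⟩ is not positive. The value 0 would give k = j and
hence a zero root i, the value -2 a zero root k. -/
lemma pairing_eq_neg_one {i j k : ι} (h : P.root k = P.root i + P.root j) :
    P.pairingIn ℤ i j = -1 := by
  have hk : P.pairingIn ℤ k j = P.pairingIn ℤ i j + 2 := by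
    rw [P.pairingIn_eq_add_of_root_eq_add h, P.pairingIn_same]
  rcases hP.pairing_cases i j with ⟨-, h'⟩ | ⟨h', -⟩ | ⟨-, -, h' | h' | h'⟩
  · rcases hP.pairing_cases k j with h'' | h'' | h'' <;> omega
  · rw [h', neg_add_cancel] at h
    exact absurd h (P.ne_zero k)
  · rcases hP.pairing_cases k j with ⟨rfl, -⟩ | h'' | h''
    · exact absurd (left_eq_add.1 (h.trans (add_comm _ _))) (P.ne_zero i)
    · omega
    · omega
  · rcases hP.pairing_cases k j with h'' | h'' | h'' <;> omega
  · exact h'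

lemma pairing_eq_one {i j k : ι} (h : P.root k = P.root i - P.root j) :
    P.pairingIn ℤ i j = 1 := by
  have h' : P.root i = P.root k + P.root j := by rw [h, sub_add_cancel]
  rw [P.pairingIn_eq_add_of_root_eq_add h', hP.pairing_eq_neg_one h', P.pairingIn_same]
  rfl

/-- Together with `sub_mem_iff` this reads root adjacency off the pairing and shows that i + j and i
- j are never both roots. -/
lemma add_mem_iff (i j : ι) : P.root i + P.root j ∈ Set.range P.root ↔ P.pairingIn ℤ i j = -1 := by
  refine ⟨fun ⟨k, hk⟩ => hP.pairing_eq_neg_one hk, fun h => ?_⟩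
  refine P.root_add_root_mem_of_pairingIn_neg (by omega) fun h' => ?_
  rcases hP.pairing_cases i j with h'' | h'' | ⟨-, h'', -⟩
  · omega
  · omega
  · exact h'' h'

lemma sub_mem_iff (i j : ι) : P.root i - P.root j ∈ Set.range P.root ↔ P.pairingIn ℤ i j = 1 := by
  refine ⟨fun ⟨k, hk⟩ => hP.pairing_eq_one hk, fun h => ?_⟩
  refine P.root_sub_root_mem_of_pairingIn_pos (by omega) fun h' => ?_
  rw [h', P.pairingIn_same] at h
  omega

end IsSimplyLaced

end SimplyLaced

/-! ### The complexification in real coordinates -/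

section Complexification

variable {𝔤 : Type*} [LieRing 𝔤] [LieAlgebra ℝ 𝔤]

/-- The element `x + iy` of `𝔤_ℂ`. -/
def cx (x y : 𝔤) : ℂ ⊗[ℝ] 𝔤 := (1 : ℂ) ⊗ₜ[ℝ] x + Complex.I ⊗ₜ[ℝ] y

@[simp] lemma rePart_cx (x y : 𝔤) : rePart 𝔤 (cx x y) = x := by simp [cx]

@[simp] lemma imPart_cx (x y : 𝔤) : imPart 𝔤 (cx x y) = y := by simp [cx]

lemma cx_re_im (z : ℂ ⊗[ℝ] 𝔤) : cx (rePart 𝔤 z) (imPart 𝔤 z) = z := (eq_re_add_im z).symm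

lemma cx_inj {x y u v : 𝔤} : cx x y = cx u v ↔ x = u ∧ y = v := by
  refine ⟨fun h => ?_, fun ⟨h₁, h₂⟩ => by rw [h₁, h₂]⟩
  exact ⟨by simpa using congrArg (rePart 𝔤) h, by simpa using congrArg (imPart 𝔤) h⟩

lemma cx_eq_zero {x y : 𝔤} : cx x y = 0 ↔ x = 0 ∧ y = 0 := by
  have h : (0 : ℂ ⊗[ℝ] 𝔤) = cx 0 0 := by simp [cx]
  rw [h, cx_inj]

lemma cx_zero (x : 𝔤) : cx x 0 = (1 : ℂ) ⊗ₜ[ℝ] x := by simp [cx]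

lemma cx_add (x y u v : 𝔤) : cx x y + cx u v = cx (x + u) (y + v) := by
  simp only [cx, TensorProduct.tmul_add]; abel

lemma smul_cx (a : ℂ) (x y : 𝔤) :
    a • cx x y = cx (a.re • x - a.im • y) (a.im • x + a.re • y) := by
  have h : ∀ z : 𝔤, a • ((1 : ℂ) ⊗ₜ[ℝ] z) = cx (a.re • z) (a.im • z) := by
    intro z
    rw [TensorProduct.smul_tmul', smul_eq_mul, mul_one, ← cx_re_im (a ⊗ₜ[ℝ] z), rePart_tmul,
      imPart_tmul]
  have h' : ∀ z : 𝔤, a • (Complex.I ⊗ₜ[ℝ] z) = cx (-a.im • z) (a.re • z) := by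
    intro z
    rw [TensorProduct.smul_tmul', smul_eq_mul, ← cx_re_im ((a * Complex.I) ⊗ₜ[ℝ] z), rePart_tmul,
      imPart_tmul]
    simp
  rw [cx, smul_add, h, h', cx_add, neg_smul, ← sub_eq_add_neg]

lemma lie_cx (x y u v : 𝔤) :
    ⁅cx x y, cx u v⁆ = cx (⁅x, u⁆ - ⁅y, v⁆) (⁅x, v⁆ + ⁅y, u⁆) := by
  have h : ∀ (a c : ℂ) (x y : 𝔤), ⁅a ⊗ₜ[ℝ] x, c ⊗ₜ[ℝ] y⁆ = (a * c) ⊗ₜ[ℝ] ⁅x, y⁆ :=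
    fun a c x y => LieAlgebra.ExtendScalars.bracket_tmul ℝ ℂ 𝔤 𝔤 a c x y
  rw [cx, cx, LieRing.add_lie, LieRing.lie_add, LieRing.lie_add, h, h, h, h, cx]
  simp only [mul_one, one_mul, Complex.I_mul_I, TensorProduct.tmul_sub, TensorProduct.tmul_add,
    TensorProduct.neg_tmul]
  abel

lemma smul_lie_cx (a : ℂ) (z w : ℂ ⊗[ℝ] 𝔤) : ⁅a • z, w⁆ = a • ⁅z, w⁆ := by
  rw [← cx_re_im z, ← cx_re_im w, smul_cx, lie_cx, lie_cx, smul_cx, cx_inj]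
  simp only [sub_lie, add_lie, smul_lie]
  constructor <;> module

lemma lie_zero_cx (z : ℂ ⊗[ℝ] 𝔤) : ⁅z, (0 : ℂ ⊗[ℝ] 𝔤)⁆ = 0 := by
  have h : (0 : ℂ ⊗[ℝ] 𝔤) = cx 0 0 := (cx_eq_zero.2 ⟨rfl, rfl⟩).symm
  rw [h, ← cx_re_im z, lie_cx]
  simp

/-- The Killing form of the complexification is the base change of the real one; it is bilinear,
without conjugation, whence the minus sign. -/
lemma killing_cx [FiniteDimensional ℝ 𝔤] (x y u v : 𝔤) :
    killingForm ℂ (ℂ ⊗[ℝ] 𝔤) (cx x y) (cx u v) =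
      ((killingForm ℝ 𝔤 x u - killingForm ℝ 𝔤 y v : ℝ) : ℂ) +
        Complex.I * ((killingForm ℝ 𝔤 x v + killingForm ℝ 𝔤 y u : ℝ) : ℂ) := by
  have h := LieModule.traceForm_baseChange ℝ 𝔤 𝔤 ℂ
  change LieModule.traceForm ℂ (ℂ ⊗[ℝ] 𝔤) (ℂ ⊗[ℝ] 𝔤) _ _ = _
  rw [h, cx, cx]
  simp [mul_comm]
  ring_nf

end Complexification

/-! ### Real and imaginary parts of root vectors -/

section RootSpaces

variable {𝔤 : Type*} [LieRing 𝔤] [LieAlgebra ℝ 𝔤] [FiniteDimensional ℝ 𝔤] [IsCompactSemisimple 𝔤]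
  {𝔱 : LieSubalgebra ℝ 𝔤} [IsMaximalTorus 𝔱]

/-- An element of `𝔱` as an element of `𝔱_ℂ`. -/
def toCartan (Z : 𝔱) : cartan 𝔱 :=
  ⟨(1 : ℂ) ⊗ₜ[ℝ] (Z : 𝔤), Submodule.tmul_mem_baseChange_of_mem (A := ℂ) (1 : ℂ) Z.2⟩

omit [FiniteDimensional ℝ 𝔤] [IsCompactSemisimple 𝔤] [IsMaximalTorus 𝔱] in
lemma coe_toCartan (Z : 𝔱) : (toCartan Z : ℂ ⊗[ℝ] 𝔤) = cx (Z : 𝔤) 0 := (cx_zero _).symm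

omit [FiniteDimensional ℝ 𝔤] [IsCompactSemisimple 𝔤] [IsMaximalTorus 𝔱] in
lemma exists_toCartan (h : cartan 𝔱) : ∃ Z W : 𝔱, h = toCartan Z + Complex.I • toCartan W := by
  have hp := parts_mem 𝔱 h h.2
  refine ⟨⟨_, hp.1⟩, ⟨_, hp.2⟩, Subtype.ext ?_⟩
  change (h : ℂ ⊗[ℝ] 𝔤) = ((toCartan ⟨_, hp.1⟩ : cartan 𝔱) : ℂ ⊗[ℝ] 𝔤) +
    Complex.I • ((toCartan ⟨_, hp.2⟩ : cartan 𝔱) : ℂ ⊗[ℝ] 𝔤)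
  rw [coe_toCartan, coe_toCartan, smul_cx, cx_add]
  simp [cx_re_im]

omit [FiniteDimensional ℝ 𝔤] [IsCompactSemisimple 𝔤] [IsMaximalTorus 𝔱] in
lemma ext_toCartan {χ ψ : Dual ℂ (cartan 𝔱)} (h : ∀ Z, χ (toCartan Z) = ψ (toCartan Z)) :
    χ = ψ := by
  ext1 x
  obtain ⟨Z, W, rfl⟩ := exists_toCartan x
  rw [map_add, map_add, map_smul, map_smul, h, h]

/-- The Cartan subalgebra acts semisimply, so generalized weight vectors are honest eigenvectors. By
complex linearity, testing on 𝔱 suffices. -/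
lemma mem_rootSpace_iff (χ : Dual ℂ (cartan 𝔱)) (E : ℂ ⊗[ℝ] 𝔤) :
    E ∈ LieAlgebra.rootSpace (cartan 𝔱) χ ↔
      ∀ Z : 𝔱, ⁅cx (Z : 𝔤) 0, E⁆ = χ (toCartan Z) • E := by
  constructor
  · intro hE Z
    have h := LieAlgebra.IsKilling.lie_eq_smul_of_mem_rootSpace hE (toCartan Z)
    rw [← coe_toCartan]
    exact h
  · intro hE
    refine LieModule.weightSpace_le_genWeightSpace _ _ ?_
    rw [LieModule.mem_weightSpace]
    intro h
    obtain ⟨Z, W, rfl⟩ := exists_toCartan h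
    change ⁅(toCartan Z : ℂ ⊗[ℝ] 𝔤) + Complex.I • (toCartan W : ℂ ⊗[ℝ] 𝔤), E⁆ = _
    have hs : ⁅Complex.I • cx (W : 𝔤) 0, E⁆ = Complex.I • ⁅cx (W : 𝔤) 0, E⁆ := smul_lie_cx _ _ _
    rw [LieRing.add_lie, coe_toCartan, coe_toCartan, hs, hE, hE, map_add, map_smul, add_smul,
      smul_assoc]

lemma ip_eq_neg_killing (x y : 𝔤) : ip 𝔤 x y = -killingForm ℝ 𝔤 x y := rfl

lemma ip_lie_self (x y : 𝔤) : ip 𝔤 ⁅x, y⁆ y = 0 := by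
  have h := ip_lie x y y
  rw [ip_symm y] at h
  linarith

/-- Roots take imaginary values on `𝔱`. -/
lemma re_eq_zero {χ : Dual ℂ (cartan 𝔱)} {x y : 𝔤}
    (h : cx x y ∈ LieAlgebra.rootSpace (cartan 𝔱) χ) (h₀ : cx x y ≠ 0) (Z : 𝔱) :
    (χ (toCartan Z)).re = 0 := by
  have hZ := (mem_rootSpace_iff χ _).1 h Z
  rw [lie_cx, smul_cx, cx_inj] at hZ
  simp only [zero_lie, sub_zero, add_zero] at hZ
  -- ad Z is skew, so ⟨[Z,x],x⟩ + ⟨[Z,y],y⟩ = 0. By the eigenvalue equation this sum is Re χ(Z)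
  -- (|x|² + |y|²).
  have h₁ := ip_lie_self (Z : 𝔤) x
  have h₂ := ip_lie_self (Z : 𝔤) y
  rw [hZ.1] at h₁
  rw [hZ.2] at h₂
  simp only [map_sub, map_add, map_smul, LinearMap.sub_apply, LinearMap.add_apply,
    LinearMap.smul_apply, smul_eq_mul] at h₁ h₂
  rw [ip_symm y x] at h₁
  have h₃ : (χ (toCartan Z)).re * (ip 𝔤 x x + ip 𝔤 y y) = 0 := by linarith
  refine (mul_eq_zero.1 h₃).resolve_right fun h₄ => h₀ (cx_eq_zero.2 ?_)
  have hx : 0 ≤ ip 𝔤 x x := by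
    by_cases hx : x = 0
    · simp [hx]
    · exact (ip_pos x hx).le
  have hy : 0 ≤ ip 𝔤 y y := by
    by_cases hy : y = 0
    · simp [hy]
    · exact (ip_pos y hy).le
  exact ⟨eq_zero_of_ip _ (by linarith), eq_zero_of_ip _ (by linarith)⟩

lemma cx_mem_rootSpace_iff (χ : Dual ℂ (cartan 𝔱)) (x y : 𝔤)
    (hχ : ∀ Z : 𝔱, (χ (toCartan Z)).re = 0) :
    cx x y ∈ LieAlgebra.rootSpace (cartan 𝔱) χ ↔ ∀ Z : 𝔱,
      ⁅(Z : 𝔤), x⁆ = -(χ (toCartan Z)).im • y ∧ ⁅(Z : 𝔤), y⁆ = (χ (toCartan Z)).im • x := by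
  rw [mem_rootSpace_iff]
  refine forall_congr' fun Z => ?_
  rw [lie_cx, smul_cx, cx_inj, hχ Z]
  simp

/-- Complex conjugation conjugates the eigenvalues of 𝔱, which are imaginary on a nonzero root
space. The zero vector is treated apart because nothing is then known about χ. -/
lemma cx_neg_mem_rootSpace {χ : Dual ℂ (cartan 𝔱)} {x y : 𝔤}
    (h : cx x y ∈ LieAlgebra.rootSpace (cartan 𝔱) χ) :
    cx x (-y) ∈ LieAlgebra.rootSpace (cartan 𝔱) ⇑(-χ) := by
  by_cases h₀ : cx x y = 0
  · obtain ⟨rfl, rfl⟩ := cx_eq_zero.1 h₀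
    rw [neg_zero, h₀]
    exact zero_mem _
  have hχ := re_eq_zero h h₀
  rw [cx_mem_rootSpace_iff χ x y hχ] at h
  have := (cx_mem_rootSpace_iff (-χ) x (-y) fun Z => by simp [hχ Z]).2 fun Z => by
    obtain ⟨h₁, h₂⟩ := h Z
    refine ⟨?_, ?_⟩
    · rw [h₁]; simp
    · rw [lie_neg, h₂]; simp
  exact this

/-- Stated for arbitrary linear forms, since it is applied to α ± β before these are known to be
roots. -/
lemma rootSpace_eq_bot {χ : Dual ℂ (cartan 𝔱)} (h₀ : χ ≠ 0)
    (hχ : χ ∉ Set.range (roots 𝔱).root) : LieAlgebra.rootSpace (cartan 𝔱) χ = ⊥ := by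
  by_contra h
  let w : LieModule.Weight ℂ (cartan 𝔱) (ℂ ⊗[ℝ] 𝔤) := ⟨χ, h⟩
  have hw : w.IsNonZero := fun h' => h₀ (DFunLike.coe_injective h')
  refine hχ ⟨⟨w, by simpa using hw⟩, ?_⟩
  rw [LieAlgebra.IsKilling.rootSystem_root_apply]
  exact DFunLike.coe_injective rfl

/-- Since 2α ≠ 0, a root vector E = x + iy satisfies B(E, E) = 0. The real and imaginary parts of
this equation say |x| = |y| and x ⊥ y, so a real rescaling produces an orthonormal pair. -/
lemma exists_frame (i : (cartan 𝔱).root) : ∃ x y : 𝔤,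
    ip 𝔤 x x = 1 ∧ ip 𝔤 y y = 1 ∧ ip 𝔤 x y = 0 ∧
    cx x y ∈ LieAlgebra.rootSpace (cartan 𝔱) ((roots 𝔱).root i) := by
  have hi : (i : LieModule.Weight ℂ (cartan 𝔱) (ℂ ⊗[ℝ] 𝔤)).IsNonZero := by
    exact (Finset.mem_filter.1 i.2).2
  obtain ⟨E, hE, hE₀⟩ := (i : LieModule.Weight ℂ (cartan 𝔱) (ℂ ⊗[ℝ] 𝔤)).exists_ne_zero
  change E ∈ LieAlgebra.rootSpace (cartan 𝔱) ((roots 𝔱).root i) at hE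
  rw [← cx_re_im E] at hE hE₀
  set x := rePart 𝔤 E
  set y := imPart 𝔤 E
  have hK := LieAlgebra.killingForm_apply_eq_zero_of_mem_rootSpace_of_add_ne_zero ℂ (ℂ ⊗[ℝ] 𝔤)
    (cartan 𝔱) hE hE (by
      intro h
      refine (roots 𝔱).ne_zero i (DFunLike.coe_injective ?_)
      funext z
      have := congrFun h z
      simpa using this)
  rw [killing_cx] at hK
  have h₁ := congrArg Complex.re hK
  have h₂ := congrArg Complex.im hK
  simp only [Complex.add_re, Complex.add_im, Complex.mul_re, Complex.mul_im, Complex.ofReal_re,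
    Complex.ofReal_im, Complex.I_re, Complex.I_im, Complex.zero_re, Complex.zero_im] at h₁ h₂
  have e₁ : ip 𝔤 x x = ip 𝔤 y y := by
    simp only [ip_eq_neg_killing]; linarith
  have e₂ : ip 𝔤 x y = 0 := by
    have := ip_symm x y
    simp only [ip_eq_neg_killing] at this ⊢; linarith
  have e₃ : 0 < ip 𝔤 x x := by
    refine ip_pos x fun hx => hE₀ ?_
    rw [cx_eq_zero]
    exact ⟨hx, eq_zero_of_ip y (by rw [← e₁, hx]; simp)⟩
  set r : ℝ := (√(ip 𝔤 x x))⁻¹ with hr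
  have hr₂ : r * (r * ip 𝔤 x x) = 1 := by
    rw [← mul_assoc, hr, ← mul_inv, Real.mul_self_sqrt e₃.le, inv_mul_cancel₀ e₃.ne']
  refine ⟨r • x, r • y, ?_, ?_, ?_, ?_⟩
  · simpa using hr₂
  · simpa [← e₁] using hr₂
  · simp [e₂]
  · have h := Submodule.smul_mem (LieAlgebra.rootSpace (cartan 𝔱)
      ((roots 𝔱).root i)).toSubmodule (r : ℂ) hE
    rw [smul_cx] at h
    simpa using h

end RootSpaces
end FullFlag
end

noncomputable section
namespace FullFlag
open Module

/-! ### The planes 𝔭_α and the decomposition of 𝔭 -/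

section PosRoots

variable {𝔤 : Type*} [LieRing 𝔤] [LieAlgebra ℝ 𝔤] [FiniteDimensional ℝ 𝔤] [IsCompactSemisimple 𝔤]
  {𝔱 : LieSubalgebra ℝ 𝔤} [IsMaximalTorus 𝔱]

lemma lie_mem_rootSpace {χ ψ : Dual ℂ (cartan 𝔱)} {E F : ℂ ⊗[ℝ] 𝔤}
    (hE : E ∈ LieAlgebra.rootSpace (cartan 𝔱) χ) (hF : F ∈ LieAlgebra.rootSpace (cartan 𝔱) ψ) :
    ⁅E, F⁆ ∈ LieAlgebra.rootSpace (cartan 𝔱) ⇑(χ + ψ) :=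
  LieAlgebra.lie_mem_genWeightSpace_of_mem_genWeightSpace hE hF

lemma killing_eq_zero {χ ψ : Dual ℂ (cartan 𝔱)} {E F : ℂ ⊗[ℝ] 𝔤}
    (hE : E ∈ LieAlgebra.rootSpace (cartan 𝔱) χ) (hF : F ∈ LieAlgebra.rootSpace (cartan 𝔱) ψ)
    (h : χ + ψ ≠ 0) : killingForm ℂ (ℂ ⊗[ℝ] 𝔤) E F = 0 :=
  LieAlgebra.killingForm_apply_eq_zero_of_mem_rootSpace_of_add_ne_zero ℂ (ℂ ⊗[ℝ] 𝔤)
    (cartan 𝔱) hE hF fun h' => h (DFunLike.coe_injective h')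

lemma cx_mem_rootSpace_zero {Z : 𝔤} (hZ : Z ∈ 𝔱) :
    cx Z 0 ∈ LieAlgebra.rootSpace (cartan 𝔱) (0 : Dual ℂ (cartan 𝔱)) := by
  rw [mem_rootSpace_iff]
  intro W
  rw [lie_cx, IsMaximalTorus.abelian (W : 𝔤) W.2 Z hZ]
  simp [cx_eq_zero]

lemma eq_smul_of_mem_rootSpace (i : (cartan 𝔱).root) {E F : ℂ ⊗[ℝ] 𝔤}
    (hE : E ∈ LieAlgebra.rootSpace (cartan 𝔱) ((roots 𝔱).root i)) (hE₀ : E ≠ 0)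
    (hF : F ∈ LieAlgebra.rootSpace (cartan 𝔱) ((roots 𝔱).root i)) : ∃ c : ℂ, F = c • E := by
  have h := LieAlgebra.IsKilling.finrank_rootSpace_eq_one (H := cartan 𝔱) i.1
    (Finset.mem_filter.1 i.2).2
  obtain ⟨c, hc⟩ := (finrank_eq_one_iff_of_nonzero'
    (⟨E, hE⟩ : LieAlgebra.rootSpace (cartan 𝔱) ((roots 𝔱).root i))
    (fun h => hE₀ (congrArg Subtype.val h))).1 h ⟨F, hF⟩
  exact ⟨c, (congrArg Subtype.val hc).symm⟩

lemma cx_mem_rootSpace_of_neg {χ : Dual ℂ (cartan 𝔱)} {x y : 𝔤}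
    (h : cx x y ∈ LieAlgebra.rootSpace (cartan 𝔱) ⇑(-χ)) :
    cx x (-y) ∈ LieAlgebra.rootSpace (cartan 𝔱) χ := by
  have h' := cx_neg_mem_rootSpace h
  rwa [neg_neg] at h'

/-- The defining condition of `𝔭_α` for an arbitrary linear form. -/
def IsRealPart (χ : Dual ℂ (cartan 𝔱)) (w : 𝔤) : Prop :=
  ∃ E ∈ LieAlgebra.rootSpace (cartan 𝔱) χ, ∃ F ∈ LieAlgebra.rootSpace (cartan 𝔱) ⇑(-χ),
    E + F = cx w 0

/-- Two root spaces are Killing-orthogonal unless their forms add up to zero, and the hypotheses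
exclude this for all four sums ±χ ± ψ. Allowing χ = 0 covers the torus as well. -/
lemma ip_eq_zero_of_isRealPart {χ ψ : Dual ℂ (cartan 𝔱)} {u v : 𝔤} (hu : IsRealPart χ u)
    (hv : IsRealPart ψ v) (h : χ + ψ ≠ 0) (h' : χ - ψ ≠ 0) : ip 𝔤 u v = 0 := by
  obtain ⟨E, hE, E', hE', hu⟩ := hu
  obtain ⟨F, hF, F', hF', hv⟩ := hv
  have h₁ : χ + -ψ ≠ 0 := by rwa [← sub_eq_add_neg]
  have h₂ : -χ + ψ ≠ 0 := fun h'' => h' (by rw [← neg_eq_zero, ← h'']; abel)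
  have h₃ : -χ + -ψ ≠ 0 := fun h'' => h (by rw [← neg_eq_zero, ← h'']; abel)
  have hK : killingForm ℂ (ℂ ⊗[ℝ] 𝔤) (cx u 0) (cx v 0) = 0 := by
    rw [← hu, ← hv, map_add, map_add, LinearMap.add_apply, LinearMap.add_apply,
      killing_eq_zero hE hF h, killing_eq_zero hE hF' h₁, killing_eq_zero hE' hF h₂,
      killing_eq_zero hE' hF' h₃]
    simp
  rw [killing_cx] at hK
  have := congrArg Complex.re hK
  simp only [map_zero, LinearMap.zero_apply, sub_zero, add_zero, Complex.ofReal_zero, mul_zero,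
    Complex.ofReal_re, Complex.zero_re] at this
  rw [ip_eq_neg_killing, this, neg_zero]

lemma isRealPart_zero {Z : 𝔤} (hZ : Z ∈ 𝔱) : IsRealPart (0 : Dual ℂ (cartan 𝔱)) Z :=
  ⟨_, cx_mem_rootSpace_zero hZ, 0, zero_mem _, add_zero _⟩

variable {b : (roots 𝔱).Base}

/-- Height is odd under negation and positive on positive roots. -/
lemma root_ne_neg_of_isPos {i j : (cartan 𝔱).root} (hi : b.IsPos i) (hj : b.IsPos j) :
    (roots 𝔱).root i ≠ -(roots 𝔱).root j := by
  intro h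
  have h' : i = (roots 𝔱).reflectionPerm j j := (roots 𝔱).root.injective (by
    rw [h, RootPairing.root_reflectionPerm, RootPairing.reflection_apply_self])
  have h'' := b.height_reflectionPerm_self j
  rw [RootPairing.Base.isPos_iff] at hi hj
  change b.height ((roots 𝔱).reflectionPerm j j) = _ at h''
  rw [← h'] at h''
  omega

/-- The index set of a positive root and its negative cover all the roots. -/
lemma exists_posRoot (b : (roots 𝔱).Base) (i : (cartan 𝔱).root) :
    ∃ α : PosRoot b, (roots 𝔱).root i = α.form ∨ (roots 𝔱).root i = -α.form := by
  rcases RootPairing.Base.IsPos.or_neg b i with h | h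
  · exact ⟨⟨i, h⟩, Or.inl rfl⟩
  · refine ⟨⟨(roots 𝔱).reflectionPerm i i, h⟩, Or.inr ?_⟩
    rw [PosRoot.form, RootPairing.root_reflectionPerm, RootPairing.reflection_apply_self, neg_neg]

namespace PosRoot

lemma form_injective : Function.Injective (form : PosRoot b → Dual ℂ (cartan 𝔱)) :=
  fun _ _ h => Subtype.ext ((roots 𝔱).root.injective h)

lemma form_ne_zero (α : PosRoot b) : α.form ≠ 0 := (roots 𝔱).ne_zero α.1

lemma form_add_ne_zero (α β : PosRoot b) : α.form + β.form ≠ 0 := fun h =>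
  root_ne_neg_of_isPos α.2 β.2 (eq_neg_of_add_eq_zero_left h)

lemma form_sub_ne_zero {α β : PosRoot b} (h : α ≠ β) : α.form - β.form ≠ 0 := fun h' =>
  h (form_injective (sub_eq_zero.1 h'))

/-- The first vector of an orthonormal basis of `𝔭_α`. -/
def ex (α : PosRoot b) : 𝔤 := (exists_frame α.1).choose

/-- The second vector of an orthonormal basis of `𝔭_α`. -/
def ey (α : PosRoot b) : 𝔤 := (exists_frame α.1).choose_spec.choose

lemma ip_ex_ex (α : PosRoot b) : ip 𝔤 α.ex α.ex = 1 :=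
  (exists_frame α.1).choose_spec.choose_spec.1

lemma ip_ey_ey (α : PosRoot b) : ip 𝔤 α.ey α.ey = 1 :=
  (exists_frame α.1).choose_spec.choose_spec.2.1

lemma ip_ex_ey (α : PosRoot b) : ip 𝔤 α.ex α.ey = 0 :=
  (exists_frame α.1).choose_spec.choose_spec.2.2.1

lemma ip_ey_ex (α : PosRoot b) : ip 𝔤 α.ey α.ex = 0 := by rw [ip_symm, ip_ex_ey]

lemma cx_mem (α : PosRoot b) : cx α.ex α.ey ∈ LieAlgebra.rootSpace (cartan 𝔱) α.form :=
  (exists_frame α.1).choose_spec.choose_spec.2.2.2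

lemma cx_neg_mem (α : PosRoot b) :
    cx α.ex (-α.ey) ∈ LieAlgebra.rootSpace (cartan 𝔱) ⇑(-α.form) :=
  cx_neg_mem_rootSpace α.cx_mem

lemma ex_ne_zero (α : PosRoot b) : α.ex ≠ 0 := fun h => by
  have := α.ip_ex_ex
  rw [h] at this
  simp at this

lemma cx_ne_zero (α : PosRoot b) : cx α.ex α.ey ≠ 0 := fun h =>
  α.ex_ne_zero (cx_eq_zero.1 h).1

lemma form_re (α : PosRoot b) (Z : 𝔱) : (α.form (toCartan Z)).re = 0 :=
  re_eq_zero α.cx_mem α.cx_ne_zero Z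

/-- The real root: `α = i θ` on `𝔱`. -/
def theta (α : PosRoot b) (Z : 𝔱) : ℝ := (α.form (toCartan Z)).im

lemma lie_ex (α : PosRoot b) (Z : 𝔱) : ⁅(Z : 𝔤), α.ex⁆ = -α.theta Z • α.ey :=
  ((cx_mem_rootSpace_iff _ _ _ α.form_re).1 α.cx_mem Z).1

lemma lie_ey (α : PosRoot b) (Z : 𝔱) : ⁅(Z : 𝔤), α.ey⁆ = α.theta Z • α.ex :=
  ((cx_mem_rootSpace_iff _ _ _ α.form_re).1 α.cx_mem Z).2

lemma mem_space {α : PosRoot b} {w : 𝔤} :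
    w ∈ α.space ↔ IsRealPart α.form w := by
  have h : w ∈ α.space ↔ (1 : ℂ) ⊗ₜ[ℝ] w ∈ (LieAlgebra.rootSpace (cartan 𝔱) α.form ⊔
    LieAlgebra.rootSpace (cartan 𝔱) ⇑(-α.form)).toSubmodule := Iff.rfl
  rw [h, LieSubmodule.sup_toSubmodule, Submodule.mem_sup, ← cx_zero]
  rfl

/-- The root space is the complex line through the frame vector, so multiplying by c only mixes `ex`
and `ey`. -/
lemma parts_of_mem (α : PosRoot b) {E : ℂ ⊗[ℝ] 𝔤}
    (hE : E ∈ LieAlgebra.rootSpace (cartan 𝔱) α.form) :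
    (∃ r s : ℝ, rePart 𝔤 E = r • α.ex + s • α.ey) ∧
      ∃ r s : ℝ, imPart 𝔤 E = r • α.ex + s • α.ey := by
  obtain ⟨c, rfl⟩ := eq_smul_of_mem_rootSpace α.1 α.cx_mem α.cx_ne_zero hE
  rw [smul_cx, rePart_cx, imPart_cx]
  exact ⟨⟨c.re, -c.im, by module⟩, ⟨c.im, c.re, rfl⟩⟩

lemma parts_of_mem_neg (α : PosRoot b) {E : ℂ ⊗[ℝ] 𝔤}
    (hE : E ∈ LieAlgebra.rootSpace (cartan 𝔱) ⇑(-α.form)) :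
    (∃ r s : ℝ, rePart 𝔤 E = r • α.ex + s • α.ey) ∧
      ∃ r s : ℝ, imPart 𝔤 E = r • α.ex + s • α.ey := by
  rw [← cx_re_im E] at hE
  have h := cx_mem_rootSpace_of_neg hE
  obtain ⟨h₁, r, s, h₂⟩ := α.parts_of_mem h
  rw [rePart_cx] at h₁
  rw [imPart_cx] at h₂
  refine ⟨h₁, -r, -s, ?_⟩
  rw [← neg_neg (imPart 𝔤 E), h₂]
  module

lemma mem_space_iff {α : PosRoot b} {w : 𝔤} :
    w ∈ α.space ↔ ∃ r s : ℝ, w = r • α.ex + s • α.ey := by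
  rw [mem_space]
  constructor
  · rintro ⟨E, hE, F, hF, h⟩
    obtain ⟨⟨r, s, h₁⟩, -⟩ := α.parts_of_mem hE
    obtain ⟨⟨r', s', h₂⟩, -⟩ := α.parts_of_mem_neg hF
    refine ⟨r + r', s + s', ?_⟩
    have := congrArg (rePart 𝔤) h
    rw [map_add, h₁, h₂, rePart_cx] at this
    rw [← this]
    module
  · rintro ⟨r, s, rfl⟩
    -- The coefficients (r - is)/2 and (r + is)/2 are conjugate, so the two summands are conjugate
    -- vectors and their sum is the real vector r ex + s ey.
    refine ⟨((r / 2 : ℝ) - (s / 2 : ℝ) * Complex.I : ℂ) • cx α.ex α.ey,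
      Submodule.smul_mem (LieAlgebra.rootSpace (cartan 𝔱) α.form).toSubmodule _ α.cx_mem,
      ((r / 2 : ℝ) + (s / 2 : ℝ) * Complex.I : ℂ) • cx α.ex (-α.ey),
      Submodule.smul_mem (LieAlgebra.rootSpace (cartan 𝔱) ⇑(-α.form)).toSubmodule _ α.cx_neg_mem, ?_⟩
    rw [smul_cx, smul_cx, cx_add, cx_inj]
    simp only [Complex.sub_re, Complex.add_re, Complex.sub_im, Complex.add_im, Complex.mul_re,
      Complex.mul_im, Complex.ofReal_re, Complex.ofReal_im, Complex.I_re, Complex.I_im]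
    constructor <;> module

lemma ex_mem (α : PosRoot b) : α.ex ∈ α.space := mem_space_iff.2 ⟨1, 0, by simp⟩

lemma ey_mem (α : PosRoot b) : α.ey ∈ α.space := mem_space_iff.2 ⟨0, 1, by simp⟩

lemma space_expand (α : PosRoot b) {w : 𝔤} (hw : w ∈ α.space) :
    ip 𝔤 w α.ex • α.ex + ip 𝔤 w α.ey • α.ey = w := by
  obtain ⟨r, s, rfl⟩ := mem_space_iff.1 hw
  simp [ip_ex_ex, ip_ex_ey, ip_ey_ex, ip_ey_ey]

lemma sum_onb_space {F : Type*} [AddCommGroup F] [Module ℝ F] (α : PosRoot b)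
    (f : 𝔤 →ₗ[ℝ] 𝔤 →ₗ[ℝ] F) :
    ∑ j, f (onb α.space j) (onb α.space j) = f α.ex α.ex + f α.ey α.ey := by
  have h := sum_onb_eq α.space f ![α.ex, α.ey]
    (by intro k; fin_cases k; exacts [α.ex_mem, α.ey_mem])
    (by intro w hw; simpa using α.space_expand hw)
  simpa using h

/-- Contracting the metric with itself gives the dimension in an orthonormal basis and 1 + 1 in the
frame. -/
lemma finrank_space (α : PosRoot b) : finrank ℝ α.space = 2 := by
  have h := α.sum_onb_space (ip 𝔤)
  rw [ip_ex_ex, ip_ey_ey] at h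
  simp only [ip_onb, if_true, Finset.sum_const, Finset.card_univ, Fintype.card_fin, nsmul_eq_mul,
    mul_one] at h
  have h' : ((finrank ℝ α.space : ℕ) : ℝ) = ((2 : ℕ) : ℝ) := by rw [h]; norm_num
  exact_mod_cast h'

lemma ip_eq_zero_of_ne {α β : PosRoot b} (h : α ≠ β) {u v : 𝔤} (hu : u ∈ α.space)
    (hv : v ∈ β.space) : ip 𝔤 u v = 0 :=
  ip_eq_zero_of_isRealPart (mem_space.1 hu) (mem_space.1 hv) (form_add_ne_zero α β)
    (form_sub_ne_zero h)

lemma ip_torus {α : PosRoot b} {u Z : 𝔤} (hu : u ∈ α.space) (hZ : Z ∈ 𝔱) : ip 𝔤 Z u = 0 :=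
  ip_eq_zero_of_isRealPart (isRealPart_zero hZ) (mem_space.1 hu)
    (fun h => α.form_ne_zero ((zero_add _).symm.trans h))
    (fun h => α.form_ne_zero (sub_eq_zero.1 h).symm)

lemma space_le (α : PosRoot b) : α.space ≤ 𝔭 𝔱 := fun _ hu _ hZ => ip_torus hu hZ

end PosRoot

variable (b) in
/-- The orthogonal complement of `𝔱` and all the `𝔭_α` is zero. -/
lemma eq_zero_of_orthogonal (v : 𝔤) (h₀ : ∀ Z ∈ 𝔱, ip 𝔤 v Z = 0)
    (h : ∀ α : PosRoot b, ∀ u ∈ α.space, ip 𝔤 v u = 0) : v = 0 := by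
  have hS : (⊤ : Submodule ℂ (ℂ ⊗[ℝ] 𝔤)) ≤
      LinearMap.ker (killingForm ℂ (ℂ ⊗[ℝ] 𝔤) (cx v 0)) := by
    have htop := congrArg LieSubmodule.toSubmodule
      (LieModule.iSup_genWeightSpace_eq_top' ℂ (cartan 𝔱) (ℂ ⊗[ℝ] 𝔤))
    rw [LieSubmodule.iSup_toSubmodule, LieSubmodule.top_toSubmodule] at htop
    rw [← htop]
    refine iSup_le fun χ E hE => ?_
    have hE' : E ∈ LieAlgebra.rootSpace (cartan 𝔱) χ := hE
    -- The real and imaginary parts of a weight vector lie in 𝔱 or in one plane 𝔭_α. Hence v is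
    -- Killing-orthogonal to all weight spaces, which span 𝔤_ℂ.
    have key : ip 𝔤 v (rePart 𝔤 E) = 0 ∧ ip 𝔤 v (imPart 𝔤 E) = 0 := by
      by_cases hχ : χ.IsZero
      · rw [hχ.eq, LieAlgebra.rootSpace_zero_eq] at hE'
        obtain ⟨h₁, h₂⟩ := parts_mem 𝔱 E hE'
        exact ⟨h₀ _ h₁, h₀ _ h₂⟩
      · let i : (cartan 𝔱).root := ⟨χ, Finset.mem_filter.2 ⟨Finset.mem_univ _, hχ⟩⟩
        have hE'' : E ∈ LieAlgebra.rootSpace (cartan 𝔱) ((roots 𝔱).root i) := hE'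
        obtain ⟨α, hα | hα⟩ := exists_posRoot b i
        · rw [hα] at hE''
          obtain ⟨h₁, h₂⟩ := α.parts_of_mem hE''
          exact ⟨h α _ (PosRoot.mem_space_iff.2 h₁), h α _ (PosRoot.mem_space_iff.2 h₂)⟩
        · rw [hα] at hE''
          obtain ⟨h₁, h₂⟩ := α.parts_of_mem_neg hE''
          exact ⟨h α _ (PosRoot.mem_space_iff.2 h₁), h α _ (PosRoot.mem_space_iff.2 h₂)⟩
    rw [LinearMap.mem_ker, ← cx_re_im E, killing_cx]
    simp only [ip_eq_neg_killing, neg_eq_zero] at key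
    simp [key]
  have hv := hS (Submodule.mem_top (x := cx v 0))
  rw [LinearMap.mem_ker, killing_cx] at hv
  have := congrArg Complex.re hv
  simp only [map_zero, LinearMap.zero_apply, sub_zero, add_zero, Complex.ofReal_zero, mul_zero,
    Complex.ofReal_re, Complex.zero_re] at this
  exact eq_zero_of_ip v (by rw [ip_eq_neg_killing, this, neg_zero])

lemma proj_of_mem {W : Submodule ℝ 𝔤} {v : 𝔤} (hv : v ∈ W) : (proj W v : 𝔤) = v := by
  have := Submodule.projectionOnto_apply_left (isCompl_orthogonal W) ⟨v, hv⟩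
  exact congrArg Subtype.val this

variable (b) in
/-- The decomposition `𝔭 = ⨁ 𝔭_α`. -/
lemma sum_proj_space {v : 𝔤} (hv : v ∈ 𝔭 𝔱) : ∑ α : PosRoot b, (proj α.space v : 𝔤) = v := by
  rw [eq_comm, ← sub_eq_zero]
  refine eq_zero_of_orthogonal b _ (fun Z hZ => ?_) fun β u hu => ?_
  · rw [LinearMap.BilinForm.sub_left, ip_symm v, hv Z hZ, map_sum, LinearMap.sum_apply,
      Finset.sum_eq_zero, sub_zero]
    intro α _
    rw [ip_symm]
    exact PosRoot.ip_torus (Subtype.property _) hZ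
  · rw [LinearMap.BilinForm.sub_left, map_sum, LinearMap.sum_apply,
      Finset.sum_eq_single β (fun α _ h => PosRoot.ip_eq_zero_of_ne h (Subtype.property _) hu)
      (fun h => absurd (Finset.mem_univ _) h), ip_proj _ _ ⟨u, hu⟩, sub_self]

end PosRoots
end FullFlag
end

noncomputable section
namespace FullFlag
open Module

/-! ### Brackets of the planes and partial Casimir operators -/

section Brackets

variable {𝔤 : Type*} [LieRing 𝔤] [LieAlgebra ℝ 𝔤] [FiniteDimensional ℝ 𝔤] [IsCompactSemisimple 𝔤]
  {𝔱 : LieSubalgebra ℝ 𝔤} [IsMaximalTorus 𝔱]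

lemma IsRealPart.neg {χ : Dual ℂ (cartan 𝔱)} {u : 𝔤} (hu : IsRealPart χ u) :
    IsRealPart (-χ) u := by
  obtain ⟨E, hE, F, hF, h⟩ := hu
  refine ⟨F, hF, E, ?_, by rw [add_comm, h]⟩
  rwa [neg_neg]

lemma rootSpace_neg_eq_bot {χ : Dual ℂ (cartan 𝔱)} (h₀ : χ ≠ 0)
    (hχ : χ ∉ Set.range (roots 𝔱).root) : LieAlgebra.rootSpace (cartan 𝔱) ⇑(-χ) = ⊥ :=
  rootSpace_eq_bot (neg_ne_zero.2 h₀) fun h => hχ ((roots 𝔱).neg_mem_range_root_iff.1 h)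

/-- The mixed brackets land in the root spaces of ±(χ - ψ), which vanish; only those of ±(χ + ψ)
survive. -/
lemma IsRealPart.lie {χ ψ : Dual ℂ (cartan 𝔱)} {u v : 𝔤} (hu : IsRealPart χ u)
    (hv : IsRealPart ψ v) (h₀ : χ - ψ ≠ 0) (h : χ - ψ ∉ Set.range (roots 𝔱).root) :
    IsRealPart (χ + ψ) ⁅u, v⁆ := by
  obtain ⟨E, hE, E', hE', hu⟩ := hu
  obtain ⟨F, hF, F', hF', hv⟩ := hv
  have h₁ := lie_mem_rootSpace hE hF'
  have h₂ := lie_mem_rootSpace hE' hF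
  have h₃ := lie_mem_rootSpace hE' hF'
  rw [← sub_eq_add_neg, rootSpace_eq_bot h₀ h, LieSubmodule.mem_bot] at h₁
  rw [show -χ + ψ = -(χ - ψ) by abel, rootSpace_neg_eq_bot h₀ h, LieSubmodule.mem_bot] at h₂
  rw [← neg_add] at h₃
  refine ⟨_, lie_mem_rootSpace hE hF, _, h₃, ?_⟩
  have h₄ : cx ⁅u, v⁆ 0 = ⁅cx u 0, cx v 0⁆ := by rw [lie_cx]; simp
  rw [h₄, ← hu, ← hv, LieRing.add_lie, LieRing.lie_add, LieRing.lie_add, h₁, h₂]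
  abel

lemma IsRealPart.eq_zero {χ : Dual ℂ (cartan 𝔱)} {u : 𝔤} (hu : IsRealPart χ u)
    (h₀ : χ ≠ 0) (h : χ ∉ Set.range (roots 𝔱).root) : u = 0 := by
  obtain ⟨E, hE, E', hE', hu⟩ := hu
  rw [rootSpace_eq_bot h₀ h, LieSubmodule.mem_bot] at hE
  rw [rootSpace_neg_eq_bot h₀ h, LieSubmodule.mem_bot] at hE'
  rw [hE, hE', add_zero, eq_comm, cx_eq_zero] at hu
  exact hu.1

variable {b : (roots 𝔱).Base}

/-- One of the three positive roots is the sum of the other two. -/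
def IsTriple (α β γ : PosRoot b) : Prop :=
  γ.form = α.form + β.form ∨ α.form = β.form + γ.form ∨ β.form = α.form + γ.form

lemma exists_isTriple {α β : PosRoot b} (h : RootAdj α β) : ∃ γ, IsTriple α β γ := by
  rcases h with ⟨k, hk⟩ | ⟨k, hk⟩
  · exact ⟨⟨k, RootPairing.Base.IsPos.add α.2 β.2 hk⟩, Or.inl hk⟩
  · obtain ⟨γ, hγ | hγ⟩ := exists_posRoot b k
    · refine ⟨γ, Or.inr (Or.inl ?_)⟩
      rw [← hγ, hk]; abel
    · refine ⟨γ, Or.inr (Or.inr ?_)⟩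
      rw [← neg_neg γ.form, ← hγ, hk]; abel

section

variable (hS : IsSimplyLaced (roots 𝔱))

include hS

/-- In a simply laced system only one of α + β and α - β is a root, so the bracket has components in
a single plane. The cases are the three ways in which γ can arise. -/
lemma IsTriple.lie_mem {α β γ : PosRoot b} (h : IsTriple α β γ) {u v : 𝔤} (hu : u ∈ α.space)
    (hv : v ∈ β.space) : ⁅u, v⁆ ∈ γ.space := by
  rw [PosRoot.mem_space] at hu hv ⊢
  have key : α ≠ β → (roots 𝔱).pairingIn ℤ α.1 β.1 = 1 → IsRealPart (α.form - β.form) ⁅u, v⁆ := by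
    intro hne h₁
    have h₂ : α.form - -β.form ∉ Set.range (roots 𝔱).root := by
      rw [sub_neg_eq_add]
      intro h'
      have := (hS.add_mem_iff α.1 β.1).1 h'
      omega
    rw [sub_eq_add_neg]
    refine hu.lie hv.neg ?_ h₂
    rw [sub_neg_eq_add]
    exact PosRoot.form_add_ne_zero α β
  rcases h with h | h | h
  · have h₁ : (roots 𝔱).pairingIn ℤ α.1 β.1 = -1 := hS.pairing_eq_neg_one h
    have hne : α ≠ β := by
      rintro rfl
      rw [RootPairing.pairingIn_same] at h₁
      omega
    rw [h]
    refine hu.lie hv (PosRoot.form_sub_ne_zero hne) fun h' => ?_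
    have := (hS.sub_mem_iff α.1 β.1).1 h'
    omega
  · have hγ : γ.form = α.form - β.form := by rw [h]; abel
    have h₁ : (roots 𝔱).pairingIn ℤ α.1 β.1 = 1 := hS.pairing_eq_one hγ
    rw [hγ]
    refine key ?_ h₁
    rintro rfl
    exact γ.form_ne_zero (by rw [hγ, sub_self])
  · have hγ : γ.form = β.form - α.form := by rw [h]; abel
    have h₁ : (roots 𝔱).pairingIn ℤ β.1 α.1 = 1 := hS.pairing_eq_one hγ
    rw [hS] at h₁
    rw [hγ, show β.form - α.form = -(α.form - β.form) by abel]
    refine (key ?_ h₁).neg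
    rintro rfl
    exact γ.form_ne_zero (by rw [hγ, sub_self])

end

lemma lie_eq_zero_of_not_adj {α β : PosRoot b} (hne : α ≠ β) (h : ¬ RootAdj α β) {u v : 𝔤}
    (hu : u ∈ α.space) (hv : v ∈ β.space) : ⁅u, v⁆ = 0 := by
  rw [RootAdj, not_or] at h
  rw [PosRoot.mem_space] at hu hv
  exact (hu.lie hv (PosRoot.form_sub_ne_zero hne) h.2).eq_zero (PosRoot.form_add_ne_zero α β) h.1

namespace PosRoot

lemma lie_torus {α : PosRoot b} (Z : 𝔱) (r s : ℝ) :
    ⁅(Z : 𝔤), r • α.ex + s • α.ey⁆ = (s * α.theta Z) • α.ex + (-(r * α.theta Z)) • α.ey := by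
  rw [lie_add, lie_smul, lie_smul, lie_ex, lie_ey]
  module

/-- By the Jacobi identity an infinitesimal rotation of the plane annihilates [ex, ey], so the
bracket commutes with 𝔱 and lies in it by maximality. -/
lemma lie_self_mem {α : PosRoot b} {u v : 𝔤} (hu : u ∈ α.space) (hv : v ∈ α.space) :
    ⁅u, v⁆ ∈ 𝔱 := by
  obtain ⟨r, s, rfl⟩ := mem_space_iff.1 hu
  obtain ⟨r', s', rfl⟩ := mem_space_iff.1 hv
  refine IsMaximalTorus.maximal _ fun Z hZ => ?_
  rw [← lie_skew, leibniz_lie, lie_torus ⟨Z, hZ⟩, lie_torus ⟨Z, hZ⟩]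
  simp only [add_lie, lie_add, smul_lie, lie_smul, lie_self]
  rw [← lie_skew α.ey α.ex]
  module

end PosRoot

/-- The squared length of a root for the Killing form. -/
def rootNorm (i : (cartan 𝔱).root) : ℂ :=
  (roots 𝔱).root i
    ((LieAlgebra.IsKilling.cartanEquivDual (cartan 𝔱)).symm ((roots 𝔱).root i))

lemma rootNorm_ne_zero (i : (cartan 𝔱).root) : rootNorm i ≠ 0 :=
  LieAlgebra.IsKilling.root_apply_cartanEquivDual_symm_ne_zero (Finset.mem_filter.1 i.2).2

/-- For the coroot H of α, B(H, H) equals 4/|α|² by the definition of H, and ∑ ⟨k,i⟩² as the trace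
of (ad H)². The root length is thereby fixed by integer data. -/
lemma rootNorm_mul_sum (i : (cartan 𝔱).root) :
    rootNorm i * ∑ k, (((roots 𝔱).pairingIn ℤ k i : ℤ) : ℂ) ^ 2 = 4 := by
  have h₁ := LieAlgebra.IsKilling.traceForm_coroot i.1 (LieAlgebra.IsKilling.coroot i.1)
  have h₂ : LieModule.traceForm ℂ (cartan 𝔱) (ℂ ⊗[ℝ] 𝔤) (LieAlgebra.IsKilling.coroot i.1)
      (LieAlgebra.IsKilling.coroot i.1) = ∑ k, (((roots 𝔱).pairingIn ℤ k i : ℤ) : ℂ) ^ 2 := by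
    have h := congrArg (fun f => f ((roots 𝔱).coroot i) ((roots 𝔱).coroot i))
      (LieAlgebra.IsKilling.corootForm_rootSystem_eq_killing (H := cartan 𝔱))
    simp only [RootPairing.corootForm_apply_apply] at h
    rw [LieAlgebra.restrict_killingForm] at h
    refine Eq.trans h.symm (Finset.sum_congr rfl fun k _ => ?_)
    have hk := (roots 𝔱).algebraMap_pairingIn ℤ k i
    rw [eq_intCast] at hk
    rw [hk, sq]
    rfl
  rw [h₂, LieAlgebra.IsKilling.root_apply_coroot (Finset.mem_filter.1 i.2).2] at h₁
  rw [h₁]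
  have h₃ := rootNorm_ne_zero i
  change rootNorm i * (2 • (rootNorm i)⁻¹ • (2 : ℂ)) = 4
  rw [smul_eq_mul, nsmul_eq_mul]
  field_simp
  norm_num

lemma apply_cartanEquivDual_symm (i k : (cartan 𝔱).root) :
    (roots 𝔱).root k
      ((LieAlgebra.IsKilling.cartanEquivDual (cartan 𝔱)).symm ((roots 𝔱).root i)) =
      rootNorm i / 2 * ((roots 𝔱).pairingIn ℤ k i : ℤ) := by
  have h₁ : (roots 𝔱).coroot i = 2 • (rootNorm i)⁻¹ •
      (LieAlgebra.IsKilling.cartanEquivDual (cartan 𝔱)).symm ((roots 𝔱).root i) := rfl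
  have hk := (roots 𝔱).algebraMap_pairingIn ℤ k i
  rw [eq_intCast] at hk
  have h₂ : (roots 𝔱).pairing k i = (roots 𝔱).root k ((roots 𝔱).coroot i) := rfl
  rw [hk, h₂, h₁, map_nsmul, map_smul, smul_eq_mul, nsmul_eq_mul]
  have h₃ := rootNorm_ne_zero i
  field_simp
  norm_num

/-- With E = x + iy and Ē = x - iy this is the polarization 2(x² + y²) = EĒ + ĒE. It expresses a
Casimir operator of real vectors by operators which shift weights. -/
lemma lie_lie_cx (x y : 𝔤) (F : ℂ ⊗[ℝ] 𝔤) :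
    (2 : ℂ) • (⁅cx x 0, ⁅cx x 0, F⁆⁆ + ⁅cx y 0, ⁅cx y 0, F⁆⁆) =
      ⁅cx x y, ⁅cx x (-y), F⁆⁆ + ⁅cx x (-y), ⁅cx x y, F⁆⁆ := by
  rw [← cx_re_im F]
  simp only [lie_cx, cx_add, smul_cx, cx_inj]
  simp only [zero_lie, lie_zero, lie_add, lie_sub, neg_lie, lie_neg, Complex.re_ofNat,
    Complex.im_ofNat]
  constructor <;> module

/-- A partial Casimir operator of a root `i` acts on the root space of a root `k ≠ ±i` by a scalar
if the root system is simply laced. -/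
lemma casimir_rootSpace (hS : IsSimplyLaced (roots 𝔱)) {i k : (cartan 𝔱).root} (hik : k ≠ i)
    (hik' : (roots 𝔱).root k ≠ -(roots 𝔱).root i) {x y : 𝔤} (hx : ip 𝔤 x x = 1)
    (hy : ip 𝔤 y y = 1) (hxy : ip 𝔤 x y = 0)
    (hE : cx x y ∈ LieAlgebra.rootSpace (cartan 𝔱) ((roots 𝔱).root i)) {F : ℂ ⊗[ℝ] 𝔤}
    (hF : F ∈ LieAlgebra.rootSpace (cartan 𝔱) ((roots 𝔱).root k)) :
    ⁅cx x 0, ⁅cx x 0, F⁆⁆ + ⁅cx y 0, ⁅cx y 0, F⁆⁆ =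
      (-(rootNorm i / 2) * (((roots 𝔱).pairingIn ℤ k i : ℤ) : ℂ) ^ 2) • F := by
  have hE' := cx_neg_mem_rootSpace hE
  -- B(E, Ē) = B(x, x) + B(y, y), and the frame is orthonormal for -B.
  have hK : killingForm ℂ (ℂ ⊗[ℝ] 𝔤) (cx x y) (cx x (-y)) = -2 := by
    rw [ip_eq_neg_killing] at hx hy hxy
    have hyx : killingForm ℝ 𝔤 y x = 0 := by
      have := ip_symm x y
      rw [ip_eq_neg_killing, ip_eq_neg_killing, hxy] at this
      linarith
    rw [killing_cx, map_neg, map_neg, hyx, show killingForm ℝ 𝔤 x y = 0 by linarith,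
      show killingForm ℝ 𝔤 x x = -1 by linarith, show killingForm ℝ 𝔤 y y = -1 by linarith]
    norm_num
  have hH : ⁅⁅cx x y, cx x (-y)⁆, F⁆ =
      (-rootNorm i * ((roots 𝔱).pairingIn ℤ k i : ℤ)) • F := by
    have h₁ := LieAlgebra.IsKilling.lie_eq_killingForm_smul_of_mem_rootSpace_of_mem_rootSpace_neg
      (α := i.1) hE hE'
    have h₂ := LieAlgebra.IsKilling.lie_eq_smul_of_mem_rootSpace hF
      ((LieAlgebra.IsKilling.cartanEquivDual (cartan 𝔱)).symm ((roots 𝔱).root i))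
    rw [apply_cartanEquivDual_symm] at h₂
    rw [h₁, hK, smul_lie_cx]
    refine (congrArg ((-2 : ℂ) • ·) h₂).trans ?_
    simp only [smul_smul]
    congr 1
    ring
  have hadd : (roots 𝔱).root k + (roots 𝔱).root i ≠ 0 := fun h =>
    hik' (eq_neg_of_add_eq_zero_left h)
  have hsub : (roots 𝔱).root k - (roots 𝔱).root i ≠ 0 := fun h =>
    hik ((roots 𝔱).root.injective (sub_eq_zero.1 h))
  -- k + i is a root only for pairing -1, and k - i only for pairing 1. So at most one of EĒF and
  -- ĒEF is nonzero, and it is then ±[E, Ē]F, a known multiple of F.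
  have hplus : (roots 𝔱).pairingIn ℤ k i ≠ -1 → ⁅cx x y, F⁆ = 0 := by
    intro h
    have h₁ := lie_mem_rootSpace hE hF
    rwa [add_comm, rootSpace_eq_bot hadd fun h' => h ((hS.add_mem_iff k i).1 h'),
      LieSubmodule.mem_bot] at h₁
  have hminus : (roots 𝔱).pairingIn ℤ k i ≠ 1 → ⁅cx x (-y), F⁆ = 0 := by
    intro h
    have h₁ := lie_mem_rootSpace hE' hF
    rwa [neg_add_eq_sub, rootSpace_eq_bot hsub fun h' => h ((hS.sub_mem_iff k i).1 h'),
      LieSubmodule.mem_bot] at h₁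
  have hj := leibniz_lie (cx x y) (cx x (-y)) F
  rw [hH] at hj
  have two : (2 : ℂ) ≠ 0 := two_ne_zero
  refine smul_right_injective _ two ?_
  change (2 : ℂ) • _ = (2 : ℂ) • _
  rw [lie_lie_cx]
  rcases hS.pairing_cases k i with ⟨h, -⟩ | ⟨h, -⟩ | ⟨-, -, h | h | h⟩
  · exact absurd h hik
  · exact absurd h hik'
  · rw [hplus (by omega), hminus (by omega), h, lie_zero_cx, lie_zero_cx]
    simp
  · rw [hj, hplus (by omega), h, smul_smul, lie_zero_cx, add_zero, add_zero]
    congr 1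
    push_cast
    ring
  · rw [hminus (by omega)] at hj ⊢
    rw [lie_zero_cx, eq_comm, add_eq_zero_iff_neg_eq] at hj
    rw [← hj, h, smul_smul, ← neg_smul, lie_zero_cx, zero_add]
    congr 1
    push_cast
    ring

/-- Decompose v into its components in 𝔤_β and 𝔤_{-β}; `casimir_rootSpace` gives the same scalar on
both. As c is real, the identity descends from 𝔤_ℂ to 𝔤. -/
lemma casimir_space (hS : IsSimplyLaced (roots 𝔱)) {α β : PosRoot b} (h : α ≠ β) {c : ℝ}
    (hc : rootNorm α.1 = c) {v : 𝔤} (hv : v ∈ β.space) :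
    ∑ j, ⁅(onb α.space j : 𝔤), ⁅(onb α.space j : 𝔤), v⁆⁆ =
      (-(c / 2) * (((roots 𝔱).pairingIn ℤ β.1 α.1 : ℤ) : ℝ) ^ 2) • v := by
  let f : 𝔤 →ₗ[ℝ] 𝔤 →ₗ[ℝ] 𝔤 := LinearMap.mk₂ ℝ (fun x y => ⁅x, ⁅y, v⁆⁆)
    (by simp) (by simp) (by simp) (by simp)
  have hf := α.sum_onb_space f
  simp only [f, LinearMap.mk₂_apply] at hf
  rw [hf]
  obtain ⟨E, hE, F, hF, hEF⟩ := PosRoot.mem_space.1 hv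
  have hne : β.1 ≠ α.1 := fun h' => h (Subtype.ext h'.symm)
  have hne' : (roots 𝔱).root β.1 ≠ -(roots 𝔱).root α.1 := root_ne_neg_of_isPos β.2 α.2
  have h₁ := casimir_rootSpace hS hne hne' α.ip_ex_ex α.ip_ey_ey α.ip_ex_ey α.cx_mem hE
  -- β and -β have opposite pairings with α, but only the square of the pairing enters the scalar.
  let k := (roots 𝔱).reflectionPerm β.1 β.1
  have hk : (roots 𝔱).root k = -(roots 𝔱).root β.1 := by
    rw [RootPairing.root_reflectionPerm, RootPairing.reflection_apply_self]
  have hkp : (roots 𝔱).pairingIn ℤ k α.1 = -(roots 𝔱).pairingIn ℤ β.1 α.1 :=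
    (roots 𝔱).pairingIn_reflectionPerm_self_left ℤ β.1 α.1
  have h₂ := casimir_rootSpace hS (i := α.1) (k := k) (F := F)
    (fun h' => hne' (by rw [← h', hk, neg_neg]))
    (fun h' => hne ((roots 𝔱).root.injective (neg_injective (by rw [← hk, h']))))
    α.ip_ex_ex α.ip_ey_ey α.ip_ex_ey α.cx_mem (by rw [hk]; exact hF)
  rw [hkp, Int.cast_neg, neg_sq] at h₂
  have h₃ : ∀ x : 𝔤, cx ⁅x, ⁅x, v⁆⁆ 0 = ⁅cx x 0, ⁅cx x 0, E⁆⁆ + ⁅cx x 0, ⁅cx x 0, F⁆⁆ := by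
    intro x
    rw [← LieRing.lie_add, ← LieRing.lie_add, hEF, lie_cx, lie_cx]
    simp
  have h₄ : cx (⁅α.ex, ⁅α.ex, v⁆⁆ + ⁅α.ey, ⁅α.ey, v⁆⁆) 0 =
      (-(rootNorm α.1 / 2) * (((roots 𝔱).pairingIn ℤ β.1 α.1 : ℤ) : ℂ) ^ 2) • cx v 0 := by
    rw [← hEF, smul_add, ← h₁, ← h₂, ← add_zero (0 : 𝔤), ← cx_add, h₃, h₃]
    simp only [add_zero]
    abel
  have h₅ : (-(rootNorm α.1 / 2) * (((roots 𝔱).pairingIn ℤ β.1 α.1 : ℤ) : ℂ) ^ 2) =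
      ((-(c / 2) * (((roots 𝔱).pairingIn ℤ β.1 α.1 : ℤ) : ℝ) ^ 2 : ℝ) : ℂ) := by
    rw [hc]; push_cast; ring
  rw [h₅, smul_cx] at h₄
  simpa only [Complex.ofReal_re, Complex.ofReal_im, zero_smul, sub_zero] using (cx_inj.1 h₄).1

end Brackets
end FullFlag
end

noncomputable section
namespace FullFlag
open Module

section Formula

variable {𝔤 : Type*} [LieRing 𝔤] [LieAlgebra ℝ 𝔤] [FiniteDimensional ℝ 𝔤] [IsCompactSemisimple 𝔤]
  {𝔱 : LieSubalgebra ℝ 𝔤} [IsMaximalTorus 𝔱] {b : (roots 𝔱).Base}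

/-! ### The block decomposition of `Sym(𝔭)^T` -/

/-- The orthogonal projection onto `𝔭_α`, as an endomorphism of `𝔭`. -/
def PosRoot.blockProj (α : PosRoot b) : End ℝ (𝔭 𝔱) :=
  proj (𝔭 𝔱) ∘ₗ α.space.subtype ∘ₗ proj α.space ∘ₗ (𝔭 𝔱).subtype

namespace PosRoot

lemma blockId_eq (α : PosRoot b) : α.blockId = (1 / √2 : ℝ) • α.blockProj := by
  rw [blockId, blockProj, finrank_space]
  norm_num

lemma coe_blockProj (α : PosRoot b) (X : 𝔭 𝔱) : (α.blockProj X : 𝔤) = proj α.space (X : 𝔤) :=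
  proj_of_mem (α.space_le (Subtype.property _))

lemma blockProj_self (α : PosRoot b) {X : 𝔭 𝔱} (hX : (X : 𝔤) ∈ α.space) : α.blockProj X = X :=
  Subtype.ext (by rw [coe_blockProj, proj_of_mem hX])

lemma blockProj_of_ne {α β : PosRoot b} (h : α ≠ β) {X : 𝔭 𝔱} (hX : (X : 𝔤) ∈ β.space) :
    α.blockProj X = 0 := by
  refine Subtype.ext ?_
  rw [coe_blockProj, Submodule.coe_zero, Submodule.coe_eq_zero]
  refine eq_of_ip_eq _ _ _ fun w => ?_
  rw [ip_proj, ip_eq_zero_of_ne h.symm hX w.2]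
  simp

end PosRoot

lemma sum_blockProj_apply (X : 𝔭 𝔱) : ∑ α : PosRoot b, α.blockProj X = X := by
  refine Subtype.ext ?_
  rw [Submodule.coe_sum]
  simp_rw [PosRoot.coe_blockProj]
  exact sum_proj_space b X.2

variable (b) in
lemma end_ext {F : Type*} [AddCommGroup F] [Module ℝ F] {A B : 𝔭 𝔱 →ₗ[ℝ] F}
    (h : ∀ (α : PosRoot b) (X : 𝔭 𝔱), (X : 𝔤) ∈ α.space → A X = B X) : A = B := by
  ext1 X
  rw [← sum_blockProj_apply (b := b) X, map_sum, map_sum]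
  exact Finset.sum_congr rfl fun α _ => h α _ (by rw [PosRoot.coe_blockProj]; exact Subtype.property _)

lemma sum_smul_blockProj_apply (c : PosRoot b → ℝ) (β : PosRoot b) {X : 𝔭 𝔱}
    (hX : (X : 𝔤) ∈ β.space) : (∑ α, c α • α.blockProj) X = c β • X := by
  rw [LinearMap.sum_apply, Finset.sum_eq_single β]
  · rw [LinearMap.smul_apply, β.blockProj_self hX]
  · intro α _ h
    rw [LinearMap.smul_apply, PosRoot.blockProj_of_ne h hX, smul_zero]
  · exact fun h => absurd (Finset.mem_univ _) h

namespace PosRoot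

lemma lie_torus_mem {α : PosRoot b} {Z X : 𝔤} (hZ : Z ∈ 𝔱) (hX : X ∈ α.space) :
    ⁅Z, X⁆ ∈ α.space := by
  obtain ⟨r, s, rfl⟩ := mem_space_iff.1 hX
  exact mem_space_iff.2 ⟨_, _, lie_torus ⟨Z, hZ⟩ r s⟩

lemma coe_adP_torus {α : PosRoot b} {Z : 𝔤} (hZ : Z ∈ 𝔱) {X : 𝔭 𝔱} (hX : (X : 𝔤) ∈ α.space) :
    (adP 𝔱 Z X : 𝔤) = ⁅Z, (X : 𝔤)⁆ :=
  proj_of_mem (α.space_le (lie_torus_mem hZ hX))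

lemma blockProj_mul (α β : PosRoot b) :
    α.blockProj * β.blockProj = if α = β then α.blockProj else 0 := by
  refine end_ext b fun γ X hX => ?_
  rw [Module.End.mul_apply]
  by_cases hβ : β = γ
  · subst hβ
    rw [blockProj_self β hX]
    split_ifs with h
    · rfl
    · rw [blockProj_of_ne h hX]; rfl
  · rw [blockProj_of_ne hβ hX, map_zero]
    split_ifs with h
    · rw [h, blockProj_of_ne hβ hX]
    · rfl

/-- Factor the projection through the plane; cyclicity of the trace turns it into the identity of a
two-dimensional space. -/
lemma trace_blockProj (α : PosRoot b) : LinearMap.trace ℝ (𝔭 𝔱) α.blockProj = 2 := by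
  have h : α.blockProj = (proj (𝔭 𝔱) ∘ₗ α.space.subtype) ∘ₗ (proj α.space ∘ₗ (𝔭 𝔱).subtype) := rfl
  rw [h, LinearMap.trace_comp_comm']
  have h' : (proj α.space ∘ₗ (𝔭 𝔱).subtype) ∘ₗ (proj (𝔭 𝔱) ∘ₗ α.space.subtype) = LinearMap.id := by
    ext w
    simp only [LinearMap.comp_apply, Submodule.subtype_apply, LinearMap.id_apply]
    rw [proj_of_mem (α.space_le w.2), proj_of_mem w.2]
  rw [h', LinearMap.trace_id, finrank_space]
  norm_num

lemma blockProj_mem (α : PosRoot b) : α.blockProj ∈ symInv 𝔱 := by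
  constructor
  · intro X Y
    rw [coe_blockProj, coe_blockProj]
    have h₁ := ip_proj α.space (X : 𝔤) (proj α.space (Y : 𝔤))
    have h₂ := ip_proj α.space (Y : 𝔤) (proj α.space (X : 𝔤))
    rw [← h₁, ip_symm, ← h₂, ip_symm]
  · intro Z hZ
    refine end_ext b fun β X hX => ?_
    have hX' : (adP 𝔱 Z X : 𝔤) ∈ β.space := by
      rw [coe_adP_torus hZ hX]
      exact lie_torus_mem hZ hX
    rw [comm, LinearMap.sub_apply, Module.End.mul_apply, Module.End.mul_apply, LinearMap.zero_apply]
    by_cases h : α = β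
    · subst h
      rw [blockProj_self α hX, blockProj_self α hX', sub_self]
    · rw [blockProj_of_ne h hX, blockProj_of_ne h hX', map_zero, sub_self]

lemma theta_add (α : PosRoot b) (Z W : 𝔱) : α.theta (Z + W) = α.theta Z + α.theta W := by
  have h : toCartan (Z + W) = toCartan Z + toCartan W :=
    Subtype.ext (TensorProduct.tmul_add _ _ _)
  rw [theta, h, map_add, Complex.add_im]
  rfl

lemma exists_theta_ne_zero (α : PosRoot b) : ∃ Z : 𝔱, α.theta Z ≠ 0 := by
  by_contra! h
  refine α.form_ne_zero (ext_toCartan fun Z => Complex.ext ?_ ?_)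
  · simpa using α.form_re Z
  · have h' := h Z
    simp only [theta] at h'
    simpa using h'

/-- Otherwise 𝔱 would be the union of the kernels of θ_α - θ_β and θ_α + θ_β, both proper because α
≠ ±β. The sum Z + W of vectors outside either kernel gives the contradiction. -/
lemma exists_theta_sq_ne {α β : PosRoot b} (h : α ≠ β) :
    ∃ Z : 𝔱, α.theta Z ^ 2 ≠ β.theta Z ^ 2 := by
  by_contra! hsq
  have h₁ : ∃ Z, α.theta Z ≠ β.theta Z := by
    by_contra! h'
    refine h (form_injective (ext_toCartan fun Z => Complex.ext ?_ (h' Z)))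
    rw [α.form_re, β.form_re]
  have h₂ : ∃ Z, α.theta Z ≠ -β.theta Z := by
    by_contra! h'
    refine form_add_ne_zero α β (ext_toCartan fun Z => Complex.ext ?_ ?_)
    · simp [α.form_re, β.form_re]
    · have := h' Z
      simp only [theta] at this
      simp [this]
  obtain ⟨Z, hZ⟩ := h₁
  obtain ⟨W, hW⟩ := h₂
  have hZ' := (sq_eq_sq_iff_eq_or_eq_neg.1 (hsq Z)).resolve_left hZ
  have hW' := (sq_eq_sq_iff_eq_or_eq_neg.1 (hsq W)).resolve_right hW
  have hZW := sq_eq_sq_iff_eq_or_eq_neg.1 (hsq (Z + W))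
  rw [theta_add, theta_add] at hZW
  rcases hZW with h' | h'
  · exact hZ (by linarith)
  · exact hW (by linarith)

end PosRoot

lemma lie_torus_mem_compl {Z : 𝔤} (hZ : Z ∈ 𝔱) (X : 𝔤) : ⁅Z, X⁆ ∈ 𝔭 𝔱 := by
  intro W hW
  change ip 𝔤 W ⁅Z, X⁆ = 0
  have h := ip_lie Z W X
  rw [IsMaximalTorus.abelian Z hZ W hW, map_zero, LinearMap.zero_apply] at h
  linarith

lemma coe_adP_torus {Z : 𝔤} (hZ : Z ∈ 𝔱) (X : 𝔭 𝔱) : (adP 𝔱 Z X : 𝔤) = ⁅Z, (X : 𝔤)⁆ :=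
  proj_of_mem (lie_torus_mem_compl hZ X)

lemma adP_comm_of_mem {A : End ℝ (𝔭 𝔱)} (hA : A ∈ symInv 𝔱) {Z : 𝔤} (hZ : Z ∈ 𝔱) (X : 𝔭 𝔱) :
    adP 𝔱 Z (A X) = A (adP 𝔱 Z X) := by
  have := LinearMap.congr_fun (hA.2 Z hZ) X
  simpa [comm, sub_eq_zero] using this

lemma adP_adP_torus {α : PosRoot b} (Z : 𝔱) {X : 𝔭 𝔱} (hX : (X : 𝔤) ∈ α.space) :
    adP 𝔱 (Z : 𝔤) (adP 𝔱 (Z : 𝔤) X) = (-α.theta Z ^ 2) • X := by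
  refine Subtype.ext ?_
  rw [coe_adP_torus Z.2, coe_adP_torus Z.2, Submodule.coe_smul]
  obtain ⟨r, s, h⟩ := PosRoot.mem_space_iff.1 hX
  rw [h, PosRoot.lie_torus, PosRoot.lie_torus]
  module

/-- The `𝔭_α` are pairwise inequivalent, hence preserved by the elements of `Sym(𝔭)^T`. -/
lemma apply_mem_space {A : End ℝ (𝔭 𝔱)} (hA : A ∈ symInv 𝔱) {α : PosRoot b} {X : 𝔭 𝔱}
    (hX : (X : 𝔤) ∈ α.space) : (A X : 𝔤) ∈ α.space := by
  have h : ∀ β : PosRoot b, β ≠ α → proj β.space (A X : 𝔤) = 0 := by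
    intro β hβ
    -- (ad Z)² is symmetric, commutes with A, and acts by -θ_α(Z)² and -θ_β(Z)² on the two planes.
    -- As these differ, A X has no component in 𝔭_β.
    obtain ⟨Z, hZ⟩ := PosRoot.exists_theta_sq_ne hβ
    refine eq_of_ip_eq _ _ _ fun w => ?_
    rw [ip_proj, Submodule.coe_zero, map_zero, LinearMap.zero_apply]
    have h₁ : adP 𝔱 (Z : 𝔤) (adP 𝔱 (Z : 𝔤) (A X)) = (-α.theta Z ^ 2) • A X := by
      rw [adP_comm_of_mem hA Z.2, adP_comm_of_mem hA Z.2, adP_adP_torus Z hX, map_smul]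
    have h₂ := adP_adP_torus Z (X := ⟨w, β.space_le w.2⟩) w.2
    have h₃ := ip_adP_skew 𝔱 (Z : 𝔤) (adP 𝔱 (Z : 𝔤) (A X)) ⟨w, β.space_le w.2⟩
    rw [ip_adP_skew 𝔱 (Z : 𝔤) (A X), neg_neg, h₁, h₂] at h₃
    simp only [Submodule.coe_smul, map_smul, LinearMap.smul_apply, smul_eq_mul] at h₃
    have h₄ : (α.theta Z ^ 2 - β.theta Z ^ 2) * ip 𝔤 (A X : 𝔤) w = 0 := by linarith
    exact (mul_eq_zero.1 h₄).resolve_left fun h' => hZ (by linarith)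
  have h' := sum_proj_space b (A X).2
  rw [Finset.sum_eq_single α (fun β _ hβ => by rw [h β hβ]; rfl)
    (fun h => absurd (Finset.mem_univ _) h)] at h'
  rw [← h']
  exact Subtype.property _

/-- If θ_α(Z) ≠ 0, then ad Z is a multiple of the quarter turn J of the plane. Commuting with J
makes A = r + sJ up to the sign of J, and symmetry forces s = 0. -/
lemma exists_scalar {A : End ℝ (𝔭 𝔱)} (hA : A ∈ symInv 𝔱) (α : PosRoot b) :
    ∃ c : ℝ, ∀ X : 𝔭 𝔱, (X : 𝔤) ∈ α.space → A X = c • X := by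
  let x : 𝔭 𝔱 := ⟨α.ex, α.space_le α.ex_mem⟩
  let y : 𝔭 𝔱 := ⟨α.ey, α.space_le α.ey_mem⟩
  obtain ⟨Z, hZ⟩ := α.exists_theta_ne_zero
  have hx : adP 𝔱 (Z : 𝔤) x = -α.theta Z • y :=
    Subtype.ext (by rw [coe_adP_torus Z.2]; exact α.lie_ex Z)
  have hy : adP 𝔱 (Z : 𝔤) y = α.theta Z • x :=
    Subtype.ext (by rw [coe_adP_torus Z.2]; exact α.lie_ey Z)
  obtain ⟨r, s, h⟩ := PosRoot.mem_space_iff.1 (apply_mem_space hA (X := x) α.ex_mem)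
  have hAx : A x = r • x + s • y := Subtype.ext h
  have h₁ := adP_comm_of_mem hA Z.2 x
  rw [hAx, hx, map_add, map_smul, map_smul, hx, hy, map_smul] at h₁
  have hAy : A y = r • y - s • x := by
    refine smul_right_injective _ (neg_ne_zero.2 hZ) ?_
    change -α.theta Z • A y = -α.theta Z • _
    rw [← h₁]
    module
  have hsym := hA.1 x y
  rw [hAx, hAy] at hsym
  simp only [Submodule.coe_add, Submodule.coe_sub, Submodule.coe_smul, map_add, map_sub, map_smul,
    LinearMap.add_apply, LinearMap.smul_apply, smul_eq_mul] at hsym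
  change r * ip 𝔤 α.ex α.ey + s * ip 𝔤 α.ey α.ey =
    r * ip 𝔤 α.ex α.ey - s * ip 𝔤 α.ex α.ex at hsym
  rw [α.ip_ex_ex, α.ip_ey_ey] at hsym
  have hs : s = 0 := by linarith
  rw [hs, zero_smul, add_zero] at hAx
  rw [hs, zero_smul, sub_zero] at hAy
  refine ⟨r, fun X hX => ?_⟩
  obtain ⟨p, q, hpq⟩ := PosRoot.mem_space_iff.1 hX
  have hX' : X = p • x + q • y := Subtype.ext hpq
  rw [hX', map_add, map_smul, map_smul, hAx, hAy]
  module

variable (b) in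
lemma exists_eq_sum_blockProj {A : End ℝ (𝔭 𝔱)} (hA : A ∈ symInv 𝔱) :
    ∃ c : PosRoot b → ℝ, A = ∑ α, c α • α.blockProj := by
  choose c hc using exists_scalar (b := b) hA
  exact ⟨c, end_ext b fun β X hX => by rw [hc β X hX, sum_smul_blockProj_apply c β hX]⟩

lemma trace_blockId_mul (α β : PosRoot b) :
    LinearMap.trace ℝ (𝔭 𝔱) (α.blockId * β.blockId) = if α = β then 1 else 0 := by
  rw [PosRoot.blockId_eq, PosRoot.blockId_eq, smul_mul_assoc, mul_smul_comm, smul_smul, map_smul,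
    PosRoot.blockProj_mul]
  have h : (1 / √2 * (1 / √2) : ℝ) * 2 = 1 := by
    rw [div_mul_div_comm, one_mul, Real.mul_self_sqrt two_pos.le]
    norm_num
  split_ifs with h'
  · rw [PosRoot.trace_blockProj, smul_eq_mul, h]
  · rw [map_zero, smul_zero]

lemma span_blockId :
    Submodule.span ℝ (Set.range fun α : PosRoot b => α.blockId) = symInv 𝔱 := by
  refine le_antisymm (Submodule.span_le.2 ?_) fun A hA => ?_
  · rintro _ ⟨α, rfl⟩
    simp only [PosRoot.blockId_eq]
    exact Submodule.smul_mem _ _ α.blockProj_mem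
  · obtain ⟨c, rfl⟩ := exists_eq_sum_blockProj b hA
    refine Submodule.sum_mem _ fun α _ => ?_
    have h : c α • α.blockProj = (c α * √2) • α.blockId := by
      rw [PosRoot.blockId_eq, smul_smul, mul_assoc, mul_one_div_cancel (by positivity), mul_one]
    rw [h]
    exact Submodule.smul_mem _ _ (Submodule.subset_span ⟨α, rfl⟩)

/-! ### The structural constants and the Lichnerowicz Laplacian -/

/-- Expand the projection of Xᵢ in the basis of 𝔭_α and resum over i. The sum over a basis of 𝔭
becomes one over a basis of the plane. -/
lemma casP_blockProj (α : PosRoot b) :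
    casP 𝔱 α.blockProj = -∑ j, adP 𝔱 (onb α.space j : 𝔤) * adP 𝔱 (onb α.space j : 𝔤) := by
  rw [casP]
  congr 1
  change ∑ i, adMul 𝔱 (α.blockProj (onb (𝔭 𝔱) i) : 𝔤) (onb (𝔭 𝔱) i) =
    ∑ j, adMul 𝔱 (onb α.space j) (onb α.space j)
  have h₁ : ∀ X : 𝔭 𝔱, (α.blockProj X : 𝔤) =
      ∑ j, ip 𝔤 (onb α.space j : 𝔤) X • (onb α.space j : 𝔤) := by
    intro X
    have h := sum_ip_onb_coe α.space (α.blockProj X) (by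
      rw [PosRoot.coe_blockProj]; exact Subtype.property _)
    refine h.symm.trans (Finset.sum_congr rfl fun j _ => ?_)
    rw [PosRoot.coe_blockProj, ip_proj, ip_symm]
  simp_rw [h₁, map_sum, LinearMap.sum_apply]
  rw [Finset.sum_comm]
  refine Finset.sum_congr rfl fun j _ => ?_
  have h₂ : (onb α.space j : 𝔤) ∈ 𝔭 𝔱 := α.space_le (Subtype.property _)
  have h₃ := congrArg (adMul 𝔱 (onb α.space j : 𝔤)) (sum_ip_onb_coe (𝔭 𝔱) _ h₂)
  rw [map_sum] at h₃
  rw [← h₃]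
  simp_rw [map_smul, LinearMap.smul_apply]

lemma casP_one : casP 𝔱 1 = ∑ α : PosRoot b, casP 𝔱 α.blockProj := by
  simp only [casP]
  rw [Finset.sum_neg_distrib, Finset.sum_comm]
  congr 1
  refine Finset.sum_congr rfl fun i _ => ?_
  rw [← Finset.sum_mul, ← map_sum, ← Submodule.coe_sum, sum_blockProj_apply]
  rfl

lemma proj_torus {Z : 𝔤} (hZ : Z ∈ 𝔱) : proj (𝔭 𝔱) Z = 0 :=
  eq_of_ip_eq _ _ _ fun w => by
    rw [ip_proj, Submodule.coe_zero, map_zero, LinearMap.zero_apply]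
    exact w.2 Z hZ

section

variable (hS : IsSimplyLaced (roots 𝔱))

include hS

lemma rootAdj_iff (α β : PosRoot b) :
    RootAdj α β ↔ (roots 𝔱).pairingIn ℤ α.1 β.1 = -1 ∨ (roots 𝔱).pairingIn ℤ α.1 β.1 = 1 :=
  or_congr (hS.add_mem_iff α.1 β.1) (hS.sub_mem_iff α.1 β.1)

lemma not_rootAdj_self (α : PosRoot b) : ¬ RootAdj α α := by
  rw [rootAdj_iff hS, RootPairing.pairingIn_same]
  omega

open Classical in
-- The 4 is ⟨α,α⟩²; the value -2 does not occur between positive roots. This turns adjacency into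
-- the entrywise square of the pairing.
lemma pairing_sq (α β : PosRoot b) :
    ((roots 𝔱).pairingIn ℤ α.1 β.1) ^ 2 = (if RootAdj α β then 1 else 0) + if α = β then 4 else 0 := by
  by_cases h : α = β
  · subst h
    rw [RootPairing.pairingIn_same, if_neg (not_rootAdj_self hS α), if_pos rfl]
    norm_num
  · rw [if_neg h, rootAdj_iff hS]
    rcases hS.pairing_cases α.1 β.1 with ⟨h', -⟩ | ⟨h', -⟩ | ⟨-, -, h' | h' | h'⟩
    · exact absurd (Subtype.ext h') h
    · exact absurd h' (root_ne_neg_of_isPos α.2 β.2)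
    all_goals rw [h']; norm_num

lemma lie_mem_compl {α β : PosRoot b} (h : α ≠ β) {u v : 𝔤} (hu : u ∈ α.space)
    (hv : v ∈ β.space) : ⁅u, v⁆ ∈ 𝔭 𝔱 := by
  by_cases h' : RootAdj α β
  · obtain ⟨γ, hγ⟩ := exists_isTriple h'
    exact γ.space_le (hγ.lie_mem hS hu hv)
  · rw [lie_eq_zero_of_not_adj h h' hu hv]
    exact zero_mem _

variable {c : ℝ} (hc : ∀ i : (cartan 𝔱).root, rootNorm i = c)

include hc

open Classical in
-- For α ≠ β the inner bracket stays in 𝔭, so its projection changes nothing and `casimir_space`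
-- applies. For α = β it lies in 𝔱 and projects to zero.
lemma casP_blockProj_apply {α β : PosRoot b} {X : 𝔭 𝔱} (hX : (X : 𝔤) ∈ β.space) :
    casP 𝔱 α.blockProj X = (c / 2 * (if RootAdj α β then 1 else 0)) • X := by
  rw [casP_blockProj, LinearMap.neg_apply, LinearMap.sum_apply]
  by_cases h : α = β
  · subst h
    rw [if_neg (not_rootAdj_self hS α), Finset.sum_eq_zero, neg_zero, mul_zero, zero_smul]
    intro j _
    have h' : adP 𝔱 (onb α.space j : 𝔤) X = 0 :=
      (adP_apply 𝔱 _ X).trans (proj_torus (PosRoot.lie_self_mem (onb α.space j).2 hX))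
    rw [Module.End.mul_apply, h', map_zero]
  · have h₁ : ∀ j, (adP 𝔱 (onb α.space j : 𝔤) * adP 𝔱 (onb α.space j : 𝔤)) X =
        proj (𝔭 𝔱) ⁅(onb α.space j : 𝔤), ⁅(onb α.space j : 𝔤), (X : 𝔤)⁆⁆ := by
      intro j
      rw [Module.End.mul_apply, adP_apply, adP_apply,
        proj_of_mem (lie_mem_compl hS h (onb α.space j).2 hX)]
    simp_rw [h₁]
    rw [← map_sum, casimir_space hS h (hc α.1) hX, map_smul]
    have h₂ : proj (𝔭 𝔱) (X : 𝔤) = X := Subtype.ext (proj_of_mem X.2)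
    have h₃ := pairing_sq hS α β
    rw [if_neg h, add_zero] at h₃
    have h₄ : ((((roots 𝔱).pairingIn ℤ β.1 α.1 : ℤ) : ℝ)) ^ 2 = if RootAdj α β then 1 else 0 := by
      rw [hS, ← Int.cast_pow, h₃]
      split_ifs <;> simp
    rw [h₂, h₄, ← neg_smul]
    congr 1
    ring

/-- The structural constants of a simply laced root system. -/
lemma hasStructConst : HasStructConst b c := by
  intro α β γ
  constructor
  · intro h
    have h' : IsTriple α β γ := h
    have hadj : RootAdj α β := by
      rcases h with h | h | h
      · exact Or.inl ⟨γ.1, h⟩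
      · exact Or.inr ⟨γ.1, by change γ.form = _; rw [h]; abel⟩
      · refine Or.inr ((roots 𝔱).neg_mem_range_root_iff.1 ⟨γ.1, ?_⟩)
        change γ.form = _
        rw [h]
        abel
    have hne : α ≠ β := by
      rintro rfl
      exact not_rootAdj_self hS α hadj
    -- The bracket of u ∈ 𝔭_α and v ∈ 𝔭_β lies in 𝔭_γ, so Parseval gives |[u, v]|² = -⟨v, [u, [u,
    -- v]]⟩. Summed over u this is the Casimir operator of 𝔭_α.
    have h₁ : ∀ i j, ∑ k, ip 𝔤 ⁅(onb α.space i : 𝔤), (onb β.space j : 𝔤)⁆ (onb γ.space k) ^ 2 =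
        -ip 𝔤 (onb β.space j : 𝔤)
          ⁅(onb α.space i : 𝔤), ⁅(onb α.space i : 𝔤), (onb β.space j : 𝔤)⁆⁆ := by
      intro i j
      simp_rw [sq]
      rw [sum_ip_mul_ip γ.space _ _
        (h'.lie_mem hS (Subtype.property _) (Subtype.property _)), ip_lie]
    have h₂ : ((((roots 𝔱).pairingIn ℤ β.1 α.1 : ℤ) : ℝ)) ^ 2 = 1 := by
      rw [hS]
      rcases (rootAdj_iff hS α β).1 hadj with h | h <;> rw [h] <;> norm_num
    have h₃ : ∀ j, ∑ i, -ip 𝔤 (onb β.space j : 𝔤)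
          ⁅(onb α.space i : 𝔤), ⁅(onb α.space i : 𝔤), (onb β.space j : 𝔤)⁆⁆ = c / 2 := by
      intro j
      rw [Finset.sum_neg_distrib, ← map_sum, casimir_space hS hne (hc α.1) (Subtype.property _), h₂,
        map_smul, ip_onb, if_pos rfl]
      simp
    rw [structConst]
    simp_rw [h₁]
    rw [Finset.sum_comm]
    simp_rw [h₃]
    -- Each of the two basis vectors of 𝔭_β contributes c/2.
    rw [Finset.sum_const, Finset.card_univ, Fintype.card_fin, β.finrank_space, nsmul_eq_mul]
    push_cast
    ring
  · intro h
    refine Finset.sum_eq_zero fun i _ => Finset.sum_eq_zero fun j _ => Finset.sum_eq_zero fun k _ => ?_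
    have hi : (onb α.space i : 𝔤) ∈ α.space := Subtype.property _
    have hj : (onb β.space j : 𝔤) ∈ β.space := Subtype.property _
    have hk : (onb γ.space k : 𝔤) ∈ γ.space := Subtype.property _
    rw [sq_eq_zero_iff]
    by_cases hαβ : α = β
    · subst hαβ
      exact PosRoot.ip_torus hk (PosRoot.lie_self_mem hi hj)
    · by_cases hadj : RootAdj α β
      · obtain ⟨δ, hδ⟩ := exists_isTriple hadj
        refine PosRoot.ip_eq_zero_of_ne (fun h' => h ?_) (hδ.lie_mem hS hi hj) hk
        rw [← h']
        exact hδ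
      · rw [lie_eq_zero_of_not_adj hαβ hadj hi hj, map_zero, LinearMap.zero_apply]

variable {κ : ℕ} (hκ : HasValency b κ)

include hκ

omit hS hc in
open Classical in
lemma sum_adj (β : PosRoot b) : ∑ α : PosRoot b, (if RootAdj β α then (1 : ℝ) else 0) = κ := by
  rw [Finset.sum_boole, ← hκ β, Nat.card_eq_fintype_card, Fintype.card_subtype]

open Classical in
-- C_1 acts on each plane by c/2 times a row sum of the adjacency matrix, and constant valency makes
-- these equal.
lemma casP_one_eq : casP 𝔱 1 = (c / 2 * κ) • (1 : End ℝ (𝔭 𝔱)) := by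
  refine end_ext b fun β X hX => ?_
  rw [casP_one (b := b), LinearMap.sum_apply]
  simp_rw [casP_blockProj_apply hS hc hX]
  rw [← Finset.sum_smul, ← Finset.mul_sum]
  have h : ∀ α : PosRoot b, RootAdj α β ↔ RootAdj β α := fun α => by
    rw [rootAdj_iff hS, rootAdj_iff hS, hS]
  simp_rw [h]
  rw [sum_adj hκ]
  rfl

open Classical in
lemma lichnerowicz_blockProj (α : PosRoot b) :
    lichnerowicz 𝔱 α.blockProj = ∑ β, ((c / 2) • ((κ : ℝ) •
      (1 : Matrix (PosRoot b) (PosRoot b) ℝ) - rootAdjMatrix b) : Matrix _ _ ℝ) β α •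
        β.blockProj := by
  rw [lichnerowicz_eq α.blockProj_mem, casP_one_eq hS hc hκ]
  refine end_ext b fun β X hX => ?_
  rw [sum_smul_blockProj_apply _ β hX, LinearMap.sub_apply, casP_blockProj_apply hS hc hX]
  simp only [smul_mul_assoc, mul_smul_comm, one_mul, mul_one, LinearMap.smul_apply,
    LinearMap.add_apply, Matrix.smul_apply, Matrix.sub_apply, Matrix.one_apply, rootAdjMatrix,
    Matrix.of_apply, smul_eq_mul]
  have h : RootAdj β α ↔ RootAdj α β := by
    rw [rootAdj_iff hS, rootAdj_iff hS, hS]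
  rw [if_congr h rfl rfl]
  by_cases hαβ : β = α
  · subst hαβ
    rw [β.blockProj_self hX, if_pos rfl]
    module
  · rw [PosRoot.blockProj_of_ne (fun h' => hαβ h'.symm) hX, if_neg hαβ]
    module

lemma hasLichnerowiczMatrix :
    HasLichnerowiczMatrix b ((c / 2) • ((κ : ℝ) • (1 : Matrix _ _ ℝ) - rootAdjMatrix b)) := by
  refine ⟨trace_blockId_mul, span_blockId, fun α => ?_⟩
  simp only [PosRoot.blockId_eq]
  rw [map_smul, lichnerowicz_blockProj hS hc hκ, Finset.smul_sum]
  exact Finset.sum_congr rfl fun β _ => smul_comm _ _ _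

end

/-- Sums of even functions over all roots. -/
lemma sum_roots_eq {F : Type*} [AddCommMonoid F] (b : (roots 𝔱).Base) (f : (cartan 𝔱).root → F)
    (hf : ∀ i, f ((roots 𝔱).reflectionPerm i i) = f i) :
    ∑ i, f i = 2 • ∑ α : PosRoot b, f α.1 := by
  classical
  let e : {i : (cartan 𝔱).root // b.IsPos i} ≃ {i : (cartan 𝔱).root // ¬ b.IsPos i} :=
    { toFun := fun i => ⟨(roots 𝔱).reflectionPerm i.1 i.1, fun h => root_ne_neg_of_isPos h i.2 (by
        rw [RootPairing.root_reflectionPerm, RootPairing.reflection_apply_self])⟩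
      invFun := fun i => ⟨(roots 𝔱).reflectionPerm i.1 i.1,
        (RootPairing.Base.IsPos.neg_iff_not b i.1).2 i.2⟩
      left_inv := fun i => Subtype.ext ((roots 𝔱).root.injective (by
        change (roots 𝔱).root ((roots 𝔱).reflectionPerm ((roots 𝔱).reflectionPerm i.1 i.1)
          ((roots 𝔱).reflectionPerm i.1 i.1)) = _
        rw [RootPairing.root_reflectionPerm, RootPairing.reflection_apply_self,
          RootPairing.root_reflectionPerm, RootPairing.reflection_apply_self, neg_neg]))
      right_inv := fun i => Subtype.ext ((roots 𝔱).root.injective (by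
        change (roots 𝔱).root ((roots 𝔱).reflectionPerm ((roots 𝔱).reflectionPerm i.1 i.1)
          ((roots 𝔱).reflectionPerm i.1 i.1)) = _
        rw [RootPairing.root_reflectionPerm, RootPairing.reflection_apply_self,
          RootPairing.root_reflectionPerm, RootPairing.reflection_apply_self, neg_neg])) }
  rw [← Fintype.sum_subtype_add_sum_subtype (fun i => b.IsPos i) f, two_nsmul]
  congr 1
  · exact Finset.sum_congr (by ext; simp) fun _ _ => rfl
  · rw [← e.sum_comp]
    exact Finset.sum_congr (by ext; simp) fun i _ => hf i.1

/-- The Lichnerowicz Laplacian of a full flag manifold with simply laced root system. -/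
theorem hasLichnerowiczFormula (hS : IsSimplyLaced (roots 𝔱)) {κ : ℕ} (hκ : HasValency b κ) :
    HasLichnerowiczFormula b (2 / ((κ : ℝ) + 4)) κ := by
  classical
  -- The squared length times 2(κ + 4) is 4. Constant valency thus forces all roots to have the same
  -- length, with no irreducibility assumption.
  have hpos : ∀ α : PosRoot b, rootNorm α.1 = ((2 / ((κ : ℝ) + 4) : ℝ) : ℂ) := by
    intro α
    have h₁ := rootNorm_mul_sum α.1
    rw [sum_roots_eq b _ fun i => by
      rw [RootPairing.pairingIn_reflectionPerm_self_left]; push_cast; ring] at h₁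
    have h₂ : ∑ β : PosRoot b, (((roots 𝔱).pairingIn ℤ β.1 α.1 : ℤ) : ℝ) ^ 2 = κ + 4 := by
      have h₃ : ∀ β : PosRoot b, (((roots 𝔱).pairingIn ℤ β.1 α.1 : ℤ) : ℝ) ^ 2 =
          (if RootAdj α β then (1 : ℝ) else 0) + if α = β then 4 else 0 := by
        intro β
        rw [hS, ← Int.cast_pow, pairing_sq hS α β]
        by_cases h : α = β
        · subst h
          rw [if_neg (not_rootAdj_self hS α), if_neg (not_rootAdj_self hS α), if_pos rfl, if_pos rfl]
          norm_num
        · rw [if_neg h, if_neg h]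
          split_ifs <;> norm_num
      simp_rw [h₃]
      rw [Finset.sum_add_distrib, sum_adj hκ, Finset.sum_ite_eq, if_pos (Finset.mem_univ _)]
    have h₄ : ∑ β : PosRoot b, (((roots 𝔱).pairingIn ℤ β.1 α.1 : ℤ) : ℂ) ^ 2 =
        ((κ + 4 : ℝ) : ℂ) := by
      rw [← h₂]; push_cast; rfl
    rw [h₄] at h₁
    have h₅ : ((κ + 4 : ℝ) : ℂ) ≠ 0 := by
      rw [Complex.ofReal_ne_zero]; positivity
    push_cast at h₁ h₅ ⊢
    field_simp
    rw [nsmul_eq_mul] at h₁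
    push_cast at h₁
    linear_combination h₁ / 2
  have hc : ∀ i : (cartan 𝔱).root, rootNorm i = ((2 / ((κ : ℝ) + 4) : ℝ) : ℂ) := by
    intro i
    obtain ⟨α, h | h⟩ := exists_posRoot b i
    · rw [← hpos α, rootNorm, h]; rfl
    · rw [← hpos α, rootNorm, h, map_neg, map_neg, LinearMap.neg_apply, neg_neg]; rfl
  exact ⟨hasStructConst hS hc, hκ, hasLichnerowiczMatrix hS hc hκ⟩

end Formula
end FullFlag
end

noncomputable section
namespace FullFlag
open Module

/-! ### Spectra of symmetric matrices -/

section SymmetricMatrix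

variable {ι : Type*} [Fintype ι] [DecidableEq ι] {A : Matrix ι ι ℝ}

lemma mulVec_dotProduct_of_isSymm (hA : A.IsSymm) (v w : ι → ℝ) :
    dotProduct (A.mulVec v) w = dotProduct v (A.mulVec w) := by
  rw [dotProduct_comm, Matrix.dotProduct_mulVec, ← Matrix.mulVec_transpose, hA, dotProduct_comm]

/-- Algebraic and geometric multiplicities agree: N = A - μ is symmetric, so N²v = 0 gives |Nv|² =
⟨v, N²v⟩ = 0, and generalized eigenvectors are eigenvectors. -/
lemma count_roots_charpoly (hA : A.IsSymm) (μ : ℝ) :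
    A.charpoly.roots.count μ = finrank ℝ (End.eigenspace (Matrix.toLin' A) μ) := by
  rw [Polynomial.count_roots, ← Matrix.charpoly_toLin', ← LinearMap.finrank_maxGenEigenspace_eq]
  refine congrArg (fun W : Submodule ℝ (ι → ℝ) => finrank ℝ W) (le_antisymm ?_ ?_)
  · intro v hv
    obtain ⟨k, hk⟩ := (End.mem_maxGenEigenspace _ _ _).1 hv
    set N : End ℝ (ι → ℝ) := Matrix.toLin' A - μ • 1 with hN
    have hsymm : ∀ v w : ι → ℝ, dotProduct (N v) w = dotProduct v (N w) := fun v w => by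
      simp only [hN, LinearMap.sub_apply, LinearMap.smul_apply, End.one_apply, Matrix.toLin'_apply,
        sub_dotProduct, dotProduct_sub, smul_dotProduct, dotProduct_smul,
        mulVec_dotProduct_of_isSymm hA]
    have hsq : ∀ v, N (N v) = 0 → N v = 0 := fun v h => by
      rw [← dotProduct_self_eq_zero, hsymm, h, dotProduct_zero]
    have h : ∀ k : ℕ, (N ^ (k + 1)) v = 0 → N v = 0 := by
      intro k
      induction k with
      | zero => intro h; simpa using h
      | succ k ih =>
        intro h
        rw [pow_succ', pow_succ', End.mul_apply, End.mul_apply] at h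
        refine ih ?_
        rw [pow_succ', End.mul_apply]
        exact hsq _ h
    have h' : N v = 0 := h k (by rw [pow_succ', End.mul_apply, hk, map_zero])
    rw [End.mem_eigenspace_iff]
    exact sub_eq_zero.1 h'
  · exact (Module.End.genEigenspace _ _).mono le_top

/-- A symmetric matrix with constant row sums `k`, whose eigenvectors are subject to a relation
`P(A) = cJ` with `P(k) ≠ 0`. -/
structure IsRegularWith (A : Matrix ι ι ℝ) (k : ℝ) (P : ℝ → ℝ) : Prop where
  isSymm : A.IsSymm
  mulVec_one : A.mulVec 1 = k • 1
  ne_zero : P k ≠ 0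
  relation : ∃ c : ℝ, ∀ (μ : ℝ) (v : ι → ℝ), A.mulVec v = μ • v → P μ • v = (c * ∑ i, v i) • 1

namespace IsRegularWith

variable {k : ℝ} {P : ℝ → ℝ}

/-- As P(k) ≠ 0, the relation can be solved for v, which makes it constant. -/
lemma eigenspace_eq (h : IsRegularWith A k P) :
    End.eigenspace (Matrix.toLin' A) k = Submodule.span ℝ {1} := by
  refine le_antisymm (fun v hv => ?_) ?_
  · rw [End.mem_eigenspace_iff, Matrix.toLin'_apply] at hv
    obtain ⟨c, hc⟩ := h.relation
    rw [Submodule.mem_span_singleton]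
    refine ⟨(P k)⁻¹ * (c * ∑ i, v i), ?_⟩
    rw [mul_smul, ← hc k v hv, smul_smul, inv_mul_cancel₀ h.ne_zero, one_smul]
  · rw [Submodule.span_singleton_le_iff_mem, End.mem_eigenspace_iff, Matrix.toLin'_apply]
    exact h.mulVec_one

lemma count_eq_one [Nonempty ι] (h : IsRegularWith A k P) : A.charpoly.roots.count k = 1 := by
  rw [count_roots_charpoly h.isSymm, h.eigenspace_eq, finrank_span_singleton one_ne_zero]

/-- Eigenvectors of a symmetric matrix for different eigenvalues are orthogonal, and 1 is an
eigenvector for k. -/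
lemma sum_eq_zero (h : IsRegularWith A k P) {μ : ℝ} (hμ : μ ≠ k) {v : ι → ℝ}
    (hv : A.mulVec v = μ • v) : ∑ i, v i = 0 := by
  have h₁ := mulVec_dotProduct_of_isSymm h.isSymm v 1
  rw [h.mulVec_one, hv, smul_dotProduct, dotProduct_smul, dotProduct_one, smul_eq_mul,
    smul_eq_mul] at h₁
  have h₂ : (μ - k) * ∑ i, v i = 0 := by linarith
  exact (mul_eq_zero.1 h₂).resolve_left (sub_ne_zero.2 hμ)

lemma eq_or_eq_zero (h : IsRegularWith A k P) {μ : ℝ} (hμ : μ ∈ A.charpoly.roots) :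
    μ = k ∨ P μ = 0 := by
  refine or_iff_not_imp_left.2 fun hne => ?_
  have h₁ : End.HasEigenvalue (Matrix.toLin' A) μ := by
    rw [End.hasEigenvalue_iff, ← Submodule.one_le_finrank_iff]
    rw [← count_roots_charpoly h.isSymm]
    exact Multiset.count_pos.2 hμ
  obtain ⟨v, hv⟩ := h₁.exists_hasEigenvector
  have hv' : A.mulVec v = μ • v := hv.apply_eq_smul
  obtain ⟨c, hc⟩ := h.relation
  have h₂ := hc μ v hv'
  rw [h.sum_eq_zero hne hv', mul_zero, zero_smul] at h₂
  exact (smul_eq_zero.1 h₂).resolve_right hv.2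

lemma card_roots (h : IsRegularWith A k P) :
    Multiset.card A.charpoly.roots = Fintype.card ι := by
  have hA : A.IsHermitian := by
    rw [Matrix.IsHermitian, Matrix.conjTranspose_eq_transpose_of_trivial]; exact h.isSymm
  rw [hA.roots_charpoly_eq_eigenvalues]
  simp

lemma sum_roots (h : IsRegularWith A k P) : A.charpoly.roots.sum = A.trace := by
  have hA : A.IsHermitian := by
    rw [Matrix.IsHermitian, Matrix.conjTranspose_eq_transpose_of_trivial]; exact h.isSymm
  rw [Matrix.trace_eq_sum_roots_charpoly_of_splits hA.splits_charpoly]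

lemma sum_sq_roots (h : IsRegularWith A k P) :
    (A.charpoly.roots.map (· ^ 2)).sum = (A * A).trace := by
  have hA : A.IsHermitian := by
    rw [Matrix.IsHermitian, Matrix.conjTranspose_eq_transpose_of_trivial]; exact h.isSymm
  rw [hA.roots_charpoly_eq_eigenvalues]
  conv_rhs => rw [hA.spectral_theorem, ← map_mul, Unitary.conjStarAlgAut_apply,
    Matrix.trace_mul_comm, ← mul_assoc, Unitary.coe_star_mul_self, one_mul,
    Matrix.diagonal_mul_diagonal, Matrix.trace_diagonal]
  simp [sq]

/-- Only k, r and s can occur, and k is simple. The order and the trace of A give two linear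
equations for the remaining multiplicities, regular because r ≠ s. -/
lemma roots_eq_two [Nonempty ι] {r s : ℝ} {m n : ℕ} (h : IsRegularWith A k P)
    (hP : ∀ μ, P μ = 0 → μ = r ∨ μ = s) (hr : P r = 0) (hs : P s = 0) (hrs : r ≠ s)
    (htr : A.trace = 0) (hcard : Fintype.card ι = 1 + m + n) (hsum : k + m * r + n * s = 0) :
    A.charpoly.roots = {k} + Multiset.replicate m r + Multiset.replicate n s := by
  have hkr : k ≠ r := fun e => h.ne_zero (e ▸ hr)
  have hks : k ≠ s := fun e => h.ne_zero (e ▸ hs)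
  have key : A.charpoly.roots = {k} + Multiset.replicate (A.charpoly.roots.count r) r +
      Multiset.replicate (A.charpoly.roots.count s) s := by
    ext μ
    have h₁ := h.count_eq_one
    rw [Multiset.count_add, Multiset.count_add, Multiset.count_singleton, Multiset.count_replicate,
      Multiset.count_replicate]
    by_cases hμ : μ ∈ A.charpoly.roots
    · rcases h.eq_or_eq_zero hμ with rfl | h'
      · rw [h₁, if_pos rfl, if_neg hkr.symm, if_neg hks.symm]
      · rcases hP μ h' with rfl | rfl
        · rw [if_neg hkr.symm, if_pos rfl, if_neg hrs.symm, zero_add, add_zero]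
        · rw [if_neg hks.symm, if_neg hrs, if_pos rfl, zero_add, zero_add]
    · rw [Multiset.count_eq_zero_of_notMem hμ, if_neg, zero_add]
      · split_ifs with e₁ e₂ e₂
        · exact absurd (e₁.trans e₂.symm) hrs
        · rw [e₁, Multiset.count_eq_zero_of_notMem hμ]
        · rw [e₂, Multiset.count_eq_zero_of_notMem hμ]
        · rfl
      · rintro rfl
        rw [Multiset.count_eq_zero_of_notMem hμ] at h₁
        exact zero_ne_one h₁
  have h₁ := congrArg Multiset.card key
  have h₂ := congrArg Multiset.sum key
  rw [h.card_roots] at h₁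
  rw [h.sum_roots, htr] at h₂
  simp only [Multiset.card_add, Multiset.card_singleton, Multiset.card_replicate,
    Multiset.sum_add, Multiset.sum_singleton, Multiset.sum_replicate, nsmul_eq_mul] at h₁ h₂
  set a := A.charpoly.roots.count r
  set b := A.charpoly.roots.count s
  have h₃ : (a : ℝ) + b = m + n := by exact_mod_cast (by omega : a + b = m + n)
  have h₄ : ((a : ℝ) - m) * (r - s) = 0 := by
    linear_combination hsum * (-1) - h₂ - s * h₃
  have h₅ : a = m := by
    exact_mod_cast sub_eq_zero.1 ((mul_eq_zero.1 h₄).resolve_right (sub_ne_zero.2 hrs))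
  have h₆ : b = n := by omega
  rw [key, h₅, h₆]

/-- As for two eigenvalues, with the trace of A² as third equation; the system is of Vandermonde
type. -/
lemma roots_eq_three [Nonempty ι] {r s t : ℝ} {l m n : ℕ} (h : IsRegularWith A k P)
    (hP : ∀ μ, P μ = 0 → μ = r ∨ μ = s ∨ μ = t) (hr : P r = 0) (hs : P s = 0) (ht : P t = 0)
    (hrs : r ≠ s) (hrt : r ≠ t) (hst : s ≠ t)
    (htr : A.trace = 0) (hcard : Fintype.card ι = 1 + l + m + n)
    (hsum : k + l * r + m * s + n * t = 0)
    (hsum' : (A * A).trace = k ^ 2 + l * r ^ 2 + m * s ^ 2 + n * t ^ 2) :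
    A.charpoly.roots = {k} + Multiset.replicate l r + Multiset.replicate m s +
      Multiset.replicate n t := by
  have hkr : k ≠ r := fun e => h.ne_zero (e ▸ hr)
  have hks : k ≠ s := fun e => h.ne_zero (e ▸ hs)
  have hkt : k ≠ t := fun e => h.ne_zero (e ▸ ht)
  have key : A.charpoly.roots = {k} + Multiset.replicate (A.charpoly.roots.count r) r +
      Multiset.replicate (A.charpoly.roots.count s) s +
      Multiset.replicate (A.charpoly.roots.count t) t := by
    ext μ
    have h₁ := h.count_eq_one
    simp only [Multiset.count_add, Multiset.count_singleton, Multiset.count_replicate]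
    by_cases hμ : μ ∈ A.charpoly.roots
    · rcases h.eq_or_eq_zero hμ with rfl | h'
      · rw [h₁, if_pos rfl, if_neg hkr.symm, if_neg hks.symm, if_neg hkt.symm]
      · rcases hP μ h' with rfl | rfl | rfl
        · rw [if_neg hkr.symm, if_pos rfl, if_neg hrs.symm, if_neg hrt.symm, zero_add, add_zero,
            add_zero]
        · rw [if_neg hks.symm, if_neg hrs, if_pos rfl, if_neg hst.symm, zero_add, zero_add,
            add_zero]
        · rw [if_neg hkt.symm, if_neg hrt, if_neg hst, if_pos rfl, zero_add, zero_add, zero_add]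
    · have h₀ := Multiset.count_eq_zero_of_notMem hμ
      have h₂ : ∀ x, (if x = μ then A.charpoly.roots.count x else 0) = 0 := by
        intro x
        split_ifs with e
        · rw [e, h₀]
        · rfl
      rw [h₀, if_neg, h₂, h₂, h₂]
      rintro rfl
      rw [h₀] at h₁
      exact zero_ne_one h₁
  have h₁ := congrArg Multiset.card key
  have h₂ := congrArg Multiset.sum key
  have h₃ := congrArg (fun S : Multiset ℝ => (S.map (· ^ 2)).sum) key
  rw [h.card_roots] at h₁
  rw [h.sum_roots, htr] at h₂
  rw [h.sum_sq_roots, hsum'] at h₃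
  simp only [Multiset.card_add, Multiset.card_singleton, Multiset.card_replicate,
    Multiset.sum_add, Multiset.sum_singleton, Multiset.sum_replicate, nsmul_eq_mul,
    Multiset.map_add, Multiset.map_singleton, Multiset.map_replicate] at h₁ h₂ h₃
  set a := A.charpoly.roots.count r
  set b := A.charpoly.roots.count s
  set c := A.charpoly.roots.count t
  have h₄ : (a : ℝ) + b + c = l + m + n := by
    exact_mod_cast (by omega : a + b + c = l + m + n)
  -- Combining the three equations with the coefficients of (x - s)(x - t) leaves only the
  -- multiplicity of r; the next step uses (x - r)(x - t) in the same way.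
  have h₅ : ((a : ℝ) - l) * ((r - s) * (r - t)) = 0 := by
    linear_combination -h₃ + (s + t) * (hsum + h₂) + s * t * h₄
  have h₆ : ((b : ℝ) - m) * ((s - r) * (s - t)) = 0 := by
    linear_combination -h₃ + (r + t) * (hsum + h₂) + r * t * h₄
  have h₇ : a = l := by
    exact_mod_cast sub_eq_zero.1 ((mul_eq_zero.1 h₅).resolve_right
      (mul_ne_zero (sub_ne_zero.2 hrs) (sub_ne_zero.2 hrt)))
  have h₈ : b = m := by
    exact_mod_cast sub_eq_zero.1 ((mul_eq_zero.1 h₆).resolve_right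
      (mul_ne_zero (sub_ne_zero.2 hrs.symm) (sub_ne_zero.2 hst)))
  have h₉ : c = n := by omega
  rw [key, h₇, h₈, h₉]

end IsRegularWith

end SymmetricMatrix

end FullFlag
end

noncomputable section
namespace FullFlag
open Module

section TTSpectrum

variable {𝔤 : Type*} [LieRing 𝔤] [LieAlgebra ℝ 𝔤] [FiniteDimensional ℝ 𝔤] [IsCompactSemisimple 𝔤]
  {𝔱 : LieSubalgebra ℝ 𝔤}

/-! ### The spectrum on invariant TT-tensors -/

/-- As Λ(X)X = 0, the divergence is ∑ Λ(Xᵢ)(A Xᵢ), the contraction of a skew bilinear map with a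
symmetric tensor. The divergence condition is therefore void on Sym(𝔭)^T. -/
lemma diverg_eq_zero {A : End ℝ (𝔭 𝔱)} (hA : A ∈ symInv 𝔱) : diverg 𝔱 A = 0 := by
  have h₁ := sum_onb_symm (𝔭 𝔱) (levi 𝔱) A hA.1
  have h₂ : ∀ X Y : 𝔭 𝔱, levi 𝔱 X Y = -levi 𝔱 Y X := fun X Y => by
    simp only [levi, LinearMap.smul_apply, LinearMap.comp_apply, Submodule.subtype_apply]
    rw [adP_swap, smul_neg]
  simp_rw [h₂ (A _)] at h₁
  rw [Finset.sum_neg_distrib] at h₁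
  have h₀ : ∀ v : 𝔭 𝔱, v = -v → v = 0 := fun v hv => by
    have h : (2 : ℝ) • v = 0 := by
      rw [two_smul]
      nth_rewrite 1 [hv]
      exact neg_add_cancel v
    exact (smul_eq_zero.1 h).resolve_left two_ne_zero
  have h₃ : ∀ X : 𝔭 𝔱, levi 𝔱 X X = 0 := fun X => h₀ _ (h₂ X X)
  change ∑ i, comm 𝔱 (levi 𝔱 (onb (𝔭 𝔱) i)) A (onb (𝔭 𝔱) i) = 0
  simp only [comm, LinearMap.sub_apply, End.mul_apply, h₃, map_zero, sub_zero]
  exact h₀ _ h₁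

lemma mem_ttInv_iff {A : End ℝ (𝔭 𝔱)} :
    A ∈ ttInv 𝔱 ↔ A ∈ symInv 𝔱 ∧ LinearMap.trace ℝ (𝔭 𝔱) A = 0 := by
  rw [ttInv, Submodule.mem_inf, Submodule.mem_inf, LinearMap.mem_ker, LinearMap.mem_ker]
  exact ⟨fun h => h.1, fun h => ⟨h, diverg_eq_zero h.1⟩⟩

lemma HasTTSpectrum.ttEigenvalues_eq {S : Multiset ℝ} (h : HasTTSpectrum 𝔱 S) :
    ttEigenvalues 𝔱 = {μ | μ ∈ S} := by
  ext μ
  rw [Set.mem_ofPred_eq, ← Multiset.one_le_count_iff_mem, ← h.2.2 μ, Submodule.one_le_finrank_iff,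
    Submodule.ne_bot_iff]
  exact ⟨fun ⟨A, hA, h₀, h₁⟩ => ⟨A, ⟨hA, End.mem_eigenspace_iff.2 h₁⟩, h₀⟩,
    fun ⟨A, hA, h₀⟩ => ⟨A, hA.1, h₀, End.mem_eigenspace_iff.1 hA.2⟩⟩

lemma HasTTSpectrum.isLeast {S : Multiset ℝ} (h : HasTTSpectrum 𝔱 S) {x : ℝ} (hx : x ∈ S)
    (hx' : ∀ y ∈ S, x ≤ y) : IsLeast (ttEigenvalues 𝔱) x := by
  rw [h.ttEigenvalues_eq]
  exact ⟨hx, hx'⟩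

lemma HasTTSpectrum.isGreatest {S : Multiset ℝ} (h : HasTTSpectrum 𝔱 S) {x : ℝ} (hx : x ∈ S)
    (hx' : ∀ y ∈ S, y ≤ x) : IsGreatest (ttEigenvalues 𝔱) x := by
  rw [h.ttEigenvalues_eq]
  exact ⟨hx, hx'⟩

variable [IsMaximalTorus 𝔱] {b : (roots 𝔱).Base}

/-- The invariant tensor with given coordinates in the basis `(I_α)`. -/
def ofCoords (b : (roots 𝔱).Base) : (PosRoot b → ℝ) →ₗ[ℝ] End ℝ (𝔭 𝔱) :=
  Fintype.linearCombination ℝ fun α : PosRoot b => α.blockId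

lemma ofCoords_apply (x : PosRoot b → ℝ) : ofCoords b x = ∑ α, x α • α.blockId :=
  Fintype.linearCombination_apply ..

/-- All I_α have the same trace √2, so tracelessness means orthogonality to the constant vector, the
eigenvector of the adjacency matrix for its row sum. -/
lemma trace_ofCoords (x : PosRoot b → ℝ) :
    LinearMap.trace ℝ (𝔭 𝔱) (ofCoords b x) = √2 * ∑ α, x α := by
  rw [ofCoords_apply, map_sum, Finset.mul_sum]
  refine Finset.sum_congr rfl fun α _ => ?_
  rw [PosRoot.blockId_eq, map_smul, map_smul, PosRoot.trace_blockProj, smul_eq_mul, smul_eq_mul]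
  have h : 1 / √2 * 2 = √2 := by
    rw [one_div, inv_mul_eq_div, Real.div_sqrt]
  rw [h, mul_comm]

variable {M : Matrix (PosRoot b) (PosRoot b) ℝ} (hM : HasLichnerowiczMatrix b M)

include hM

lemma HasLichnerowiczMatrix.ofCoords_injective : Function.Injective (ofCoords b) := by
  refine (injective_iff_map_eq_zero _).2 fun x hx => funext fun β => ?_
  have h := congrArg (fun A => LinearMap.trace ℝ (𝔭 𝔱) (A * β.blockId)) hx
  simpa [ofCoords_apply, Finset.sum_mul, hM.1] using h

lemma HasLichnerowiczMatrix.range_ofCoords : LinearMap.range (ofCoords b) = symInv 𝔱 := by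
  rw [ofCoords, Fintype.range_linearCombination, hM.2.1]

lemma HasLichnerowiczMatrix.lichnerowicz_ofCoords (x : PosRoot b → ℝ) :
    lichnerowicz 𝔱 (ofCoords b x) = ofCoords b (M.mulVec x) := by
  rw [ofCoords_apply, ofCoords_apply, map_sum]
  simp_rw [map_smul, hM.2.2, Finset.smul_sum, Matrix.mulVec, dotProduct, Finset.sum_smul]
  rw [Finset.sum_comm]
  refine Finset.sum_congr rfl fun β _ => Finset.sum_congr rfl fun α _ => ?_
  rw [smul_smul, mul_comm]

lemma HasLichnerowiczMatrix.ttInv_eq :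
    ttInv 𝔱 = (LinearMap.ker (dotProductBilin ℝ ℝ (1 : PosRoot b → ℝ))).map (ofCoords b) := by
  ext A
  rw [mem_ttInv_iff, ← hM.range_ofCoords, Submodule.mem_map]
  have h' : √(2 : ℝ) ≠ 0 := by positivity
  constructor
  · rintro ⟨⟨x, rfl⟩, h⟩
    rw [trace_ofCoords] at h
    refine ⟨x, ?_, rfl⟩
    rw [LinearMap.mem_ker]
    change dotProduct 1 x = 0
    rw [one_dotProduct]
    exact (mul_eq_zero.1 h).resolve_left h'
  · rintro ⟨x, hx, rfl⟩
    refine ⟨⟨x, rfl⟩, ?_⟩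
    rw [trace_ofCoords]
    rw [LinearMap.mem_ker] at hx
    change dotProduct 1 x = 0 at hx
    rw [one_dotProduct] at hx
    rw [hx, mul_zero]

lemma HasLichnerowiczMatrix.ttInv_inf_eigenspace (μ : ℝ) :
    ttInv 𝔱 ⊓ End.eigenspace (lichnerowicz 𝔱) μ =
      (LinearMap.ker (dotProductBilin ℝ ℝ (1 : PosRoot b → ℝ)) ⊓
        End.eigenspace (Matrix.toLin' M) μ).map (ofCoords b) := by
  rw [hM.ttInv_eq]
  ext A
  constructor
  · rintro ⟨⟨x, hx, rfl⟩, h⟩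
    refine ⟨x, ⟨hx, End.mem_eigenspace_iff.2 (hM.ofCoords_injective ?_)⟩, rfl⟩
    rw [Matrix.toLin'_apply, ← hM.lichnerowicz_ofCoords, map_smul]
    exact End.mem_eigenspace_iff.1 h
  · rintro ⟨x, ⟨hx, h⟩, rfl⟩
    refine ⟨⟨x, hx, rfl⟩, End.mem_eigenspace_iff.2 ?_⟩
    rw [hM.lichnerowicz_ofCoords, ← map_smul, ← Matrix.toLin'_apply, End.mem_eigenspace_iff.1 h]

omit hM in
/-- The spectrum on invariant TT-tensors in terms of that of the root-adjacency matrix. -/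
theorem HasLichnerowiczFormula.hasTTSpectrum [Nonempty (PosRoot b)] {c : ℝ} {κ : ℕ}
    (hL : HasLichnerowiczFormula b c κ) (hc : c ≠ 0) {P : ℝ → ℝ}
    (hA : IsRegularWith (rootAdjMatrix b) κ P) {S : Multiset ℝ}
    (hS : (rootAdjMatrix b).charpoly.roots = {(κ : ℝ)} + S) :
    HasTTSpectrum 𝔱 (S.map fun r => c / 2 * (κ - r)) := by
  have hM := hL.2.2
  set A := rootAdjMatrix b with hA_def
  set M : Matrix (PosRoot b) (PosRoot b) ℝ := (c / 2) • ((κ : ℝ) • 1 - A) with hM_def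
  have hc' : c / 2 ≠ 0 := by simpa using hc
  have hker : ∀ x : PosRoot b → ℝ, x ∈ LinearMap.ker (dotProductBilin ℝ ℝ (1 : PosRoot b → ℝ)) ↔
      ∑ i, x i = 0 := fun x => by
    rw [LinearMap.mem_ker, ← one_dotProduct]
    rfl
  have hmul : ∀ x, M.mulVec x = (c / 2) • ((κ : ℝ) • x - A.mulVec x) := fun x => by
    rw [hM_def, Matrix.smul_mulVec, Matrix.sub_mulVec, Matrix.smul_mulVec, Matrix.one_mulVec]
  have hdim : finrank ℝ (LinearMap.ker (dotProductBilin ℝ ℝ (1 : PosRoot b → ℝ))) =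
      Multiset.card S := by
    have h₁ := LinearMap.finrank_range_add_finrank_ker (dotProductBilin ℝ ℝ (1 : PosRoot b → ℝ))
    have h₂ : LinearMap.range (dotProductBilin ℝ ℝ (1 : PosRoot b → ℝ)) = ⊤ := by
      refine LinearMap.range_eq_top.2 fun r => ⟨Pi.single (Classical.arbitrary _) r, ?_⟩
      change dotProduct 1 _ = r
      rw [dotProduct_single, Pi.one_apply, one_mul]
    have h₃ := hA.card_roots
    rw [hS, Multiset.card_add, Multiset.card_singleton] at h₃
    rw [h₂, finrank_top, finrank_self, finrank_fintype_fun_eq_card] at h₁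
    omega
  have hinj : Function.Injective fun r : ℝ => c / 2 * (κ - r) := fun r s h => by
    have := mul_left_cancel₀ hc' h
    linarith
  refine ⟨?_, ?_, fun μ => ?_⟩
  · intro B hB
    rw [hM.ttInv_eq] at hB ⊢
    obtain ⟨x, hx, rfl⟩ := hB
    rw [hM.lichnerowicz_ofCoords]
    refine ⟨_, ?_, rfl⟩
    rw [SetLike.mem_coe, hker] at hx ⊢
    -- A symmetric matrix with the constant vector as eigenvector preserves the hyperplane
    -- orthogonal to it.
    have h₁ := mulVec_dotProduct_of_isSymm hA.isSymm 1 x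
    rw [hA.mulVec_one, smul_dotProduct, one_dotProduct, one_dotProduct, hx, smul_zero] at h₁
    rw [hmul]
    simp only [Pi.smul_apply, Pi.sub_apply, smul_eq_mul]
    rw [← Finset.mul_sum, Finset.sum_sub_distrib, ← Finset.mul_sum, hx, ← h₁]
    ring
  · rw [hM.ttInv_eq, Multiset.card_map, ← hdim]
    exact (Submodule.equivMapOfInjective _ hM.ofCoords_injective _).finrank_eq.symm
  · obtain ⟨r, rfl⟩ : ∃ r, μ = c / 2 * (κ - r) := ⟨κ - μ / (c / 2), by field_simp; ring⟩
    rw [hM.ttInv_inf_eigenspace, Multiset.count_map_eq_count' _ _ hinj]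
    have h₁ : End.eigenspace (Matrix.toLin' M) (c / 2 * (κ - r)) =
        End.eigenspace (Matrix.toLin' A) r := by
      ext x
      rw [End.mem_eigenspace_iff, End.mem_eigenspace_iff, Matrix.toLin'_apply, Matrix.toLin'_apply,
        hmul, mul_smul]
      refine (smul_right_injective _ hc').eq_iff.trans ?_
      rw [sub_smul, sub_right_inj]
    have h₂ := count_roots_charpoly hA.isSymm r
    have h₃ : finrank ℝ ((LinearMap.ker (dotProductBilin ℝ ℝ (1 : PosRoot b → ℝ)) ⊓
        End.eigenspace (Matrix.toLin' A) r : Submodule ℝ _)) = S.count r := by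
      -- The κ-eigenspace is the line of constants and meets the hyperplane only in zero; all other
      -- eigenspaces lie inside the hyperplane.
      by_cases hr : r = κ
      · subst hr
        have h₄ := hA.count_eq_one
        rw [hS, Multiset.count_add, Multiset.count_singleton, if_pos rfl] at h₄
        rw [show S.count (κ : ℝ) = 0 by omega, Submodule.finrank_eq_zero, eq_bot_iff]
        rintro x ⟨hx, hx'⟩
        rw [hA.eigenspace_eq] at hx'
        obtain ⟨t, rfl⟩ := Submodule.mem_span_singleton.1 hx'
        rw [SetLike.mem_coe, hker] at hx
        simp only [Pi.smul_apply, Pi.one_apply, smul_eq_mul, mul_one, Finset.sum_const,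
          Finset.card_univ, nsmul_eq_mul, mul_eq_zero, Nat.cast_eq_zero, Fintype.card_ne_zero,
          false_or] at hx
        rw [hx, zero_smul]
        exact zero_mem _
      · rw [hS, Multiset.count_add, Multiset.count_singleton, if_neg hr, zero_add] at h₂
        rw [h₂, inf_eq_right.2]
        intro x hx
        rw [End.mem_eigenspace_iff, Matrix.toLin'_apply] at hx
        exact (hker x).2 (hA.sum_eq_zero hr hx)
    rw [h₁, ← h₃]
    exact (Submodule.equivMapOfInjective _ hM.ofCoords_injective _).finrank_eq.symm

end TTSpectrum

end FullFlag
end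

noncomputable section
namespace FullFlag
open Module

/-! ### Models of simply laced root systems -/

section Model

/-- A symmetric bilinear form with values in `ℤ` and vectors with Gram matrix `C`. -/
structure IsModel {V : Type*} [AddCommGroup V] (B : LinearMap.BilinForm ℤ V) {l : ℕ}
    (C : Matrix (Fin l) (Fin l) ℤ) (s : Fin l → V) : Prop where
  symm : ∀ v w, B v w = B w v
  gram : ∀ i j, B (s i) (s j) = C i j

/-- The vectors obtained from the simple ones by adding simple ones with product `-1`. -/
inductive Reach {V : Type*} [AddCommGroup V] (B : LinearMap.BilinForm ℤ V) {l : ℕ}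
    (s : Fin l → V) : V → Prop
  | simple (j : Fin l) : Reach B s (s j)
  | step (v : V) (j : Fin l) : Reach B s v → B v (s j) = -1 → Reach B s (v + s j)

variable {ι R M N : Type*} [Finite ι] [Field R] [CharZero R] [AddCommGroup M] [Module R M]
  [AddCommGroup N] [Module R N] {P : RootPairing ι R M N} [P.IsCrystallographic] [P.IsReduced]
  {V : Type*} [AddCommGroup V] {B : LinearMap.BilinForm ℤ V} {l : ℕ}
  {C : Matrix (Fin l) (Fin l) ℤ} {s : Fin l → V}

/-- The vector of the model which corresponds to a root. -/
def modelVec (b : P.Base) (e : b.support ≃ Fin l) (s : Fin l → V) (i : ι) : V :=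
  b.toWeightBasisInt.constr ℤ (fun j => s (e j)) (P.rootSpanMem ℤ i)

variable {b : P.Base} {e : b.support ≃ Fin l}

omit [Finite ι] [P.IsCrystallographic] [P.IsReduced] in
lemma modelVec_simple (j : b.support) : modelVec b e s j = s (e j) := by
  rw [modelVec, ← Basis.constr_basis b.toWeightBasisInt ℤ (fun j => s (e j)) j]
  congr 1
  exact Subtype.ext (b.coe_toWeightBasisInt_apply j).symm

omit [Finite ι] [P.IsCrystallographic] [P.IsReduced] in
lemma modelVec_add {i j k : ι} (h : P.root k = P.root i + P.root j) :
    modelVec b e s k = modelVec b e s i + modelVec b e s j := by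
  rw [modelVec, modelVec, modelVec, ← map_add]
  congr 1
  exact Subtype.ext h

omit [Finite ι] [P.IsReduced] in
lemma modelVec_reflectionPerm (i k : ι) :
    modelVec b e s (P.reflectionPerm k i) =
      modelVec b e s i - P.pairingIn ℤ i k • modelVec b e s k := by
  rw [modelVec, modelVec, modelVec, ← map_smul, ← map_sub]
  congr 1
  refine Subtype.ext ?_
  change P.root (P.reflectionPerm k i) = P.root i - P.pairingIn ℤ i k • P.root k
  rw [RootPairing.root_reflectionPerm, RootPairing.reflection_apply_root' ℤ]

variable (hB : IsModel B C s) (he : ∀ i j, b.cartanMatrix i j = C (e i) (e j))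

include hB he

omit [Finite ι] [P.IsReduced] in
-- Both sides are linear on the root lattice as functions of i, and the Gram condition makes them
-- agree on simple roots.
lemma form_modelVec_simple (i : ι) (j : b.support) :
    B (modelVec b e s i) (s (e j)) = P.pairingIn ℤ i j := by
  have h : (B.flip (s (e j))) ∘ₗ b.toWeightBasisInt.constr ℤ (fun j => s (e j)) =
      P.coroot'In ℤ j := by
    refine b.toWeightBasisInt.ext fun i => ?_
    rw [LinearMap.comp_apply, Basis.constr_basis]
    change B (s (e i)) (s (e j)) = _
    rw [hB.gram, ← he]
    have h' : b.toWeightBasisInt i = P.rootSpanMem ℤ i :=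
      Subtype.ext (b.coe_toWeightBasisInt_apply i)
    rw [h', RootPairing.coroot'In_rootSpanMem_eq_pairingIn]
    rfl
  exact LinearMap.congr_fun h (P.rootSpanMem ℤ i)

/-- Every root is obtained from simple ones by simple reflections. A reflection applied to j can be
moved to i by invariance of the pairing, so the induction on j must keep i arbitrary. -/
lemma form_modelVec (i j : ι) :
    B (modelVec b e s i) (modelVec b e s j) = P.pairingIn ℤ i j := by
  revert i
  refine b.induction_reflect j (p := fun j => ∀ i,
    B (modelVec b e s i) (modelVec b e s j) = P.pairingIn ℤ i j) ?_ ?_ ?_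
  · intro j hj i
    rw [modelVec_reflectionPerm, RootPairing.pairingIn_same, map_sub, map_smul, hj,
      RootPairing.pairingIn_reflectionPerm_self_right, smul_eq_mul]
    ring
  · intro j hj i
    have h := modelVec_simple (s := s) (e := e) ⟨j, hj⟩
    rw [h]
    exact form_modelVec_simple hB he i ⟨j, hj⟩
  · intro j k hj hk i
    have h := hj (P.reflectionPerm k i)
    have h' : ∀ i, B (modelVec b e s i) (modelVec b e s k) = P.pairingIn ℤ i k := fun i => by
      have h := modelVec_simple (s := s) (e := e) ⟨k, hk⟩
      rw [h]
      exact form_modelVec_simple hB he i ⟨k, hk⟩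
    rw [P.pairingIn_reflectionPerm, ← h, modelVec_reflectionPerm,
      modelVec_reflectionPerm, map_sub, map_sub, map_smul, map_smul, LinearMap.sub_apply,
      LinearMap.smul_apply, ← h', ← h', hB.symm (modelVec b e s k) (modelVec b e s j), smul_eq_mul,
      smul_eq_mul, mul_comm]

lemma isSimplyLaced_of_isModel : IsSimplyLaced P := fun i j => by
  rw [← form_modelVec hB he, ← form_modelVec hB he, hB.symm]

/-- The pairing takes the value 2 only on equal roots, so neither independence of the vectors s nor
nondegeneracy of B is needed. -/
lemma modelVec_injective : Function.Injective (modelVec b e s) := by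
  intro i j h
  have hS := isSimplyLaced_of_isModel hB he
  have h₁ : P.pairingIn ℤ i j = 2 := by
    rw [← form_modelVec hB he, h, form_modelVec hB he, RootPairing.pairingIn_same]
  rcases hS.pairing_cases i j with h | h | h
  · exact h.1
  · omega
  · omega

/-- A positive root is built by adding simple roots one at a time through positive roots, and in a
simply laced system each such addition has pairing -1. -/
lemma reach_modelVec {i : ι} (hi : b.IsPos i) : Reach B s (modelVec b e s i) := by
  have hS := isSimplyLaced_of_isModel hB he
  refine hi.induction_on_add (p := fun i => Reach B s (modelVec b e s i)) ?_ ?_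
  · intro j hj
    have h := modelVec_simple (s := s) (e := e) ⟨j, hj⟩
    rw [h]
    exact Reach.simple _
  · intro i j k hk hi hj
    have h := modelVec_simple (s := s) (e := e) ⟨j, hj⟩
    rw [modelVec_add hk, h]
    refine Reach.step _ _ hi ?_
    rw [form_modelVec_simple hB he]
    exact hS.pairing_eq_neg_one hk

/-- Conversely, a pairing -1 with a simple root makes the sum a root, and it is again positive. -/
lemma exists_of_reach {v : V} (hv : Reach B s v) : ∃ i, b.IsPos i ∧ modelVec b e s i = v := by
  have hS := isSimplyLaced_of_isModel hB he
  induction hv with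
  | simple j =>
    refine ⟨e.symm j, RootPairing.Base.isPos_of_mem_support (e.symm j).2, ?_⟩
    rw [modelVec_simple, Equiv.apply_symm_apply]
  | step v j _ h ih =>
    obtain ⟨i, hi, rfl⟩ := ih
    obtain ⟨j, rfl⟩ := e.surjective j
    rw [form_modelVec_simple hB he, ← hS.add_mem_iff] at h
    obtain ⟨k, hk⟩ := h
    refine ⟨k, hi.add (RootPairing.Base.isPos_of_mem_support j.2) hk, ?_⟩
    rw [modelVec_add hk, modelVec_simple]

/-- The positive roots in terms of a parametrization of the reachable vectors of a model. -/
lemma exists_equiv_of_isModel {K : Type*} {σ : K → V} (hσ : Function.Injective σ)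
    (hr : ∀ v, Reach B s v ↔ v ∈ Set.range σ) :
    ∃ ψ : {i // b.IsPos i} ≃ K, ∀ i j, P.pairingIn ℤ i.1 j.1 = B (σ (ψ i)) (σ (ψ j)) := by
  have h₁ : ∀ i : {i // b.IsPos i}, ∃ k, σ k = modelVec b e s i.1 := fun i =>
    (hr _).1 (reach_modelVec hB he i.2)
  choose f hf using h₁
  have hinj : Function.Injective f := fun i j h => by
    refine Subtype.ext (modelVec_injective hB he ?_)
    rw [← hf, ← hf, h]
  have hsurj : Function.Surjective f := fun k => by
    obtain ⟨i, hi, h⟩ := exists_of_reach hB he ((hr _).2 ⟨k, rfl⟩)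
    exact ⟨⟨i, hi⟩, hσ (by rw [hf, h])⟩
  refine ⟨Equiv.ofBijective f ⟨hinj, hsurj⟩, fun i j => ?_⟩
  change _ = B (σ (f i)) (σ (f j))
  rw [hf, hf, form_modelVec hB he]

end Model

end FullFlag
end

noncomputable section
namespace FullFlag
open Module

/-! ### The root-adjacency matrix in terms of a parametrization of the positive roots -/

section Parametrized

variable {𝔤 : Type*} [LieRing 𝔤] [LieAlgebra ℝ 𝔤] [FiniteDimensional ℝ 𝔤] [IsCompactSemisimple 𝔤]
  {𝔱 : LieSubalgebra ℝ 𝔤} [IsMaximalTorus 𝔱] {b : (roots 𝔱).Base}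
  (hS : IsSimplyLaced (roots 𝔱))

include hS

open Classical in
-- The form in which the adjacency matrix is computed: products of these entries become moment sums
-- over the positive roots.
lemma rootAdjMatrix_apply (α β : PosRoot b) : rootAdjMatrix b α β =
    ((roots 𝔱).pairingIn ℤ α.1 β.1 : ℝ) ^ 2 - if α = β then 4 else 0 := by
  rw [← Int.cast_pow, pairing_sq hS α β, rootAdjMatrix, Matrix.of_apply]
  push_cast
  simp

lemma isSymm_rootAdjMatrix : (rootAdjMatrix b).IsSymm := by
  ext α β
  rw [Matrix.transpose_apply, rootAdjMatrix_apply hS, rootAdjMatrix_apply hS, hS]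
  simp only [eq_comm]

lemma trace_rootAdjMatrix : (rootAdjMatrix b).trace = 0 := by
  refine Finset.sum_eq_zero fun α _ => ?_
  rw [Matrix.diag_apply, rootAdjMatrix_apply hS, if_pos rfl, RootPairing.pairingIn_same]
  norm_num

omit hS in
lemma mulVec_one_rootAdjMatrix {κ : ℕ} (hκ : HasValency b κ) :
    (rootAdjMatrix b).mulVec 1 = (κ : ℝ) • 1 := by
  ext α
  simp only [Matrix.mulVec, dotProduct_one, Pi.smul_apply, Pi.one_apply, smul_eq_mul, mul_one]
  exact sum_adj hκ α

/-- The matrix is symmetric with entries 0 and 1, so the trace of its square counts the ones. -/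
lemma trace_rootAdjMatrix_sq {κ : ℕ} (hκ : HasValency b κ) :
    (rootAdjMatrix b * rootAdjMatrix b).trace = Fintype.card (PosRoot b) * κ := by
  have h : ∀ α β : PosRoot b, rootAdjMatrix b α β * rootAdjMatrix b β α = rootAdjMatrix b α β := by
    intro α β
    rw [← Matrix.transpose_apply (rootAdjMatrix b) α β, isSymm_rootAdjMatrix hS, rootAdjMatrix,
      Matrix.of_apply]
    split_ifs <;> norm_num
  rw [Matrix.trace]
  simp_rw [Matrix.diag_apply, Matrix.mul_apply, h]
  have h' : ∀ α, ∑ β, rootAdjMatrix b α β = κ := sum_adj hκ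
  simp_rw [h', Finset.sum_const, nsmul_eq_mul]
  rfl

variable {K : Type*} [Fintype K] {g : K → K → ℤ} {ψ : PosRoot b ≃ K}
  (hψ : ∀ α β : PosRoot b, (roots 𝔱).pairingIn ℤ α.1 β.1 = g (ψ α) (ψ β))

include hψ

lemma hasValency_of_sum {κ : ℕ} (hrow : ∀ k, ∑ l, (g k l : ℝ) ^ 2 = κ + 4) : HasValency b κ := by
  classical
  intro α
  have h := hrow (ψ α)
  rw [← ψ.sum_comp] at h
  simp_rw [← hψ] at h
  have h' : ∑ β, rootAdjMatrix b α β = κ := by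
    simp_rw [rootAdjMatrix_apply hS]
    rw [Finset.sum_sub_distrib, h, Finset.sum_ite_eq, if_pos (Finset.mem_univ _)]
    ring
  simp only [rootAdjMatrix, Matrix.of_apply] at h'
  rw [Finset.sum_boole] at h'
  rw [Nat.card_eq_fintype_card, Fintype.card_subtype]
  exact_mod_cast h'

/-- An eigenvalue r of the adjacency matrix is an eigenvalue r + 4 of the matrix of squared
pairings, for which the relations are proved on the model. -/
lemma isRegularWith_rootAdjMatrix {κ : ℕ} (hκ : HasValency b κ) {P : ℝ → ℝ} (hP : P κ ≠ 0) {c : ℝ}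
    (hrel : ∀ (r : ℝ) (v : K → ℝ), (∀ k, ∑ l, (g k l : ℝ) ^ 2 * v l = (r + 4) * v k) →
      ∀ k, P r * v k = c * ∑ l, v l) : IsRegularWith (rootAdjMatrix b) κ P where
  isSymm := isSymm_rootAdjMatrix hS
  mulVec_one := mulVec_one_rootAdjMatrix hκ
  ne_zero := hP
  relation := by
    refine ⟨c, fun r v hv => funext fun α => ?_⟩
    have h := hrel r (v ∘ ψ.symm) (fun k => by
      obtain ⟨α, rfl⟩ := ψ.surjective k
      have h := congrFun hv α
      simp only [Matrix.mulVec, dotProduct, rootAdjMatrix_apply hS, sub_mul, ite_mul, zero_mul,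
        Finset.sum_sub_distrib, Finset.sum_ite_eq, Finset.mem_univ, if_true, Pi.smul_apply,
        smul_eq_mul] at h
      rw [← ψ.sum_comp]
      simp only [Function.comp_apply, Equiv.symm_apply_apply, ← hψ]
      linarith) (ψ α)
    rw [← ψ.sum_comp] at h
    simp only [Function.comp_apply, Equiv.symm_apply_apply] at h
    simpa using h

/-- The spectra in the case of two eigenvalues on the traceless invariant tensors. -/
theorem spectrum_of_two [Nonempty K] {κ : ℕ} (hκ : HasValency b κ) {r s : ℝ} {m n : ℕ} {c : ℝ}
    (hrs : r ≠ s) (hr : (κ : ℝ) ≠ r) (hs : (κ : ℝ) ≠ s)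
    (hrel : ∀ (t : ℝ) (v : K → ℝ), (∀ k, ∑ l, (g k l : ℝ) ^ 2 * v l = (t + 4) * v k) →
      ∀ k, (t - r) * (t - s) * v k = c * ∑ l, v l)
    (hcard : Fintype.card K = 1 + m + n) (hsum : κ + m * r + n * s = 0) :
    (rootAdjMatrix b).charpoly.roots = {(κ : ℝ)} + Multiset.replicate m r +
      Multiset.replicate n s ∧
    HasTTSpectrum 𝔱 (Multiset.replicate m ((κ - r) / (κ + 4)) +
      Multiset.replicate n ((κ - s) / (κ + 4))) := by
  have : Nonempty (PosRoot b) := ψ.nonempty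
  have hA := isRegularWith_rootAdjMatrix hS hψ hκ (P := fun t => (t - r) * (t - s))
    (mul_ne_zero (sub_ne_zero.2 hr) (sub_ne_zero.2 hs)) hrel
  have h := hA.roots_eq_two (r := r) (s := s) (m := m) (n := n)
    (fun μ h => (mul_eq_zero.1 h).imp sub_eq_zero.1 sub_eq_zero.1) (by simp) (by simp) hrs
    (trace_rootAdjMatrix hS) (by rw [Fintype.card_congr ψ, hcard]) hsum
  refine ⟨h, ?_⟩
  rw [add_assoc] at h
  have h' := (hasLichnerowiczFormula hS hκ).hasTTSpectrum (by positivity) hA h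
  have h₂ : ∀ x : ℝ, 2 / ((κ : ℝ) + 4) / 2 * (κ - x) = (κ - x) / (κ + 4) := fun x => by
    field_simp
  simpa only [Multiset.map_add, Multiset.map_replicate, h₂] using h'

/-- The spectra in the case of three eigenvalues on the traceless invariant tensors. -/
theorem spectrum_of_three [Nonempty K] {κ : ℕ} (hκ : HasValency b κ) {r s t : ℝ} {l m n : ℕ} {c : ℝ}
    (hrs : r ≠ s) (hrt : r ≠ t) (hst : s ≠ t)
    (hr : (κ : ℝ) ≠ r) (hs : (κ : ℝ) ≠ s) (ht : (κ : ℝ) ≠ t)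
    (hrel : ∀ (x : ℝ) (v : K → ℝ), (∀ k, ∑ l, (g k l : ℝ) ^ 2 * v l = (x + 4) * v k) →
      ∀ k, (x - r) * (x - s) * (x - t) * v k = c * ∑ l, v l)
    (hcard : Fintype.card K = 1 + l + m + n) (hsum : κ + l * r + m * s + n * t = 0)
    (hsum' : (Fintype.card K : ℝ) * κ = κ ^ 2 + l * r ^ 2 + m * s ^ 2 + n * t ^ 2) :
    (rootAdjMatrix b).charpoly.roots = {(κ : ℝ)} + Multiset.replicate l r +
      Multiset.replicate m s + Multiset.replicate n t ∧
    HasTTSpectrum 𝔱 (Multiset.replicate l ((κ - r) / (κ + 4)) +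
      Multiset.replicate m ((κ - s) / (κ + 4)) + Multiset.replicate n ((κ - t) / (κ + 4))) := by
  have : Nonempty (PosRoot b) := ψ.nonempty
  have hA := isRegularWith_rootAdjMatrix hS hψ hκ (P := fun x => (x - r) * (x - s) * (x - t))
    (mul_ne_zero (mul_ne_zero (sub_ne_zero.2 hr) (sub_ne_zero.2 hs)) (sub_ne_zero.2 ht)) hrel
  have h := hA.roots_eq_three (r := r) (s := s) (t := t) (l := l) (m := m) (n := n)
    (fun μ h => by
      rcases mul_eq_zero.1 h with h | h
      · exact (mul_eq_zero.1 h).imp sub_eq_zero.1 fun h => Or.inl (sub_eq_zero.1 h)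
      · exact Or.inr (Or.inr (sub_eq_zero.1 h)))
    (by simp) (by simp) (by simp) hrs hrt hst
    (trace_rootAdjMatrix hS) (by rw [Fintype.card_congr ψ, hcard]) hsum
    (by rw [trace_rootAdjMatrix_sq hS hκ, Fintype.card_congr ψ, hsum'])
  refine ⟨h, ?_⟩
  rw [add_assoc, add_assoc, ← add_assoc (Multiset.replicate l r)] at h
  have h' := (hasLichnerowiczFormula hS hκ).hasTTSpectrum (by positivity) hA h
  have h₂ : ∀ x : ℝ, 2 / ((κ : ℝ) + 4) / 2 * (κ - x) = (κ - x) / (κ + 4) := fun x => by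
    field_simp
  simpa only [Multiset.map_add, Multiset.map_replicate, h₂] using h'

end Parametrized

end FullFlag
end

noncomputable section
namespace FullFlag
open Module

/-! ### The root systems of type `A` -/

/-! ### Moment sums over pairs p < q -/

section Pairs

/-- The pairs `p < q`. -/
abbrev Pairs (n : ℕ) : Type := {p : Fin n × Fin n // p.1 < p.2}

variable {n : ℕ}

lemma two_mul_sum_pairs (f : Fin n → Fin n → ℝ) (hf : ∀ i j, f i j = f j i) :
    2 * ∑ p : Pairs n, f p.1.1 p.1.2 = ∑ i, ∑ j, f i j - ∑ i, f i i := by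
  have h₁ : ∑ p : Pairs n, f p.1.1 p.1.2 = ∑ i, ∑ j, if i < j then f i j else 0 := by
    rw [← Finset.sum_product', Finset.univ_product_univ, ← Finset.sum_filter]
    exact (Finset.sum_subtype _ (fun x => by simp) (fun p : Fin n × Fin n => f p.1 p.2)).symm
  have h₂ : ∑ i, ∑ j, (if i < j then f i j else 0) = ∑ i, ∑ j, if j < i then f i j else 0 := by
    rw [Finset.sum_comm]
    refine Finset.sum_congr rfl fun i _ => Finset.sum_congr rfl fun j _ => ?_
    rw [hf]
  have h₃ : ∑ i, f i i = ∑ i, ∑ j, if i = j then f i j else 0 := by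
    refine Finset.sum_congr rfl fun i _ => ?_
    rw [Finset.sum_ite_eq, if_pos (Finset.mem_univ _)]
  rw [two_mul]
  nth_rewrite 2 [h₁]
  rw [h₁, h₂, h₃, eq_sub_iff_add_eq, ← h₂]
  nth_rewrite 2 [h₂]
  simp_rw [← Finset.sum_add_distrib]
  refine Finset.sum_congr rfl fun i _ => Finset.sum_congr rfl fun j _ => ?_
  rcases lt_trichotomy i j with h | h | h
  · simp [h, h.not_gt, h.ne]
  · simp [h]
  · simp [h, h.not_gt, h.ne']

lemma card_pairs : 2 * (Fintype.card (Pairs n) : ℝ) = n * (n - 1) := by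
  have h := two_mul_sum_pairs (n := n) (fun _ _ => 1) (fun _ _ => rfl)
  simp only [Finset.sum_const, Finset.card_univ, Fintype.card_fin, nsmul_eq_mul, mul_one] at h
  rw [h]
  ring

variable (x y : Fin n → ℝ)

lemma sum_sq_sub : ∑ p : Pairs n, (x p.1.1 - x p.1.2) ^ 2 = n * ∑ i, x i ^ 2 - (∑ i, x i) ^ 2 := by
  have h := two_mul_sum_pairs (fun i j => (x i - x j) ^ 2) (fun i j => by ring)
  have h' : ∀ i j, (x i - x j) ^ 2 = x i ^ 2 + x j ^ 2 - 2 * (x i * x j) := fun i j => by ring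
  simp only [sub_self] at h
  simp_rw [h', Finset.sum_sub_distrib, Finset.sum_add_distrib, ← Finset.mul_sum, ← Finset.sum_mul,
    Finset.sum_const, Finset.card_univ, Fintype.card_fin, nsmul_eq_mul, ← Finset.mul_sum] at h
  simp_rw [h']
  rw [Finset.sum_sub_distrib, Finset.sum_add_distrib, ← Finset.mul_sum]
  linear_combination h / 2

/-- Expand the sum over all ordered pairs: every monomial linear in one index carries a factor ∑ x
or ∑ y and vanishes, except the square of ∑ xy. -/
lemma sum_sq_mul_sq_sub (hx : ∑ i, x i = 0) (hy : ∑ i, y i = 0) :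
    ∑ p : Pairs n, (x p.1.1 - x p.1.2) ^ 2 * (y p.1.1 - y p.1.2) ^ 2 =
      n * ∑ i, x i ^ 2 * y i ^ 2 + (∑ i, x i ^ 2) * ∑ i, y i ^ 2 + 2 * (∑ i, x i * y i) ^ 2 := by
  have h := two_mul_sum_pairs (fun i j => (x i - x j) ^ 2 * (y i - y j) ^ 2) (fun i j => by ring)
  have h' : ∀ i j, (x i - x j) ^ 2 * (y i - y j) ^ 2 = x i ^ 2 * y i ^ 2 + x i ^ 2 * y j ^ 2 +
      y i ^ 2 * x j ^ 2 + x j ^ 2 * y j ^ 2 + 4 * ((x i * y i) * (x j * y j)) -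
      2 * ((x i ^ 2 * y i) * y j) - 2 * ((x i * y i ^ 2) * x j) - 2 * (x i * (x j * y j ^ 2)) -
      2 * (y i * (x j ^ 2 * y j)) := fun i j => by ring
  have h₀ : ∑ i, ∑ j, (x i - x j) ^ 2 * (y i - y j) ^ 2 = 2 * (n * ∑ i, x i ^ 2 * y i ^ 2) +
      2 * ((∑ i, x i ^ 2) * ∑ i, y i ^ 2) + 4 * (∑ i, x i * y i) ^ 2 := by
    simp_rw [h', Finset.sum_sub_distrib, Finset.sum_add_distrib, ← Finset.mul_sum,
      ← Finset.sum_mul, hx, hy, Finset.sum_const, Finset.card_univ,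
      Fintype.card_fin, nsmul_eq_mul]
    have h'' : ∑ i, x i ^ 2 * (n * y i ^ 2) = n * ∑ i, x i ^ 2 * y i ^ 2 := by
      rw [Finset.mul_sum]
      exact Finset.sum_congr rfl fun i _ => by ring
    rw [h'']
    ring
  rw [h₀] at h
  simp only [sub_self] at h
  simp only [ne_eq, OfNat.ofNat_ne_zero, not_false_eq_true, zero_pow, mul_zero,
    Finset.sum_const_zero, sub_zero] at h
  linear_combination h / 2

lemma sum_sq_sub_add_sq_add :
    ∑ p : Pairs n, ((x p.1.1 - x p.1.2) ^ 2 + (x p.1.1 + x p.1.2) ^ 2) =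
      2 * (n - 1) * ∑ i, x i ^ 2 := by
  have h := two_mul_sum_pairs (fun i j => (x i - x j) ^ 2 + (x i + x j) ^ 2) (fun i j => by ring)
  have h' : ∀ i j, (x i - x j) ^ 2 + (x i + x j) ^ 2 = 2 * x i ^ 2 + 2 * x j ^ 2 :=
    fun i j => by ring
  simp_rw [h'] at h ⊢
  simp_rw [Finset.sum_add_distrib, ← Finset.mul_sum,
    Finset.sum_const, Finset.card_univ, Fintype.card_fin, nsmul_eq_mul, ← Finset.mul_sum] at h
  rw [Finset.sum_add_distrib, ← Finset.mul_sum, ← Finset.mul_sum]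
  linear_combination h / 2

/-- Adding the two signs cancels the monomials which forced zero sums in the case of differences.
The diagonal i = j now contributes 16 ∑ x²y², which accounts for the -8. -/
lemma sum_sq_mul_sq_sub_add :
    ∑ p : Pairs n, ((x p.1.1 - x p.1.2) ^ 2 * (y p.1.1 - y p.1.2) ^ 2 +
        (x p.1.1 + x p.1.2) ^ 2 * (y p.1.1 + y p.1.2) ^ 2) =
      (2 * n - 8) * ∑ i, x i ^ 2 * y i ^ 2 + 2 * ((∑ i, x i ^ 2) * ∑ i, y i ^ 2) +
        4 * (∑ i, x i * y i) ^ 2 := by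
  have h := two_mul_sum_pairs (fun i j => (x i - x j) ^ 2 * (y i - y j) ^ 2 +
    (x i + x j) ^ 2 * (y i + y j) ^ 2) (fun i j => by ring)
  have h' : ∀ i j, (x i - x j) ^ 2 * (y i - y j) ^ 2 + (x i + x j) ^ 2 * (y i + y j) ^ 2 =
      2 * (x i ^ 2 * y i ^ 2) + 2 * (x i ^ 2 * y j ^ 2) + 2 * (y i ^ 2 * x j ^ 2) +
        2 * (x j ^ 2 * y j ^ 2) + 8 * ((x i * y i) * (x j * y j)) := fun i j => by ring
  have h₀ : ∑ i, ∑ j, ((x i - x j) ^ 2 * (y i - y j) ^ 2 + (x i + x j) ^ 2 * (y i + y j) ^ 2) =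
      4 * (n * ∑ i, x i ^ 2 * y i ^ 2) + 4 * ((∑ i, x i ^ 2) * ∑ i, y i ^ 2) +
        8 * (∑ i, x i * y i) ^ 2 := by
    simp_rw [h', Finset.sum_add_distrib, ← Finset.mul_sum,
      ← Finset.sum_mul, Finset.sum_const, Finset.card_univ,
      Fintype.card_fin, nsmul_eq_mul]
    have h'' : ∑ i, x i ^ 2 * (n * y i ^ 2) = n * ∑ i, x i ^ 2 * y i ^ 2 := by
      rw [Finset.mul_sum]
      exact Finset.sum_congr rfl fun i _ => by ring
    rw [h'']
    ring
  have h₁ : ∑ i, ((x i - x i) ^ 2 * (y i - y i) ^ 2 + (x i + x i) ^ 2 * (y i + y i) ^ 2) =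
      16 * ∑ i, x i ^ 2 * y i ^ 2 := by
    rw [Finset.mul_sum]
    exact Finset.sum_congr rfl fun i _ => by ring
  rw [h₀, h₁] at h
  linear_combination h / 2

end Pairs

/-! ### The vectors e_p - e_q -/

section TypeA

variable {n : ℕ}

/-- The vector `e_p - e_q`. -/
def vecA (p : Pairs n) : Fin n → ℤ := Pi.single p.1.1 1 - Pi.single p.1.2 1

/-- The simple roots of type `A`. -/
def simpleA (n : ℕ) (i : Fin n) : Fin (n + 1) → ℤ := Pi.single i.castSucc 1 - Pi.single i.succ 1

lemma dotProduct_vecA (x : Fin n → ℤ) (p : Pairs n) : dotProduct x (vecA p) = x p.1.1 - x p.1.2 := by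
  rw [vecA, dotProduct_sub, dotProduct_single, dotProduct_single, mul_one, mul_one]

lemma vecA_apply (p : Pairs n) (i : Fin n) :
    vecA p i = (if i = p.1.1 then 1 else 0) - (if i = p.1.2 then 1 else 0) := by
  rw [vecA, Pi.sub_apply, Pi.single_apply, Pi.single_apply]

lemma dotProduct_simpleA (x : Fin (n + 1) → ℤ) (i : Fin n) :
    dotProduct x (simpleA n i) = x i.castSucc - x i.succ := by
  rw [simpleA, dotProduct_sub, dotProduct_single, dotProduct_single, mul_one, mul_one]

lemma isModel_A (n : ℕ) : IsModel (dotProductBilin ℤ ℤ) (CartanMatrix.A n) (simpleA n) where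
  symm := fun v w => dotProduct_comm v w
  gram := fun i j => by
    change dotProduct (simpleA n i) (simpleA n j) = _
    rw [dotProduct_simpleA]
    simp only [simpleA, Pi.sub_apply, Pi.single_apply, CartanMatrix.A, Matrix.of_apply, Fin.ext_iff,
      Fin.val_castSucc, Fin.val_succ]
    split_ifs <;> omega

lemma vecA_injective : Function.Injective (vecA (n := n)) := by
  intro p q h
  have h₁ := congrFun h p.1.1
  have h₂ := congrFun h p.1.2
  have hp := p.2.ne
  have hq := q.2.ne
  simp only [vecA_apply, if_true, if_neg hp, if_neg hp.symm] at h₁ h₂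
  refine Subtype.ext (Prod.ext ?_ ?_)
  · by_contra h
    rw [if_neg h] at h₁
    split_ifs at h₁ <;> omega
  · by_contra h
    rw [if_neg h] at h₂
    split_ifs at h₂ <;> omega

/-- The product of e_p - e_q with e_j - e_{j+1} is -1 only if p = j + 1 or q = j, and adding then
extends the interval by one step. Conversely, every interval grows from p + 1 upwards in q. -/
lemma reach_A_iff (v : Fin (n + 1) → ℤ) :
    Reach (dotProductBilin ℤ ℤ) (simpleA n) v ↔ v ∈ Set.range vecA := by
  constructor
  · intro h
    induction h with
    | simple j => exact ⟨⟨(j.castSucc, j.succ), Fin.castSucc_lt_succ⟩, rfl⟩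
    | step v j _ h ih =>
      obtain ⟨⟨⟨p, q⟩, hpq⟩, rfl⟩ := ih
      change dotProduct (vecA _) (simpleA n j) = -1 at h
      rw [dotProduct_simpleA, vecA_apply, vecA_apply] at h
      simp only at hpq h
      have h' : p = j.succ ∨ q = j.castSucc := by
        by_contra! h'
        rw [if_neg h'.1.symm, if_neg h'.2.symm] at h
        split_ifs at h <;> omega
      rcases h' with rfl | rfl
      · refine ⟨⟨(j.castSucc, q), lt_trans Fin.castSucc_lt_succ hpq⟩, ?_⟩
        simp only [vecA, simpleA]
        abel
      · refine ⟨⟨(p, j.succ), lt_trans hpq Fin.castSucc_lt_succ⟩, ?_⟩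
        simp only [vecA, simpleA]
        abel
  · rintro ⟨⟨⟨p, q⟩, hpq⟩, rfl⟩
    simp only at hpq
    induction q using Fin.induction with
    | zero => exact absurd hpq (Fin.not_lt_zero p)
    | succ j ih =>
      rcases (Fin.le_castSucc_iff.2 hpq).eq_or_lt with rfl | h
      · exact Reach.simple j
      · have h₁ := Reach.step _ j (ih h) (by
          change dotProduct (vecA _) (simpleA n j) = -1
          rw [dotProduct_simpleA, vecA_apply, vecA_apply]
          simp only [Fin.ext_iff, Fin.lt_def, Fin.val_castSucc, Fin.val_succ] at h hpq ⊢
          split_ifs <;> omega)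
        convert h₁ using 1
        simp only [vecA, simpleA]
        abel

/-- Gram matrix of the vectors `e_p - e_q`. -/
def gramA (p q : Pairs n) : ℤ := dotProduct (vecA p) (vecA q)

lemma cast_gramA (p q : Pairs n) : (gramA p q : ℝ) = (vecA p q.1.1 : ℝ) - vecA p q.1.2 := by
  rw [gramA, dotProduct_vecA, Int.cast_sub]

lemma sum_vecA (p : Pairs n) : ∑ i, (vecA p i : ℝ) = 0 := by
  have h := dotProduct_comm (1 : Fin n → ℤ) (vecA p)
  rw [dotProduct_vecA, dotProduct_one, Pi.one_apply, Pi.one_apply, sub_self] at h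
  exact_mod_cast h.symm

lemma sum_vecA_mul (p q : Pairs n) : ∑ i, (vecA p i : ℝ) * vecA q i = gramA p q := by
  rw [gramA, dotProduct]
  push_cast
  rfl

lemma gramA_self (p : Pairs n) : gramA p p = 2 := by
  rw [gramA, dotProduct_vecA, vecA_apply, vecA_apply, if_pos rfl, if_pos rfl, if_neg p.2.ne,
    if_neg p.2.ne']
  norm_num

lemma sum_vecA_sq (p : Pairs n) : ∑ i, (vecA p i : ℝ) ^ 2 = 2 := by
  have h := sum_vecA_mul p p
  rw [gramA_self] at h
  simp_rw [sq]
  exact_mod_cast h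

lemma sum_gramA_sq (p : Pairs n) : ∑ q, (gramA p q : ℝ) ^ 2 = 2 * n := by
  simp_rw [cast_gramA]
  rw [sum_sq_sub (fun i => (vecA p i : ℝ)), sum_vecA_sq, sum_vecA]
  ring

/-- Let x be the first vector and a < b the support of the second. The product is x_a - x_b, and x_a
x_b is -1 if the pairs coincide and 0 otherwise, so x_a² + x_b² differs from (x_a - x_b)² only on
the diagonal. -/
lemma sum_vecA_sq_mul_sq (p q : Pairs n) :
    ∑ i, (vecA p i : ℝ) ^ 2 * (vecA q i : ℝ) ^ 2 = (gramA p q : ℝ) ^ 2 - if p = q then 2 else 0 := by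
  have h₁ : ∑ i, vecA p i ^ 2 * vecA q i ^ 2 = vecA p q.1.1 ^ 2 + vecA p q.1.2 ^ 2 := by
    have h : ∀ i, vecA p i ^ 2 * vecA q i ^ 2 = (if i = q.1.1 then vecA p i ^ 2 else 0) +
        if i = q.1.2 then vecA p i ^ 2 else 0 := by
      intro i
      rw [vecA_apply q]
      have := q.2.ne
      split_ifs with h h'
      · exact absurd (h.symm.trans h') this
      all_goals ring
    simp_rw [h]
    rw [Finset.sum_add_distrib, Finset.sum_ite_eq', Finset.sum_ite_eq', if_pos (Finset.mem_univ _),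
      if_pos (Finset.mem_univ _)]
  have h₂ : vecA p q.1.1 * vecA p q.1.2 = if p = q then -1 else 0 := by
    obtain ⟨⟨p, p'⟩, hp⟩ := p
    obtain ⟨⟨q, q'⟩, hq⟩ := q
    simp only [vecA_apply, Subtype.mk.injEq, Prod.mk.injEq, Fin.ext_iff, Fin.lt_def] at hp hq ⊢
    split_ifs <;> omega
  have h₃ : (((vecA p q.1.1 * vecA p q.1.2 : ℤ)) : ℝ) = if p = q then -1 else 0 := by
    rw [h₂]; push_cast; rfl
  have h₄ : ((∑ i, vecA p i ^ 2 * vecA q i ^ 2 : ℤ) : ℝ) =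
      (vecA p q.1.1 : ℝ) ^ 2 + (vecA p q.1.2 : ℝ) ^ 2 := by
    rw [h₁]; push_cast; rfl
  push_cast at h₃ h₄
  rw [h₄, cast_gramA]
  split_ifs at h₃ ⊢ <;> linear_combination 2 * h₃

lemma gramA_comm (p q : Pairs n) : gramA p q = gramA q p := dotProduct_comm _ _

/-- In matrix form W² = (n + 2)W + 4J - 2nI for the matrix W of squared products and the all-ones
matrix J. -/
lemma sum_gramA_sq_mul_sq (p q : Pairs n) :
    ∑ l, (gramA p l : ℝ) ^ 2 * (gramA l q : ℝ) ^ 2 =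
      (n + 2) * (gramA p q : ℝ) ^ 2 + 4 - if p = q then 2 * (n : ℝ) else 0 := by
  have h := sum_sq_mul_sq_sub (fun i => (vecA p i : ℝ)) (fun i => (vecA q i : ℝ))
    (sum_vecA p) (sum_vecA q)
  have h' : ∀ l, (gramA p l : ℝ) ^ 2 * (gramA l q : ℝ) ^ 2 =
      ((vecA p l.1.1 : ℝ) - vecA p l.1.2) ^ 2 * ((vecA q l.1.1 : ℝ) - vecA q l.1.2) ^ 2 := fun l => by
    rw [gramA_comm l q, cast_gramA, cast_gramA]
  simp only [sum_vecA_sq, sum_vecA_mul, sum_vecA_sq_mul_sq] at h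
  simp_rw [h']
  rw [h]
  split_ifs <;> ring

end TypeA

section Relation

variable {K : Type*} [Fintype K] {W : K → K → ℝ} {r : ℝ} {v : K → ℝ}

lemma sum_mul_apply_eq_sq (hv : ∀ k, ∑ l, W k l * v l = r * v k) (k : K) :
    ∑ m, (∑ l, W k l * W l m) * v m = r ^ 2 * v k := by
  calc ∑ m, (∑ l, W k l * W l m) * v m = ∑ l, W k l * ∑ m, W l m * v m := by
        simp_rw [Finset.sum_mul, Finset.mul_sum]
        rw [Finset.sum_comm]
        exact Finset.sum_congr rfl fun _ _ => Finset.sum_congr rfl fun _ _ => by ring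
    _ = r ^ 2 * v k := by
        simp_rw [hv, mul_left_comm _ r, ← Finset.mul_sum, hv]
        ring

end Relation

section TypeA

variable {n : ℕ}

/-- On an eigenvector the formula for W² yields the polynomial (t + 4)² - (n + 2)(t + 4) + 2n, which
factors as displayed. Here n counts coordinates. -/
lemma relation_A (t : ℝ) (v : Pairs n → ℝ)
    (hv : ∀ k, ∑ l, (gramA k l : ℝ) ^ 2 * v l = (t + 4) * v k) (k : Pairs n) :
    (t - (n - 4)) * (t - (-2)) * v k = 4 * ∑ l, v l := by
  have h := sum_mul_apply_eq_sq hv k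
  simp_rw [sum_gramA_sq_mul_sq, sub_mul, add_mul, ite_mul, zero_mul] at h
  rw [Finset.sum_sub_distrib, Finset.sum_add_distrib, Finset.sum_ite_eq,
    if_pos (Finset.mem_univ _), ← Finset.mul_sum] at h
  simp_rw [Finset.sum_add_distrib, mul_assoc, ← Finset.mul_sum, hv] at h
  linear_combination -h

variable {𝔤 : Type*} [LieRing 𝔤] [LieAlgebra ℝ 𝔤] [FiniteDimensional ℝ 𝔤] [IsCompactSemisimple 𝔤]
  {𝔱 : LieSubalgebra ℝ 𝔤} [IsMaximalTorus 𝔱] {b : (roots 𝔱).Base}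

lemma parametrization_A (hb : HasCartanMatrix b (CartanMatrix.A n)) :
    IsSimplyLaced (roots 𝔱) ∧ ∃ ψ : PosRoot b ≃ Pairs (n + 1),
      ∀ α β : PosRoot b, (roots 𝔱).pairingIn ℤ α.1 β.1 = gramA (ψ α) (ψ β) := by
  obtain ⟨e, he⟩ := hb
  exact ⟨isSimplyLaced_of_isModel (isModel_A n) he,
    exists_equiv_of_isModel (isModel_A n) he vecA_injective reach_A_iff⟩

lemma hasValency_A (hn : 1 ≤ n) (hb : HasCartanMatrix b (CartanMatrix.A n)) :
    HasValency b (2 * (n - 1)) := by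
  obtain ⟨hS, ψ, hψ⟩ := parametrization_A hb
  refine hasValency_of_sum hS hψ fun k => ?_
  rw [sum_gramA_sq]
  push_cast [Nat.cast_sub hn]
  ring

theorem hasLichnerowiczFormula_A (hn : 1 ≤ n) (hb : HasCartanMatrix b (CartanMatrix.A n)) :
    HasLichnerowiczFormula b (1 / ((n : ℝ) + 1)) (2 * (n - 1)) := by
  have h := hasLichnerowiczFormula (parametrization_A hb).1 (hasValency_A hn hb)
  convert h using 1
  push_cast [Nat.cast_sub hn]
  rw [div_eq_div_iff (by positivity) (by ring_nf; positivity)]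
  ring

/-- Here n is the rank, so the roots have n + 1 coordinates and the group is SU(n+1). For n = 2 the
eigenvalue -2 gets multiplicity zero. -/
theorem spectrum_A (hn : 2 ≤ n) (hb : HasCartanMatrix b (CartanMatrix.A n)) :
    (rootAdjMatrix b).charpoly.roots = {2 * ((n : ℝ) - 1)} + Multiset.replicate n ((n : ℝ) - 3) +
      Multiset.replicate ((n + 1) * (n - 2) / 2) (-2) ∧
    HasTTSpectrum 𝔱 (Multiset.replicate n (1 / 2) +
      Multiset.replicate ((n + 1) * (n - 2) / 2) ((n : ℝ) / (n + 1))) := by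
  obtain ⟨hS, ψ, hψ⟩ := parametrization_A hb
  have hn' : (2 : ℝ) ≤ n := by exact_mod_cast hn
  have : Nonempty (Pairs (n + 1)) := ⟨⟨(0, Fin.last n), Fin.lt_def.2 (by simp; omega)⟩⟩
  have hκ : ((2 * (n - 1) : ℕ) : ℝ) = 2 * ((n : ℝ) - 1) := by
    push_cast [Nat.cast_sub (show 1 ≤ n by omega)]; ring
  have hm : (((n + 1) * (n - 2) / 2 : ℕ) : ℝ) = (n + 1) * ((n : ℝ) - 2) / 2 := by
    rw [Nat.cast_div _ two_ne_zero]
    · push_cast [Nat.cast_sub hn]; ring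
    -- One of n + 1 and n - 2 is even, so the division of natural numbers is exact.
    · obtain ⟨k, rfl⟩ := Nat.exists_eq_add_of_le hn
      rw [Nat.add_sub_cancel_left]
      rcases Nat.even_or_odd k with h | h
      · exact (h.mul_left _).two_dvd
      · have : Even (2 + k + 1) := by
          rw [show 2 + k + 1 = (k + 1) + 2 by ring]
          exact (Odd.add_one h).add even_two
        exact (this.mul_right _).two_dvd
  have h := spectrum_of_two hS hψ (hasValency_A (by omega) hb) (r := (n : ℝ) - 3) (s := -2)
    (m := n) (n := (n + 1) * (n - 2) / 2) (c := 4) (by linarith) (by rw [hκ]; linarith)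
    (by rw [hκ]; linarith) (fun t v hv k => by
      rw [← relation_A t v hv k]; push_cast; ring) (by
      have h := card_pairs (n := n + 1)
      have h' : (Fintype.card (Pairs (n + 1)) : ℝ) = 1 + n + ((n + 1) * (n - 2) / 2 : ℕ) := by
        rw [hm]; push_cast at h; linarith
      exact_mod_cast h') (by rw [hκ, hm]; ring)
  rw [hκ] at h
  have h₁ : (2 * ((n : ℝ) - 1) - (n - 3)) / (2 * (n - 1) + 4) = 1 / 2 := by
    rw [div_eq_div_iff (by linarith) two_ne_zero]; ring
  have h₂ : (2 * ((n : ℝ) - 1) - -2) / (2 * (n - 1) + 4) = n / (n + 1) := by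
    rw [div_eq_div_iff (by linarith) (by linarith)]; ring
  rw [h₁, h₂] at h
  exact h

end TypeA

end FullFlag
end

noncomputable section
namespace FullFlag
open Module

/-! ### The root systems of type `D` -/

section TypeD

variable {n : ℕ}

/-- The vector `e_p + s e_q`. -/
def vecN (n p q : ℕ) (s : ℤ) : Fin n → ℤ :=
  fun k => (if k.val = p then 1 else 0) + if k.val = q then s else 0

lemma dotProduct_vecN (x : Fin n → ℤ) {p q : ℕ} (hp : p < n) (hq : q < n) (s : ℤ) :
    dotProduct x (vecN n p q s) = x ⟨p, hp⟩ + s * x ⟨q, hq⟩ := by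
  have h : vecN n p q s = Pi.single ⟨p, hp⟩ 1 + Pi.single ⟨q, hq⟩ s := by
    ext k
    simp [vecN, Pi.single_apply, Fin.ext_iff]
  rw [h, dotProduct_add, dotProduct_single, dotProduct_single, mul_one, mul_comm]

/-- The sign `±1` encoded by a boolean. -/
def sgn (s : Bool) : ℤ := if s then 1 else -1

/-- The vectors `e_p ± e_q`. -/
def vecD (x : Pairs n × Bool) : Fin n → ℤ := vecN n x.1.1.1 x.1.1.2 (sgn x.2)

lemma vecD_mk {p q : ℕ} (hp : p < n) (hq : q < n) (hpq : p < q) (s : Bool) :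
    vecD (⟨(⟨p, hp⟩, ⟨q, hq⟩), hpq⟩, s) = vecN n p q (sgn s) := rfl

lemma mem_range_vecD {p q : ℕ} (hq : q < n) (hpq : p < q) (s : Bool) :
    vecN n p q (sgn s) ∈ Set.range (vecD (n := n)) :=
  ⟨_, vecD_mk (hpq.trans hq) hq hpq s⟩

lemma exists_of_mem_range_vecD {v : Fin n → ℤ} (hv : v ∈ Set.range (vecD (n := n))) :
    ∃ p q : ℕ, p < q ∧ q < n ∧ ∃ s, v = vecN n p q (sgn s) := by
  obtain ⟨⟨⟨⟨p, q⟩, h⟩, s⟩, rfl⟩ := hv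
  exact ⟨p, q, h, q.2, s, rfl⟩

/-- The simple roots of type `D`. -/
def simpleD (n : ℕ) (i : Fin n) : Fin n → ℤ :=
  if i.val + 1 < n then vecN n i (i + 1) (-1) else vecN n (i - 1) i 1

lemma simpleD_of_lt {i : Fin n} (h : i.val + 1 < n) : simpleD n i = vecN n i (i + 1) (-1) := if_pos h

lemma simpleD_of_not_lt {i : Fin n} (h : ¬ i.val + 1 < n) : simpleD n i = vecN n (i - 1) i 1 :=
  if_neg h

/-- Without the last node, the diagram is a chain. -/
lemma gram_D_of_lt {i j : ℕ} (hi : i + 1 < n) (hj : j + 1 < n) :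
    (if i = j then (2 : ℤ) else if i + 1 = j ∧ j + 2 < n then -1 else
      if j + 1 = i ∧ i + 2 < n then -1 else
        if i + 3 = n ∧ (j + 2 = n ∨ j + 1 = n) then -1 else
          if j + 3 = n ∧ (i + 2 = n ∨ i + 1 = n) then -1 else 0) =
      if i = j then 2 else if i + 1 = j ∨ j + 1 = i then -1 else 0 := by
  by_cases h : i = j
  · rw [if_pos h, if_pos h]
  rw [if_neg h, if_neg h]
  split_ifs <;> omega

/-- The last node is attached to the node two steps before it. -/
lemma gram_D_of_not_lt {i j : ℕ} (hi : i + 1 < n) (hj : j + 1 = n) :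
    (if i = j then (2 : ℤ) else if i + 1 = j ∧ j + 2 < n then -1 else
      if j + 1 = i ∧ i + 2 < n then -1 else
        if i + 3 = n ∧ (j + 2 = n ∨ j + 1 = n) then -1 else
          if j + 3 = n ∧ (i + 2 = n ∨ i + 1 = n) then -1 else 0) =
      if i + 2 = j then -1 else 0 := by
  rw [if_neg (by omega), if_neg (by omega), if_neg (by omega)]
  split_ifs <;> omega

lemma vecN_apply_of_lt {i j : ℕ} (hj : j < n) (hj' : j + 1 < n) :
    vecN n i (i + 1) (-1) ⟨j, hj⟩ + -1 * vecN n i (i + 1) (-1) ⟨j + 1, hj'⟩ =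
      if i = j then 2 else if i + 1 = j ∨ j + 1 = i then -1 else 0 := by
  simp only [vecN]
  by_cases h : i = j
  · subst h; simp
  · rw [if_neg h, if_neg (Ne.symm h), if_neg (show ¬ j + 1 = i + 1 by omega)]
    split_ifs <;> omega

lemma vecN_apply_of_not_lt (hn : 3 ≤ n) {i j : ℕ} (hi : i + 1 < n) (hj : j < n)
    (hj' : j - 1 < n) (h : j + 1 = n) :
    vecN n i (i + 1) (-1) ⟨j - 1, hj'⟩ + 1 * vecN n i (i + 1) (-1) ⟨j, hj⟩ =
      if i + 2 = j then -1 else 0 := by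
  simp only [vecN]
  rw [if_neg (show ¬ j = i by omega)]
  split_ifs <;> omega

lemma isModel_D (hn : 3 ≤ n) :
    IsModel (dotProductBilin ℤ ℤ) (CartanMatrix.D n) (simpleD n) where
  symm := fun v w => dotProduct_comm v w
  gram := by
    -- Only the first index has to avoid the last node: symmetry then covers all entries but the
    -- last diagonal one.
    have key : ∀ i j : Fin n, i.val + 1 < n →
        dotProduct (simpleD n i) (simpleD n j) = CartanMatrix.D n i j := by
      rintro ⟨i, hi⟩ ⟨j, hj⟩ h'
      simp only [CartanMatrix.D, Matrix.of_apply, Fin.ext_iff]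
      rw [if_neg (show ¬ n ≤ 2 by omega)]
      by_cases h : j + 1 < n
      · rw [simpleD_of_lt (i := ⟨j, hj⟩) h, simpleD_of_lt (i := ⟨i, hi⟩) h', dotProduct_vecN _ hj h,
          gram_D_of_lt h' h, vecN_apply_of_lt]
      · rw [simpleD_of_not_lt (i := ⟨j, hj⟩) h, simpleD_of_lt (i := ⟨i, hi⟩) h',
          dotProduct_vecN _ (show j - 1 < n by omega) hj, gram_D_of_not_lt h' (by omega),
          vecN_apply_of_not_lt hn h' _ _ (by omega)]
    intro i j
    change dotProduct (simpleD n i) (simpleD n j) = _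
    by_cases h : i.val + 1 < n
    · exact key i j h
    by_cases h' : j.val + 1 < n
    · rw [dotProduct_comm, key j i h', ← Matrix.transpose_apply (CartanMatrix.D n),
        CartanMatrix.D_transpose]
    · obtain rfl : i = j := Fin.ext (by omega)
      rw [CartanMatrix.D_diag, simpleD_of_not_lt h,
        dotProduct_vecN _ (show i.val - 1 < n by omega) i.2]
      simp only [vecN]
      rw [if_neg (show ¬ i.val - 1 = i.val by omega), if_neg (show ¬ i.val = i.val - 1 by omega)]
      norm_num

lemma sgn_injective : Function.Injective sgn := by decide

lemma sgn_cases (s : Bool) : sgn s = 1 ∨ sgn s = -1 := by cases s <;> simp [sgn]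

lemma vecN_apply_left {p q : ℕ} (hp : p < n) (hpq : p < q) (s : ℤ) : vecN n p q s ⟨p, hp⟩ = 1 := by
  simp [vecN, hpq.ne]

lemma vecN_apply_right {p q : ℕ} (hq : q < n) (hpq : p < q) (s : ℤ) :
    vecN n p q s ⟨q, hq⟩ = s := by
  simp [vecN, hpq.ne']

/-- If p ≠ p', the entry 1 at p must sit at q' in the other vector and the entry 1 at p' at q, which
contradicts p < q and p' < q'. With p = p', the entry at q determines q' and the sign. -/
lemma vecD_injective : Function.Injective (vecD (n := n)) := by
  rintro ⟨⟨⟨⟨p, hp⟩, ⟨q, hq⟩⟩, hpq⟩, s⟩ ⟨⟨⟨⟨p', hp'⟩, ⟨q', hq'⟩⟩, hpq'⟩, s'⟩ h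
  simp only [Fin.lt_def] at hpq hpq'
  change vecN n p q (sgn s) = vecN n p' q' (sgn s') at h
  have h₁ := congrFun h ⟨p, hp⟩
  have h₂ := congrFun h ⟨q, hq⟩
  have h₃ := congrFun h ⟨p', hp'⟩
  rw [vecN_apply_left _ hpq] at h₁
  rw [vecN_apply_right _ hpq] at h₂
  rw [vecN_apply_left _ hpq'] at h₃
  simp only [vecN] at h₁ h₂ h₃
  have hpp : p = p' := by
    by_contra hne
    rw [if_neg hne] at h₁
    rw [if_neg (Ne.symm hne)] at h₃
    split_ifs at h₁ h₃ <;> omega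
  subst hpp
  rw [if_neg hpq.ne'] at h₂
  have hs := sgn_cases s
  have hqq : q = q' := by
    by_contra hne
    rw [if_neg hne] at h₂
    omega
  subst hqq
  rw [if_pos rfl, zero_add] at h₂
  rw [sgn_injective h₂]

lemma reach_D_sub (d p q : ℕ) (h : q = p + 1 + d) (hq : q < n) :
    Reach (dotProductBilin ℤ ℤ) (simpleD n) (vecN n p q (-1)) := by
  induction d generalizing q with
  | zero =>
    have h₁ := Reach.simple (B := dotProductBilin ℤ ℤ) (s := simpleD n) ⟨p, by omega⟩
    rw [simpleD_of_lt (i := ⟨p, by omega⟩) (show p + 1 < n by omega)] at h₁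
    rw [h]
    exact h₁
  | succ d ih =>
    have h₁ := Reach.step _ ⟨p + 1 + d, by omega⟩ (ih (p + 1 + d) rfl (by omega)) (by
      change dotProduct (vecN _ _ _ _) (simpleD n _) = -1
      rw [simpleD_of_lt (by change p + 1 + d + 1 < n; omega),
        dotProduct_vecN _ (show p + 1 + d < n by omega) (show p + 1 + d + 1 < n by omega)]
      simp only [vecN]
      split_ifs <;> omega)
    rw [simpleD_of_lt (by change p + 1 + d + 1 < n; omega)] at h₁
    convert h₁ using 1
    ext k
    simp only [vecN, Pi.add_apply]
    split_ifs <;> omega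

/-- Start from the last simple root, the sum of the last two unit vectors, and lower p by adding e_p
- e_{p+1}. -/
lemma reach_D_last (d p : ℕ) (h : p + 2 + d = n) :
    Reach (dotProductBilin ℤ ℤ) (simpleD n) (vecN n p (n - 1) 1) := by
  induction d generalizing p with
  | zero =>
    have h₁ := Reach.simple (B := dotProductBilin ℤ ℤ) (s := simpleD n) ⟨n - 1, by omega⟩
    rw [simpleD_of_not_lt (i := ⟨n - 1, by omega⟩) (show ¬ n - 1 + 1 < n by omega)] at h₁
    rw [show p = n - 1 - 1 by omega]
    exact h₁
  | succ d ih =>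
    have h₁ := Reach.step _ ⟨p, by omega⟩ (ih (p + 1) (by omega)) (by
      change dotProduct (vecN _ _ _ _) (simpleD n _) = -1
      rw [simpleD_of_lt (by change p + 1 < n; omega),
        dotProduct_vecN _ (show p < n by omega) (show p + 1 < n by omega)]
      simp only [vecN]
      split_ifs <;> omega)
    rw [simpleD_of_lt (by change p + 1 < n; omega)] at h₁
    convert h₁ using 1
    ext k
    simp only [vecN, Pi.add_apply]
    split_ifs <;> omega

/-- Lower q from n - 1 by adding e_q - e_{q+1}. -/
lemma reach_D_add (d p q : ℕ) (hpq : p < q) (h : q + 1 + d = n) :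
    Reach (dotProductBilin ℤ ℤ) (simpleD n) (vecN n p q 1) := by
  induction d generalizing q with
  | zero =>
    have h₁ := reach_D_last (n := n) (n - p - 2) p (by omega)
    rwa [show q = n - 1 by omega]
  | succ d ih =>
    have h₁ := Reach.step _ ⟨q, by omega⟩ (ih (q + 1) (by omega) (by omega)) (by
      change dotProduct (vecN _ _ _ _) (simpleD n _) = -1
      rw [simpleD_of_lt (by change q + 1 < n; omega),
        dotProduct_vecN _ (show q < n by omega) (show q + 1 < n by omega)]
      simp only [vecN]
      split_ifs <;> omega)
    rw [simpleD_of_lt (by change q + 1 < n; omega)] at h₁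
    convert h₁ using 1
    ext k
    simp only [vecN, Pi.add_apply]
    split_ifs <;> omega

lemma reach_D_iff (hn : 3 ≤ n) (v : Fin n → ℤ) :
    Reach (dotProductBilin ℤ ℤ) (simpleD n) v ↔ v ∈ Set.range vecD := by
  constructor
  · intro h
    induction h with
    | simple j =>
      by_cases h : j.val + 1 < n
      · rw [simpleD_of_lt h]
        exact mem_range_vecD h (Nat.lt_succ_self _) false
      · rw [simpleD_of_not_lt h]
        exact mem_range_vecD j.2 (by omega) true
    | step v j _ h ih =>
      obtain ⟨p, q, hpq, hq, s, rfl⟩ := exists_of_mem_range_vecD ih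
      obtain ⟨j, hj⟩ := j
      change dotProduct (vecN _ _ _ _) (simpleD n _) = -1 at h
      have hs := sgn_cases s
      by_cases hj' : j + 1 < n
      · rw [simpleD_of_lt (i := ⟨j, hj⟩) hj', dotProduct_vecN _ hj hj'] at h
        rw [simpleD_of_lt (i := ⟨j, hj⟩) hj']
        simp only [vecN] at h
        -- The simple root e_j - e_{j+1} lowers p from j + 1 to j, or turns e_p - e_j into e_p -
        -- e_{j+1}, or e_p + e_{j+1} into e_p + e_j. The condition p < j excludes e_j + e_{j+1},
        -- which is orthogonal to it.
        have h' : p = j + 1 ∨ (q = j ∧ sgn s = -1) ∨ (q = j + 1 ∧ sgn s = 1 ∧ p < j) := by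
          by_contra! h'
          split_ifs at h <;> omega
        rcases h' with h' | ⟨h', hs⟩ | ⟨h', hs, hp⟩
        · convert mem_range_vecD hq (show j < q by omega) s using 1
          ext k
          simp only [vecN, Pi.add_apply]
          split_ifs <;> omega
        · convert mem_range_vecD hj' (show p < j + 1 by omega) false using 1
          ext k
          simp only [vecN, Pi.add_apply, hs, show sgn false = -1 from rfl]
          split_ifs <;> omega
        · convert mem_range_vecD hj hp true using 1
          ext k
          simp only [vecN, Pi.add_apply, hs, show sgn true = 1 from rfl]
          split_ifs <;> omega
      · rw [simpleD_of_not_lt (i := ⟨j, hj⟩) hj',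
          dotProduct_vecN _ (show j - 1 < n by omega) hj] at h
        rw [simpleD_of_not_lt (i := ⟨j, hj⟩) hj']
        simp only [vecN] at h
        -- Here j = n - 1. Adding e_{j-1} + e_j turns e_p - e_j into e_p + e_{j-1} and e_p - e_{j-1}
        -- into e_p + e_j.
        have h' : sgn s = -1 ∧ (q = j ∧ p < j - 1 ∨ q = j - 1) := by
          by_contra! h'
          split_ifs at h <;> omega
        obtain ⟨hs, ⟨h', hp⟩ | h'⟩ := h'
        · convert mem_range_vecD (show j - 1 < n by omega) hp true using 1
          ext k
          simp only [vecN, Pi.add_apply, hs, show sgn true = 1 from rfl]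
          split_ifs <;> omega
        · convert mem_range_vecD hj (show p < j by omega) true using 1
          ext k
          simp only [vecN, Pi.add_apply, hs, show sgn true = 1 from rfl]
          split_ifs <;> omega
  · intro h
    obtain ⟨p, q, hpq, hq, s, rfl⟩ := exists_of_mem_range_vecD h
    cases s
    · exact reach_D_sub (q - p - 1) p q (by omega) hq
    · exact reach_D_add (n - q - 1) p q hpq (by omega)

/-- Gram matrix of the vectors `e_p ± e_q`. -/
def gramD (x y : Pairs n × Bool) : ℤ := dotProduct (vecD x) (vecD y)

lemma gramD_comm (x y : Pairs n × Bool) : gramD x y = gramD y x := dotProduct_comm _ _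

lemma gramD_eq (x : Pairs n × Bool) (y : Pairs n) (s : Bool) :
    gramD x (y, s) = vecD x y.1.1 + sgn s * vecD x y.1.2 :=
  dotProduct_vecN (vecD x) y.1.1.2 y.1.2.2 (sgn s)

lemma cast_gramD_true (x : Pairs n × Bool) (y : Pairs n) :
    (gramD x (y, true) : ℝ) = vecD x y.1.1 + vecD x y.1.2 := by
  rw [gramD_eq]; simp [sgn]

lemma cast_gramD_false (x : Pairs n × Bool) (y : Pairs n) :
    (gramD x (y, false) : ℝ) = vecD x y.1.1 - vecD x y.1.2 := by
  rw [gramD_eq]; simp [sgn, sub_eq_add_neg]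

lemma gramD_self (x : Pairs n × Bool) : gramD x x = 2 := by
  obtain ⟨⟨⟨p, q⟩, h⟩, s⟩ := x
  rw [gramD_eq]
  change vecN n p q (sgn s) p + sgn s * vecN n p q (sgn s) q = 2
  have h₁ := vecN_apply_left p.2 (Fin.lt_def.1 h) (sgn s)
  have h₂ := vecN_apply_right q.2 (Fin.lt_def.1 h) (sgn s)
  rw [Fin.eta] at h₁ h₂
  rw [h₁, h₂]
  cases s <;> rfl

lemma sum_vecD_mul (x y : Pairs n × Bool) : ∑ i, (vecD x i : ℝ) * vecD y i = gramD x y := by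
  rw [gramD, dotProduct]
  push_cast
  rfl

lemma sum_vecD_sq (x : Pairs n × Bool) : ∑ i, (vecD x i : ℝ) ^ 2 = 2 := by
  have h := sum_vecD_mul x x
  rw [gramD_self] at h
  simp_rw [sq]
  exact_mod_cast h

lemma sum_gramD_sq (x : Pairs n × Bool) : ∑ y, (gramD x y : ℝ) ^ 2 = 4 * (n - 1) := by
  have h := sum_sq_sub_add_sq_add (fun i => (vecD x i : ℝ))
  rw [Fintype.sum_prod_type]
  simp_rw [Fintype.sum_bool, cast_gramD_true, cast_gramD_false]
  simp_rw [add_comm] at h ⊢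
  rw [h, sum_vecD_sq]
  ring

/-- The Gram matrix of the vectors of squared coordinates of the `e_p ± e_q`. -/
def sqGramD (x y : Pairs n × Bool) : ℝ := ∑ i, (vecD x i : ℝ) ^ 2 * (vecD y i : ℝ) ^ 2

/-- In matrix form W² = (2n - 8)S + 4W + 8J, where S is the Gram matrix of squared coordinates and
is carried along as a second unknown matrix. -/
lemma sum_gramD_sq_mul_sq (x y : Pairs n × Bool) :
    ∑ z, (gramD x z : ℝ) ^ 2 * (gramD z y : ℝ) ^ 2 =
      (2 * n - 8) * sqGramD x y + 8 + 4 * (gramD x y : ℝ) ^ 2 := by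
  have h := sum_sq_mul_sq_sub_add (fun i => (vecD x i : ℝ)) (fun i => (vecD y i : ℝ))
  rw [Fintype.sum_prod_type]
  simp_rw [gramD_comm _ y, Fintype.sum_bool, cast_gramD_true, cast_gramD_false]
  have h' : ∀ a b c d : ℝ, a * b + c * d = c * d + a * b := fun a b c d => add_comm _ _
  simp only [sum_vecD_sq, sum_vecD_mul] at h
  rw [sqGramD, gramD_comm y x, show (8 : ℝ) = 2 * (2 * 2) by norm_num]
  rw [show (2 * 2 : ℝ) = 2 * 2 by norm_num] at h
  refine (Finset.sum_congr rfl fun p _ => add_comm _ _).trans (h.trans ?_)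
  ring

/-- Insert a unit vector for y in `sum_sq_mul_sq_sub_add`. Up to constants, each squared coordinate
is an eigenvector of W. -/
lemma sum_gramD_sq_mul_vecD_sq (x : Pairs n × Bool) (i : Fin n) :
    ∑ z, (gramD x z : ℝ) ^ 2 * (vecD z i : ℝ) ^ 2 = (2 * n - 4) * (vecD x i : ℝ) ^ 2 + 4 := by
  have h := sum_sq_mul_sq_sub_add (fun j => (vecD x j : ℝ)) (Pi.single i 1)
  have h₁ : ∀ f : Fin n → ℝ, ∑ j, f j * (Pi.single i 1 : Fin n → ℝ) j ^ 2 = f i := fun f => by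
    rw [Finset.sum_eq_single i (fun j _ hj => by rw [Pi.single_eq_of_ne hj]; ring) (by simp),
      Pi.single_eq_same]
    ring
  have h₂ : ∑ j, (Pi.single i 1 : Fin n → ℝ) j ^ 2 = 1 := by
    have := h₁ fun _ => 1
    simpa using this
  have h₃ : ∑ j, (vecD x j : ℝ) * (Pi.single i 1 : Fin n → ℝ) j = vecD x i := by
    rw [Finset.sum_eq_single i (fun j _ hj => by rw [Pi.single_eq_of_ne hj]; ring) (by simp),
      Pi.single_eq_same, mul_one]
  rw [h₁ fun j => (vecD x j : ℝ) ^ 2, h₂, h₃, sum_vecD_sq] at h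
  have h₄ : ∀ (p : Pairs n) (s : Bool), (vecD (p, s) i : ℝ) =
      (Pi.single i 1 : Fin n → ℝ) p.1.1 + sgn s * (Pi.single i 1 : Fin n → ℝ) p.1.2 := by
    intro p s
    simp only [vecD, vecN, Pi.single_apply, ← Fin.ext_iff, eq_comm]
    push_cast
    split_ifs <;> simp
  rw [Fintype.sum_prod_type]
  simp_rw [Fintype.sum_bool, cast_gramD_true, cast_gramD_false, h₄]
  refine (Finset.sum_congr rfl fun p _ => ?_).trans (h.trans ?_)
  · simp only [sgn]
    push_cast
    ring
  · rw [show (vecD x i : ℝ) = _ from h₄ x.1 x.2]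
    ring

lemma sum_gramD_sq_mul_sqGramD (x y : Pairs n × Bool) :
    ∑ z, (gramD x z : ℝ) ^ 2 * sqGramD z y = (2 * n - 4) * sqGramD x y + 8 := by
  simp_rw [sqGramD, Finset.mul_sum]
  rw [Finset.sum_comm]
  simp_rw [← mul_assoc, ← Finset.sum_mul, sum_gramD_sq_mul_vecD_sq, add_mul,
    Finset.sum_add_distrib, ← Finset.mul_sum, sum_vecD_sq]
  simp_rw [mul_assoc, ← Finset.mul_sum]
  norm_num

lemma relation_D_aux {t : ℝ} {v : Pairs n × Bool → ℝ}
    (hv : ∀ k, ∑ l, (gramD k l : ℝ) ^ 2 * v l = (t + 4) * v k) (k : Pairs n × Bool) :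
    (2 * n - 8) * ∑ l, sqGramD k l * v l + 8 * ∑ l, v l + 4 * ((t + 4) * v k) =
      (t + 4) ^ 2 * v k := by
  have h := sum_mul_apply_eq_sq hv k
  simp_rw [sum_gramD_sq_mul_sq, add_mul, Finset.sum_add_distrib, mul_assoc, ← Finset.mul_sum,
    hv] at h
  exact h

/-- On an eigenvector the formula for W² reads (2n - 8)Sv = t(t + 4)v - 8(∑ v)1. Applying W and
using WS = (2n - 4)S + 8J eliminates S and adds the factor (t + 4) - (2n - 4). -/
lemma relation_D (t : ℝ) (v : Pairs n × Bool → ℝ)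
    (hv : ∀ k, ∑ l, (gramD k l : ℝ) ^ 2 * v l = (t + 4) * v k) (k : Pairs n × Bool) :
    (t - 2 * (n - 4)) * (t - (-4)) * (t - 0) * v k = 32 * (n - 2) * ∑ l, v l := by
  have h₁ := relation_D_aux hv
  have h₂ : ∑ l, (gramD k l : ℝ) ^ 2 * ∑ m, sqGramD l m * v m =
      (2 * n - 4) * ∑ m, sqGramD k m * v m + 8 * ∑ m, v m := by
    simp_rw [Finset.mul_sum]
    rw [Finset.sum_comm]
    simp_rw [← mul_assoc, ← Finset.sum_mul, sum_gramD_sq_mul_sqGramD, add_mul,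
      Finset.sum_add_distrib]
  have h₃ : ∑ l, (gramD k l : ℝ) ^ 2 * ((2 * n - 8) * ∑ m, sqGramD l m * v m + 8 * ∑ m, v m +
      4 * ((t + 4) * v l)) = (t + 4) ^ 2 * ((t + 4) * v k) := by
    simp_rw [h₁, mul_left_comm _ ((t + 4) ^ 2), ← Finset.mul_sum, hv]
  simp_rw [mul_add, Finset.sum_add_distrib, ← mul_assoc _ (8 : ℝ), mul_left_comm _ (2 * (n : ℝ) - 8),
    mul_left_comm _ (4 : ℝ), mul_left_comm _ (t + 4), ← Finset.mul_sum, hv, h₂, ← Finset.sum_mul,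
    sum_gramD_sq] at h₃
  have h₄ := h₁ k
  linear_combination (2 * n - 4) * h₄ - h₃

variable {𝔤 : Type*} [LieRing 𝔤] [LieAlgebra ℝ 𝔤] [FiniteDimensional ℝ 𝔤] [IsCompactSemisimple 𝔤]
  {𝔱 : LieSubalgebra ℝ 𝔤} [IsMaximalTorus 𝔱] {b : (roots 𝔱).Base}

lemma parametrization_D (hn : 3 ≤ n) (hb : HasCartanMatrix b (CartanMatrix.D n)) :
    IsSimplyLaced (roots 𝔱) ∧ ∃ ψ : PosRoot b ≃ Pairs n × Bool,
      ∀ α β : PosRoot b, (roots 𝔱).pairingIn ℤ α.1 β.1 = gramD (ψ α) (ψ β) := by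
  obtain ⟨e, he⟩ := hb
  exact ⟨isSimplyLaced_of_isModel (isModel_D hn) he,
    exists_equiv_of_isModel (isModel_D hn) he vecD_injective (reach_D_iff hn)⟩

lemma cast_valency_D (hn : 3 ≤ n) : ((4 * (n - 2) : ℕ) : ℝ) = 4 * ((n : ℝ) - 2) := by
  push_cast [Nat.cast_sub (show 2 ≤ n by omega)]; ring

lemma hasValency_D (hn : 3 ≤ n) (hb : HasCartanMatrix b (CartanMatrix.D n)) :
    HasValency b (4 * (n - 2)) := by
  obtain ⟨hS, ψ, hψ⟩ := parametrization_D hn hb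
  refine hasValency_of_sum hS hψ fun k => ?_
  rw [sum_gramD_sq, cast_valency_D hn]
  ring

theorem hasLichnerowiczFormula_D (hn : 3 ≤ n) (hb : HasCartanMatrix b (CartanMatrix.D n)) :
    HasLichnerowiczFormula b (1 / (2 * ((n : ℝ) - 1))) (4 * (n - 2)) := by
  have h := hasLichnerowiczFormula (parametrization_D hn hb).1 (hasValency_D hn hb)
  have hn' : (3 : ℝ) ≤ n := by exact_mod_cast hn
  convert h using 1
  rw [cast_valency_D hn, div_eq_div_iff (by linarith) (by linarith)]
  ring

lemma card_D : (Fintype.card (Pairs n × Bool) : ℝ) = n * (n - 1) := by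
  rw [Fintype.card_prod, Fintype.card_bool]
  push_cast
  rw [← card_pairs, mul_comm]

/-- For n = 4 the coefficient of S vanishes and the relation is already quadratic. The cubic would
not do, because its zeros 2(n - 4) and 0 coincide. -/
lemma relation_D_four (t : ℝ) (v : Pairs 4 × Bool → ℝ)
    (hv : ∀ k, ∑ l, (gramD k l : ℝ) ^ 2 * v l = (t + 4) * v k) (k : Pairs 4 × Bool) :
    (t - 0) * (t - (-4)) * v k = 8 * ∑ l, v l := by
  have h := relation_D_aux hv k
  push_cast at h
  linear_combination -h

lemma spectrum_D_four (hb : HasCartanMatrix b (CartanMatrix.D 4)) :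
    (rootAdjMatrix b).charpoly.roots = {8} + Multiset.replicate 9 0 + Multiset.replicate 2 (-4) ∧
    HasTTSpectrum 𝔱 (Multiset.replicate 9 (2 / 3) + Multiset.replicate 2 1) := by
  obtain ⟨hS, ψ, hψ⟩ := parametrization_D (by norm_num) hb
  have : Nonempty (Pairs 4 × Bool) := ⟨⟨(0, 1), by decide⟩, true⟩
  have hN : Fintype.card (Pairs 4 × Bool) = 12 := by
    have h := card_D (n := 4)
    norm_num at h
    exact_mod_cast h
  have h := spectrum_of_two hS hψ (hasValency_D (by norm_num) hb) (r := 0) (s := -4)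
    (m := 9) (n := 2) (by norm_num) (by norm_num) (by norm_num) relation_D_four
    (by rw [hN]) (by norm_num)
  have h₁ : ((4 * (4 - 2) : ℕ) : ℝ) = 8 := by norm_num
  rw [h₁, show ((8 : ℝ) - 0) / (8 + 4) = 2 / 3 by norm_num,
    show ((8 : ℝ) - -4) / (8 + 4) = 1 by norm_num] at h
  exact h

lemma spectrum_D_of_ne (hn : 3 ≤ n) (hn' : n ≠ 4) (hb : HasCartanMatrix b (CartanMatrix.D n)) :
    (rootAdjMatrix b).charpoly.roots = {4 * ((n : ℝ) - 2)} +
      Multiset.replicate (n - 1) (2 * ((n : ℝ) - 4)) + Multiset.replicate (n * (n - 3) / 2) (-4) +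
      Multiset.replicate (n * (n - 1) / 2) 0 ∧
    HasTTSpectrum 𝔱 (Multiset.replicate (n - 1) ((n : ℝ) / (2 * ((n : ℝ) - 1))) +
      Multiset.replicate (n * (n - 3) / 2) 1 +
      Multiset.replicate (n * (n - 1) / 2) (((n : ℝ) - 2) / ((n : ℝ) - 1))) := by
  obtain ⟨hS, ψ, hψ⟩ := parametrization_D hn hb
  have hn₁ : (3 : ℝ) ≤ n := by exact_mod_cast hn
  have hn₂ : (n : ℝ) ≠ 4 := by exact_mod_cast hn'
  have : Nonempty (Pairs n × Bool) :=
    ⟨⟨(⟨0, by omega⟩, ⟨1, by omega⟩), Fin.lt_def.2 Nat.zero_lt_one⟩, true⟩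
  have hκ := cast_valency_D hn
  have hl : ((n - 1 : ℕ) : ℝ) = (n : ℝ) - 1 := by push_cast [Nat.cast_sub (show 1 ≤ n by omega)]; ring
  have hm₁ : 2 ∣ n * (n - 3) := by
    obtain ⟨k, rfl⟩ := Nat.exists_eq_add_of_le hn
    rw [Nat.add_sub_cancel_left, ← even_iff_two_dvd, Nat.even_mul, Nat.even_add]
    have : ¬ Even 3 := by decide
    tauto
  have hm₂ : 2 ∣ n * (n - 1) := even_iff_two_dvd.1 (Nat.even_mul_pred_self n)
  have hm : ((n * (n - 3) / 2 : ℕ) : ℝ) = n * ((n : ℝ) - 3) / 2 := by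
    rw [Nat.cast_div hm₁ two_ne_zero]
    push_cast [Nat.cast_sub hn]; ring
  have hm' : ((n * (n - 1) / 2 : ℕ) : ℝ) = n * ((n : ℝ) - 1) / 2 := by
    rw [Nat.cast_div hm₂ two_ne_zero]
    push_cast [hl]; ring
  have h := spectrum_of_three hS hψ (hasValency_D hn hb) (r := 2 * ((n : ℝ) - 4)) (s := -4) (t := 0)
    (l := n - 1) (m := n * (n - 3) / 2) (n := n * (n - 1) / 2) (c := 32 * ((n : ℝ) - 2))
    (by linarith) (fun h => hn₂ (by linarith)) (by norm_num) (by rw [hκ]; linarith)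
    (by rw [hκ]; linarith) (by rw [hκ]; linarith) relation_D
    (by
      have h' : (Fintype.card (Pairs n × Bool) : ℝ) = 1 + (n - 1 : ℕ) + (n * (n - 3) / 2 : ℕ) +
          (n * (n - 1) / 2 : ℕ) := by
        rw [card_D, hl, hm, hm']
        ring
      exact_mod_cast h')
    (by rw [hκ, hl, hm, hm']; ring) (by rw [hκ, card_D, hl, hm, hm']; ring)
  rw [hκ] at h
  have h₀ : (4 * ((n : ℝ) - 2) + 4) ≠ 0 := by linarith
  have h₁ : (4 * ((n : ℝ) - 2) - 2 * (n - 4)) / (4 * (n - 2) + 4) = n / (2 * (n - 1)) := by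
    rw [div_eq_div_iff h₀ (by linarith)]; ring
  have h₂ : (4 * ((n : ℝ) - 2) - -4) / (4 * (n - 2) + 4) = 1 := by
    rw [div_eq_iff h₀]; ring
  have h₃ : (4 * ((n : ℝ) - 2) - 0) / (4 * (n - 2) + 4) = (n - 2) / (n - 1) := by
    rw [div_eq_div_iff h₀ (by linarith)]; ring
  rw [h₁, h₂, h₃] at h
  exact h

theorem spectrum_D (hn : 3 ≤ n) (hb : HasCartanMatrix b (CartanMatrix.D n)) :
    (rootAdjMatrix b).charpoly.roots = {4 * ((n : ℝ) - 2)} +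
      Multiset.replicate (n - 1) (2 * ((n : ℝ) - 4)) + Multiset.replicate (n * (n - 3) / 2) (-4) +
      Multiset.replicate (n * (n - 1) / 2) 0 ∧
    HasTTSpectrum 𝔱 (Multiset.replicate (n - 1) ((n : ℝ) / (2 * ((n : ℝ) - 1))) +
      Multiset.replicate (n * (n - 3) / 2) 1 +
      Multiset.replicate (n * (n - 1) / 2) (((n : ℝ) - 2) / ((n : ℝ) - 1))) := by
  rcases eq_or_ne n 4 with rfl | hn'
  · have h := spectrum_D_four hb
    -- For n = 4 two eigenvalues of the general list coincide; 9 splits as (n - 1) + n(n - 1)/2.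
    rw [show (9 : ℕ) = 3 + 6 by norm_num, Multiset.replicate_add, Multiset.replicate_add,
      ← add_assoc, add_right_comm _ (Multiset.replicate 6 (0 : ℝ)),
      add_right_comm _ (Multiset.replicate 6 (2 / 3 : ℝ))] at h
    refine ⟨?_, ?_⟩
    · convert h.1 using 5 <;> norm_num
    · rw [show ((4 : ℕ) : ℝ) / (2 * ((4 : ℕ) - 1)) = 2 / 3 by norm_num,
        show (((4 : ℕ) : ℝ) - 2) / ((4 : ℕ) - 1) = 2 / 3 by norm_num]
      exact h.2
  · exact spectrum_D_of_ne hn hn' hb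

end TypeD

end FullFlag
end

noncomputable section
namespace FullFlag
open Module

/-! ### The root systems of type `E` -/

section TypeE

/-- The vector whose coordinates are the decimal digits of `c`. -/
def digits (l c : ℕ) : Fin l → ℤ := fun i => (c / 10 ^ i.val % 10 : ℕ)

/-- The products of the vector `digits l c` with the simple roots. -/
def label {l : ℕ} (C : Matrix (Fin l) (Fin l) ℤ) (c : ℕ) (i : Fin l) : ℤ :=
  ∑ j, digits l c j * C j i

/-- The digits of these numbers are the coordinates of the positive roots of type `E₈`. -/
def codesE₈ : List ℕ :=
  [1, 10, 100, 101, 1000, 1010, 1100, 1101, 1110, 1111, 10000, 11000, 11010, 11100, 11101, 11110,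
   11111, 12110, 12111, 12211, 100000, 110000, 111000, 111010, 111100, 111101, 111110, 111111,
   112110, 112111, 112211, 122110, 122111, 122211, 123211, 123221, 1000000, 1100000, 1110000,
   1111000, 1111010, 1111100, 1111101, 1111110, 1111111, 1112110, 1112111, 1112211, 1122110,
   1122111, 1122211, 1123211, 1123221, 1222110, 1222111, 1222211, 1223211, 1223221, 1233211,
   1233221, 1234221, 1234321, 1234322, 10000000, 11000000, 11100000, 11110000, 11111000, 11111010,
   11111100, 11111101, 11111110, 11111111, 11112110, 11112111, 11112211, 11122110, 11122111,
   11122211, 11123211, 11123221, 11222110, 11222111, 11222211, 11223211, 11223221, 11233211,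
   11233221, 11234221, 11234321, 11234322, 12222110, 12222111, 12222211, 12223211, 12223221,
   12233211, 12233221, 12234221, 12234321, 12234322, 12333211, 12333221, 12334221, 12334321,
   12334322, 12344221, 12344321, 12344322, 12345321, 12345322, 12345331, 12345332, 12345422,
   12345432, 12346432, 12356432, 12456432, 13456432, 23456432]

/-- The codes of the positive roots of type `E₇`. -/
def codesE₇ : List ℕ := codesE₈.take 63

/-- The codes of the positive roots of type `E₆`. -/
def codesE₆ : List ℕ := codesE₈.take 36

/-- The columns of the table of the products of the positive roots with the simple ones. -/
def colsE₈ : Fin 8 → List ℤ :=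
  ![
    [2, 0, -1, 1, 0, 0, -1, 1, -1, 1, 0, 0, 0, -1, 1, -1, 1, -1, 1, 0, 0, 0, 0, 0, -1, 1, -1, 1,
    -1, 1, 0, -1, 1, 0, 0, 0, 0, 0, 0, 0, 0, -1, 1, -1, 1, -1, 1, 0, -1, 1, 0, 0, 0, -1, 1, 0, 0,
    0, 0, 0, 0, -1, 1, 0, 0, 0, 0, 0, 0, -1, 1, -1, 1, -1, 1, 0, -1, 1, 0, 0, 0, -1, 1, 0, 0, 0,
    0, 0, 0, -1, 1, -1, 1, 0, 0, 0, 0, 0, 0, -1, 1, 0, 0, 0, -1, 1, 0, -1, 1, -1, 1, -1, 1, 0, 0,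
    0, 0, 0, 0, 0],
    [0, 2, 0, 0, -1, 1, -1, -1, 1, 1, 0, -1, 1, -1, -1, 1, 1, 0, 0, 0, 0, 0, -1, 1, -1, -1, 1, 1,
    0, 0, 0, 0, 0, 0, -1, 1, 0, 0, 0, -1, 1, -1, -1, 1, 1, 0, 0, 0, 0, 0, 0, -1, 1, 0, 0, 0, -1,
    1, -1, 1, 0, 0, 0, 0, 0, 0, 0, -1, 1, -1, -1, 1, 1, 0, 0, 0, 0, 0, 0, -1, 1, 0, 0, 0, -1, 1,
    -1, 1, 0, 0, 0, 0, 0, 0, -1, 1, -1, 1, 0, 0, 0, -1, 1, 0, 0, 0, 0, 0, 0, -1, -1, 1, 1, -1, 1,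
    0, 0, 0, 0, 0],
    [-1, 0, 2, 1, -1, -1, 1, 0, 1, 0, 0, -1, -1, 1, 0, 1, 0, 0, -1, 1, 0, 0, -1, -1, 1, 0, 1, 0,
    0, -1, 1, 0, -1, 1, 0, 0, 0, 0, 0, -1, -1, 1, 0, 1, 0, 0, -1, 1, 0, -1, 1, 0, 0, 0, -1, 1, 0,
    0, 0, 0, -1, 1, 0, 0, 0, 0, 0, -1, -1, 1, 0, 1, 0, 0, -1, 1, 0, -1, 1, 0, 0, 0, -1, 1, 0, 0,
    0, 0, -1, 1, 0, 0, -1, 1, 0, 0, 0, 0, -1, 1, 0, 0, 0, -1, 1, 0, -1, 1, 0, 0, -1, 0, -1, 1, 1,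
    0, 0, 0, 0, 0],
    [0, -1, -1, -1, 2, 1, 1, 1, 0, 0, -1, 1, 0, 0, 0, -1, -1, 1, 1, 0, 0, -1, 1, 0, 0, 0, -1, -1,
    1, 1, 0, 0, 0, -1, 1, 0, 0, 0, -1, 1, 0, 0, 0, -1, -1, 1, 1, 0, 0, 0, -1, 1, 0, 0, 0, -1, 1,
    0, 0, -1, 1, 0, 0, 0, 0, 0, -1, 1, 0, 0, 0, -1, -1, 1, 1, 0, 0, 0, -1, 1, 0, 0, 0, -1, 1, 0,
    0, -1, 1, 0, 0, 0, 0, -1, 1, 0, 0, -1, 1, 0, 0, 0, -1, 1, 0, 0, 0, -1, -1, 1, 1, 0, 0, 0, -1,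
    1, 0, 0, 0, 0],
    [0, 0, 0, 0, -1, -1, -1, -1, -1, -1, 2, 1, 1, 1, 1, 1, 1, 0, 0, 0, -1, 1, 0, 0, 0, 0, 0, 0,
    -1, -1, -1, 1, 1, 1, 0, 0, 0, -1, 1, 0, 0, 0, 0, 0, 0, -1, -1, -1, 1, 1, 1, 0, 0, 0, 0, 0, -1,
    -1, 1, 1, 0, 0, 0, 0, 0, -1, 1, 0, 0, 0, 0, 0, 0, -1, -1, -1, 1, 1, 1, 0, 0, 0, 0, 0, -1, -1,
    1, 1, 0, 0, 0, 0, 0, 0, -1, -1, 1, 1, 0, 0, 0, 0, 0, -1, -1, -1, 1, 1, 1, 0, 0, 0, 0, 0, 0,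
    -1, 1, 0, 0, 0],
    [0, 0, 0, 0, 0, 0, 0, 0, 0, 0, -1, -1, -1, -1, -1, -1, -1, -1, -1, -1, 2, 1, 1, 1, 1, 1, 1, 1,
    1, 1, 1, 0, 0, 0, 0, 0, -1, 1, 0, 0, 0, 0, 0, 0, 0, 0, 0, 0, -1, -1, -1, -1, -1, 1, 1, 1, 1,
    1, 0, 0, 0, 0, 0, 0, -1, 1, 0, 0, 0, 0, 0, 0, 0, 0, 0, 0, -1, -1, -1, -1, -1, 1, 1, 1, 1, 1,
    0, 0, 0, 0, 0, 0, 0, 0, 0, 0, -1, -1, -1, -1, -1, 1, 1, 1, 1, 1, 0, 0, 0, 0, 0, 0, 0, 0, 0, 0,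
    -1, 1, 0, 0],
    [0, 0, 0, 0, 0, 0, 0, 0, 0, 0, 0, 0, 0, 0, 0, 0, 0, 0, 0, 0, -1, -1, -1, -1, -1, -1, -1, -1,
    -1, -1, -1, -1, -1, -1, -1, -1, 2, 1, 1, 1, 1, 1, 1, 1, 1, 1, 1, 1, 1, 1, 1, 1, 1, 0, 0, 0, 0,
    0, 0, 0, 0, 0, 0, -1, 1, 0, 0, 0, 0, 0, 0, 0, 0, 0, 0, 0, 0, 0, 0, 0, 0, -1, -1, -1, -1, -1,
    -1, -1, -1, -1, -1, 1, 1, 1, 1, 1, 1, 1, 1, 1, 1, 0, 0, 0, 0, 0, 0, 0, 0, 0, 0, 0, 0, 0, 0, 0,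
    0, -1, 1, 0],
    [0, 0, 0, 0, 0, 0, 0, 0, 0, 0, 0, 0, 0, 0, 0, 0, 0, 0, 0, 0, 0, 0, 0, 0, 0, 0, 0, 0, 0, 0, 0,
    0, 0, 0, 0, 0, -1, -1, -1, -1, -1, -1, -1, -1, -1, -1, -1, -1, -1, -1, -1, -1, -1, -1, -1, -1,
    -1, -1, -1, -1, -1, -1, -1, 2, 1, 1, 1, 1, 1, 1, 1, 1, 1, 1, 1, 1, 1, 1, 1, 1, 1, 1, 1, 1, 1,
    1, 1, 1, 1, 1, 1, 0, 0, 0, 0, 0, 0, 0, 0, 0, 0, 0, 0, 0, 0, 0, 0, 0, 0, 0, 0, 0, 0, 0, 0, 0,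
    0, 0, -1, 1]]

/-- The columns of the table for type `E₇`. -/
def colsE₇ (i : Fin 7) : List ℤ := (colsE₈ (i.castLE (by decide))).take 63

/-- The columns of the table for type `E₆`. -/
def colsE₆ (i : Fin 6) : List ℤ := (colsE₈ (i.castLE (by decide))).take 36

/-- The sum of the products of the corresponding entries of two lists. -/
def dot : List ℤ → List ℤ → ℤ
  | x :: xs, y :: ys => x * y + dot xs ys
  | _, _ => 0

/-- The properties of a list of codes which are needed to make it a list of the positive roots with
Cartan matrix `C`, with the second and fourth moments `h` and `m`. -/
structure IsRootList {l : ℕ} (C : Matrix (Fin l) (Fin l) ℤ) (L : List ℕ) (cols : Fin l → List ℤ)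
    (h m : ℤ) : Prop where
  symm : C.IsSymm
  sorted : L.IsChain (· < ·)
  lt : ∀ c ∈ L, c < 10 ^ l
  simple : ∀ j : Fin l, 10 ^ j.val ∈ L
  step : ∀ c ∈ L, ∀ j : Fin l, label C c j = -1 →
    c + 10 ^ j.val ∈ L ∧ c / 10 ^ j.val % 10 < 9
  descent : ∀ c ∈ L, ∃ j : Fin l, c = 10 ^ j.val ∨
    (c - 10 ^ j.val ∈ L ∧ 10 ^ j.val ≤ c ∧ label C (c - 10 ^ j.val) j = -1)
  cols_eq : ∀ i, (L.map fun c => label C c i) = cols i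
  second : ∀ i j : Fin l, dot (cols i) (cols j) = h * C i j
  fourth : ∀ i j k n : Fin l, i ≤ j → j ≤ k → k ≤ n →
    dot (List.zipWith (· * ·) (cols i) (cols j)) (List.zipWith (· * ·) (cols k) (cols n)) =
      m * (C i j * C k n + C i k * C j n + C i n * C j k)

set_option maxRecDepth 100000 in
-- A finite check, also for the two lists which follow. The second moment is the Coxeter number h.
-- The Weyl groups of type E have no invariant quartic besides the square of the form, so the fourth
-- moment is a multiple m of its polarization, and contracting two slots gives m(l + 2) = 2h, hence
-- m = 3, 4, 6.
lemma isRootList_E₆ : IsRootList CartanMatrix.E₆ codesE₆ colsE₆ 12 3 := by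
  constructor <;> decide +kernel

set_option maxRecDepth 100000 in
lemma isRootList_E₇ : IsRootList CartanMatrix.E₇ codesE₇ colsE₇ 18 4 := by
  constructor <;> decide +kernel

set_option maxRecDepth 100000 in
lemma isRootList_E₈ : IsRootList CartanMatrix.E₈ codesE₈ colsE₈ 30 6 := by
  constructor <;> decide +kernel

lemma dot_map (f g : ℕ → ℤ) (L : List ℕ) :
    dot (L.map f) (L.map g) = (L.map fun c => f c * g c).sum := by
  induction L with
  | nil => rfl
  | cons c L ih => simp [dot, ih]

lemma sum_fin_eq (f : ℕ → ℤ) (L : List ℕ) : ∑ k : Fin L.length, f (L.get k) = (L.map f).sum := by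
  induction L with
  | nil => rfl
  | cons c L ih =>
    rw [List.map_cons, List.sum_cons, ← ih]
    exact Fin.sum_univ_succ _

lemma eq_of_digits_eq (l : ℕ) : ∀ {c c' : ℕ}, c < 10 ^ l → c' < 10 ^ l →
    (∀ i < l, c / 10 ^ i % 10 = c' / 10 ^ i % 10) → c = c' := by
  induction l with
  | zero => intro c c' hc hc' _; omega
  | succ l ih =>
    intro c c' hc hc' h
    have h₀ := h 0 (by omega)
    have h₁ : c / 10 = c' / 10 := by
      refine ih (by rw [pow_succ] at hc; omega) (by rw [pow_succ] at hc'; omega) fun i hi => ?_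
      have h₂ := h (i + 1) (by omega)
      rwa [pow_succ', ← Nat.div_div_eq_div_mul, ← Nat.div_div_eq_div_mul] at h₂
    simp only [pow_zero, Nat.div_one] at h₀
    omega

lemma digits_injOn {l c c' : ℕ} (hc : c < 10 ^ l) (hc' : c' < 10 ^ l)
    (h : digits l c = digits l c') : c = c' := by
  refine eq_of_digits_eq l hc hc' fun i hi => ?_
  have h' := congrFun h ⟨i, hi⟩
  simp only [digits] at h'
  exact_mod_cast h'

/-- A j-th digit below 9 means that adding 10^j produces no carry. -/
lemma digits_add {l c : ℕ} (j : Fin l) (h : c / 10 ^ j.val % 10 < 9) :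
    digits l (c + 10 ^ j.val) = digits l c + Pi.single j 1 := by
  ext i
  rw [Pi.add_apply, Pi.single_apply, digits, digits]
  rcases lt_trichotomy i j with hij | rfl | hij
  · rw [if_neg hij.ne, add_zero, Nat.cast_inj]
    obtain ⟨d, hd⟩ := Nat.exists_eq_add_of_lt (Fin.lt_def.1 hij)
    rw [hd, pow_succ, pow_add, mul_assoc, Nat.add_mul_div_left _ _ (by positivity),
      Nat.add_mul_mod_self_right]
  · rw [if_pos rfl, Nat.add_div_right _ (by positivity)]
    omega
  · rw [if_neg hij.ne', add_zero, Nat.cast_inj]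
    obtain ⟨d, hd⟩ := Nat.exists_eq_add_of_lt (Fin.lt_def.1 hij)
    rw [hd, add_assoc, pow_add, pow_succ', ← Nat.div_div_eq_div_mul, ← Nat.div_div_eq_div_mul,
      ← Nat.div_div_eq_div_mul, ← Nat.div_div_eq_div_mul, Nat.add_div_right _ (by positivity)]
    congr 2
    omega

lemma digits_pow {l : ℕ} (j : Fin l) : digits l (10 ^ j.val) = Pi.single j 1 := by
  have h := digits_add (c := 0) j (by simp)
  rw [zero_add] at h
  rw [h, add_eq_right]
  ext i
  simp [digits]

lemma toBilin'_digits_single {l : ℕ} (C : Matrix (Fin l) (Fin l) ℤ) (c : ℕ) (j : Fin l) :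
    Matrix.toBilin' C (digits l c) (Pi.single j 1) = label C c j := by
  rw [Matrix.toBilin'_apply', Matrix.mulVec_single_one, label, dotProduct]
  rfl

namespace IsRootList

variable {l : ℕ} {C : Matrix (Fin l) (Fin l) ℤ} {L : List ℕ} {cols : Fin l → List ℤ} {h m : ℤ}
  (hL : IsRootList C L cols h m)

include hL

lemma isModel : IsModel (Matrix.toBilin' C) C (fun j => Pi.single j 1) where
  symm v w := by
    rw [Matrix.toBilin'_apply', Matrix.toBilin'_apply', Matrix.dotProduct_mulVec, dotProduct_comm,
      ← Matrix.mulVec_transpose, hL.symm]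
  gram i j := Matrix.toBilin'_single C i j

lemma digits_injective : Function.Injective fun k : Fin L.length => digits l (L.get k) := by
  intro k k' hk
  have h₁ := digits_injOn (hL.lt _ (L.get_mem k)) (hL.lt _ (L.get_mem k')) hk
  have h₂ : L.Nodup := (List.isChain_iff_pairwise.1 hL.sorted).imp fun h => h.ne
  exact h₂.injective_get h₁

/-- `step` closes the list under the admissible additions. `descent` writes each code as a power of
ten or as a smaller listed code plus one, so strong induction on the code reaches all of it. -/
lemma reach_iff (v : Fin l → ℤ) : Reach (Matrix.toBilin' C) (fun j => Pi.single j 1) v ↔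
    v ∈ Set.range fun k : Fin L.length => digits l (L.get k) := by
  have h₁ : (v ∈ Set.range fun k : Fin L.length => digits l (L.get k)) ↔
      ∃ c ∈ L, digits l c = v := by
    simp only [Set.mem_range, List.mem_iff_get]
    constructor
    · rintro ⟨k, hk⟩
      exact ⟨_, ⟨k, rfl⟩, hk⟩
    · rintro ⟨_, ⟨k, rfl⟩, hk⟩
      exact ⟨k, hk⟩
  rw [h₁]
  clear h₁
  constructor
  · intro hv
    induction hv with
    | simple j => exact ⟨_, hL.simple j, digits_pow j⟩
    | step v j _ hvj ih =>
      obtain ⟨c, hc, rfl⟩ := ih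
      rw [toBilin'_digits_single] at hvj
      obtain ⟨h₂, h₃⟩ := hL.step c hc j hvj
      exact ⟨_, h₂, digits_add j h₃⟩
  · rintro ⟨c, hc, rfl⟩
    induction c using Nat.strong_induction_on with
    | _ c ih =>
      obtain ⟨j, rfl | ⟨h₂, h₃, h₄⟩⟩ := hL.descent c hc
      · rw [digits_pow]
        exact Reach.simple j
      · have h₅ := ih _ (Nat.sub_lt_self (by positivity) h₃) h₂
        rw [← Nat.sub_add_cancel h₃, digits_add j (hL.step _ h₂ j h₄).2]
        exact Reach.step _ j h₅ (by rw [toBilin'_digits_single, h₄])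

omit hL in
-- Extends a moment identity in one slot from the basis vectors to arbitrary vectors by linearity.
lemma sum_mul_form {f : Fin L.length → ℤ} {τ : (Fin l → ℤ) →ₗ[ℤ] ℤ}
    (hτ : ∀ j, ∑ k, f k * label C (L.get k) j = τ (Pi.single j 1)) (v : Fin l → ℤ) :
    ∑ k, f k * Matrix.toBilin' C (digits l (L.get k)) v = τ v := by
  have h₁ : ∑ k, f k • Matrix.toBilin' C (digits l (L.get k)) = τ := by
    refine (Pi.basisFun ℤ (Fin l)).ext fun j => ?_
    rw [Pi.basisFun_apply, ← hτ, LinearMap.sum_apply]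
    simp_rw [LinearMap.smul_apply, toBilin'_digits_single, smul_eq_mul]
  rw [← h₁, LinearMap.sum_apply]
  rfl

lemma sum_label_mul (i j : Fin l) :
    ∑ k : Fin L.length, label C (L.get k) i * label C (L.get k) j = h * C i j := by
  rw [sum_fin_eq (fun c => label C c i * label C c j), ← dot_map, hL.cols_eq, hL.cols_eq,
    hL.second]

lemma sum_form_mul (v w : Fin l → ℤ) :
    ∑ k : Fin L.length, Matrix.toBilin' C (digits l (L.get k)) v *
      Matrix.toBilin' C (digits l (L.get k)) w = h * Matrix.toBilin' C v w := by
  refine sum_mul_form (τ := h • Matrix.toBilin' C v) (fun j => ?_) w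
  rw [LinearMap.smul_apply, hL.isModel.symm v, smul_eq_mul]
  have h₁ := sum_mul_form (τ := h • Matrix.toBilin' C (Pi.single j 1)) (L := L)
    (f := fun k => label C (L.get k) j) (C := C) (fun i => by
      rw [hL.sum_label_mul, LinearMap.smul_apply, Matrix.toBilin'_single, smul_eq_mul]) v
  rw [LinearMap.smul_apply, smul_eq_mul] at h₁
  rw [← h₁]
  exact Finset.sum_congr rfl fun _ _ => mul_comm _ _

omit hL in
-- The adjacent transpositions generate all permutations of four indices. The fourth moments
-- therefore need to be tabulated only for sorted indices.
lemma forall_of_forall_le {p : Fin l → Fin l → Fin l → Fin l → Prop}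
    (h₁ : ∀ i j k n, p i j k n → p j i k n) (h₂ : ∀ i j k n, p i j k n → p i k j n)
    (h₃ : ∀ i j k n, p i j k n → p i j n k)
    (hp : ∀ i j k n, i ≤ j → j ≤ k → k ≤ n → p i j k n) (i j k n : Fin l) : p i j k n := by
  have a₁ : ∀ i j k n, i ≤ k → j ≤ k → k ≤ n → p i j k n := fun i j k n hi hj hk =>
    (le_total i j).elim (fun h => hp _ _ _ _ h hj hk) fun h => h₁ _ _ _ _ (hp _ _ _ _ h hi hk)
  have a₂ : ∀ i j k n, i ≤ n → j ≤ n → k ≤ n → p i j k n := by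
    intro i j k n hi hj hk
    rcases le_total i k with h | h <;> rcases le_total j k with h' | h'
    · exact a₁ _ _ _ _ h h' hk
    · exact h₂ _ _ _ _ (a₁ _ _ _ _ (h.trans h') h' hj)
    · exact h₁ _ _ _ _ (h₂ _ _ _ _ (a₁ _ _ _ _ (h'.trans h) h hi))
    · rcases le_total i j with h'' | h''
      · exact h₂ _ _ _ _ (a₁ _ _ _ _ h'' h' hj)
      · exact h₁ _ _ _ _ (h₂ _ _ _ _ (a₁ _ _ _ _ h'' h hi))
  rcases le_total i n with hi | hi <;> rcases le_total j n with hj | hj <;>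
    rcases le_total k n with hk | hk
  · exact a₂ _ _ _ _ hi hj hk
  · exact h₃ _ _ _ _ (a₂ _ _ _ _ (hi.trans hk) (hj.trans hk) hk)
  · exact h₂ _ _ _ _ (h₃ _ _ _ _ (a₂ _ _ _ _ (hi.trans hj) (hk.trans hj) hj))
  · rcases le_total j k with h | h
    · exact h₃ _ _ _ _ (a₂ _ _ _ _ (hi.trans hk) h hk)
    · exact h₂ _ _ _ _ (h₃ _ _ _ _ (a₂ _ _ _ _ (hi.trans hj) h hj))
  · exact h₁ _ _ _ _ (h₂ _ _ _ _ (h₃ _ _ _ _ (a₂ _ _ _ _ (hj.trans hi) (hk.trans hi) hi)))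
  · rcases le_total i k with h | h
    · exact h₃ _ _ _ _ (a₂ _ _ _ _ h (hj.trans hk) hk)
    · exact h₁ _ _ _ _ (h₂ _ _ _ _ (h₃ _ _ _ _ (a₂ _ _ _ _ (hj.trans hi) h hi)))
  · rcases le_total i j with h | h
    · exact h₂ _ _ _ _ (h₃ _ _ _ _ (a₂ _ _ _ _ h (hk.trans hj) hj))
    · exact h₁ _ _ _ _ (h₂ _ _ _ _ (h₃ _ _ _ _ (a₂ _ _ _ _ h (hk.trans hi) hi)))
  · rcases le_total i j with h | h <;> rcases le_total j k with h' | h' <;>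
      rcases le_total i k with h'' | h''
    · exact h₃ _ _ _ _ (a₂ _ _ _ _ h'' h' hk)
    · exact h₃ _ _ _ _ (a₂ _ _ _ _ (h.trans h') h' hk)
    · exact h₂ _ _ _ _ (h₃ _ _ _ _ (a₂ _ _ _ _ h h' hj))
    · exact h₂ _ _ _ _ (h₃ _ _ _ _ (a₂ _ _ _ _ h h' hj))
    · exact h₃ _ _ _ _ (a₂ _ _ _ _ h'' h' hk)
    · exact h₁ _ _ _ _ (h₂ _ _ _ _ (h₃ _ _ _ _ (a₂ _ _ _ _ h h'' hi)))
    · exact h₁ _ _ _ _ (h₂ _ _ _ _ (h₃ _ _ _ _ (a₂ _ _ _ _ h (h'.trans h) hi)))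
    · exact h₁ _ _ _ _ (h₂ _ _ _ _ (h₃ _ _ _ _ (a₂ _ _ _ _ h h'' hi)))

lemma sum_label_mul_mul (i j k n : Fin l) :
    ∑ t : Fin L.length, label C (L.get t) i * label C (L.get t) j * label C (L.get t) k *
      label C (L.get t) n = m * (C i j * C k n + C i k * C j n + C i n * C j k) := by
  have hC : ∀ i j, C i j = C j i := fun i j => (hL.symm.apply i j).symm
  refine forall_of_forall_le (p := fun i j k n =>
    ∑ t : Fin L.length, label C (L.get t) i * label C (L.get t) j * label C (L.get t) k *
      label C (L.get t) n = m * (C i j * C k n + C i k * C j n + C i n * C j k))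
    ?_ ?_ ?_ (fun i j k n hij hjk hkn => ?_) i j k n
  · intro i j k n h₁
    rw [hC j i, add_right_comm]
    simp_rw [mul_comm (label C _ j) (label C _ i)]
    rw [h₁]; ring
  · intro i j k n h₁
    rw [hC k j]
    simp_rw [mul_right_comm (label C _ i) (label C _ k)]
    rw [h₁]; ring
  · intro i j k n h₁
    rw [hC n k]
    simp_rw [mul_right_comm _ (label C _ n) (label C _ k)]
    rw [h₁]; ring
  · rw [← hL.fourth i j k n hij hjk hkn, ← hL.cols_eq, ← hL.cols_eq, ← hL.cols_eq, ← hL.cols_eq,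
      List.zipWith_map, List.zipWith_map, List.zipWith_self, List.zipWith_self, dot_map,
      sum_fin_eq (fun c => label C c i * label C c j * label C c k * label C c n)]
    simp_rw [mul_assoc]

lemma sum_form_mul_mul (u v w x : Fin l → ℤ) :
    ∑ t : Fin L.length, Matrix.toBilin' C (digits l (L.get t)) u *
      Matrix.toBilin' C (digits l (L.get t)) v * Matrix.toBilin' C (digits l (L.get t)) w *
      Matrix.toBilin' C (digits l (L.get t)) x =
      m * (Matrix.toBilin' C u v * Matrix.toBilin' C w x +
        Matrix.toBilin' C u w * Matrix.toBilin' C v x +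
        Matrix.toBilin' C u x * Matrix.toBilin' C v w) := by
  have hB := hL.isModel.symm
  have hs : ∀ i j, Matrix.toBilin' C (Pi.single i 1) (Pi.single j 1) = C i j :=
    Matrix.toBilin'_single C
  -- Frees one slot from basis vectors; it is applied four times, once for each slot.
  have key : ∀ (f : Fin L.length → ℤ) (a b c : Fin l → ℤ),
      (∀ j, ∑ t, f t * label C (L.get t) j =
        m * (Matrix.toBilin' C a b * Matrix.toBilin' C c (Pi.single j 1) +
          Matrix.toBilin' C a c * Matrix.toBilin' C b (Pi.single j 1) +
          Matrix.toBilin' C a (Pi.single j 1) * Matrix.toBilin' C b c)) →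
      ∀ v, ∑ t, f t * Matrix.toBilin' C (digits l (L.get t)) v =
        m * (Matrix.toBilin' C a b * Matrix.toBilin' C c v +
          Matrix.toBilin' C a c * Matrix.toBilin' C b v +
          Matrix.toBilin' C a v * Matrix.toBilin' C b c) := by
    intro f a b c hf v
    have h₁ := sum_mul_form (C := C) (f := f) (τ := m • (Matrix.toBilin' C a b • Matrix.toBilin' C c +
      Matrix.toBilin' C a c • Matrix.toBilin' C b + Matrix.toBilin' C b c • Matrix.toBilin' C a))
      (fun j => by
        rw [hf]
        simp only [LinearMap.smul_apply, LinearMap.add_apply, smul_eq_mul]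
        ring) v
    rw [h₁]
    simp only [LinearMap.smul_apply, LinearMap.add_apply, smul_eq_mul]
    ring
  have h₁ : ∀ (i j k : Fin l) v, _ := fun i j k => key
    (fun t => label C (L.get t) i * label C (L.get t) j * label C (L.get t) k)
    (Pi.single i 1) (Pi.single j 1) (Pi.single k 1) fun n => by
      rw [hL.sum_label_mul_mul, hs, hs, hs, hs, hs, hs]
  have h₂ : ∀ (i j : Fin l) v w, _ := fun i j v => key
    (fun t => label C (L.get t) i * label C (L.get t) j * Matrix.toBilin' C (digits l (L.get t)) v)
    (Pi.single i 1) (Pi.single j 1) v fun n => by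
      simp_rw [mul_right_comm _ _ (label C _ n)]
      rw [h₁, hB v, hB (Pi.single j 1) (Pi.single n 1)]
      ring
  have h₃ : ∀ (i : Fin l) v w x, _ := fun i v w => key
    (fun t => label C (L.get t) i * Matrix.toBilin' C (digits l (L.get t)) v *
      Matrix.toBilin' C (digits l (L.get t)) w)
    (Pi.single i 1) v w fun n => by
      simp_rw [mul_right_comm _ _ (label C _ n)]
      rw [h₂, hB v (Pi.single n 1), hB w (Pi.single n 1)]
      ring
  refine key _ _ _ _ (fun n => ?_) x
  simp_rw [mul_comm _ (label C _ n), ← mul_assoc]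
  rw [h₃, hB u (Pi.single n 1), hB v (Pi.single n 1), hB w (Pi.single n 1)]
  ring

omit hL in
/-- The products of the positive roots. -/
def gram (C : Matrix (Fin l) (Fin l) ℤ) (L : List ℕ) (k n : Fin L.length) : ℤ :=
  Matrix.toBilin' C (digits l (L.get k)) (digits l (L.get n))

lemma gram_comm (k n : Fin L.length) : gram C L k n = gram C L n k := hL.isModel.symm _ _

variable (hd : ∀ k : Fin L.length, gram C L k k = 2)

include hd

lemma sum_gram_sq (k : Fin L.length) : ∑ n, (gram C L k n : ℝ) ^ 2 = 2 * h := by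
  have h₁ : ∑ n, gram C L k n ^ 2 = 2 * h := by
    simp_rw [hL.gram_comm k, sq]
    rw [mul_comm, ← hd k]
    exact hL.sum_form_mul _ _
  exact_mod_cast h₁

/-- The fourth moment at (k, k, n, n), both vectors having norm 2. In matrix form W² = 2mW + 4mJ. -/
lemma sum_gram_sq_mul_sq (k n : Fin L.length) :
    ∑ t, (gram C L k t : ℝ) ^ 2 * (gram C L t n : ℝ) ^ 2 =
      m * (4 + 2 * (gram C L k n : ℝ) ^ 2) := by
  have h₁ : ∑ t, gram C L k t ^ 2 * gram C L t n ^ 2 = m * (4 + 2 * gram C L k n ^ 2) := by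
    have h₂ := hL.sum_form_mul_mul (digits l (L.get k)) (digits l (L.get k)) (digits l (L.get n))
      (digits l (L.get n))
    have h₃ : m * (4 + 2 * gram C L k n ^ 2) = m * (gram C L k k * gram C L n n +
        gram C L k n * gram C L k n + gram C L k n * gram C L k n) := by
      rw [hd, hd]; ring
    rw [h₃]
    refine Eq.trans (Finset.sum_congr rfl fun t _ => ?_) h₂
    rw [hL.gram_comm k, gram, gram]
    ring
  exact_mod_cast h₁

/-- On an eigenvector the formula for W² yields (t + 4)² - 2m(t + 4). -/
lemma relation (t : ℝ) (v : Fin L.length → ℝ)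
    (hv : ∀ k, ∑ n, (gram C L k n : ℝ) ^ 2 * v n = (t + 4) * v k) (k : Fin L.length) :
    (t - (2 * m - 4)) * (t - (-4)) * v k = 4 * m * ∑ n, v n := by
  have h₁ := sum_mul_apply_eq_sq hv k
  simp_rw [hL.sum_gram_sq_mul_sq hd, mul_assoc, ← Finset.mul_sum, add_mul] at h₁
  rw [Finset.sum_add_distrib] at h₁
  simp_rw [mul_assoc, ← Finset.mul_sum, hv] at h₁
  linear_combination -h₁

end IsRootList

variable {𝔤 : Type*} [LieRing 𝔤] [LieAlgebra ℝ 𝔤] [FiniteDimensional ℝ 𝔤] [IsCompactSemisimple 𝔤]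
  {𝔱 : LieSubalgebra ℝ 𝔤} [IsMaximalTorus 𝔱] {b : (roots 𝔱).Base}

/-- The Lichnerowicz formula and the spectra in terms of a list of the positive roots. -/
theorem IsRootList.spectrum {l : ℕ} {C : Matrix (Fin l) (Fin l) ℤ} {L : List ℕ}
    {cols : Fin l → List ℤ} {h m : ℤ} (hL : IsRootList C L cols h m) (hb : HasCartanMatrix b C)
    {κ p q : ℕ} (hκ : (2 * h : ℝ) = κ + 4) (hr : (κ : ℝ) ≠ 2 * m - 4) (hm : m ≠ 0)
    (hcard : L.length = 1 + p + q) (hsum : κ + p * (2 * m - 4) + q * (-4 : ℝ) = 0) :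
    HasLichnerowiczFormula b (2 / ((κ : ℝ) + 4)) κ ∧
    (rootAdjMatrix b).charpoly.roots = {(κ : ℝ)} +
      Multiset.replicate p (2 * (m : ℝ) - 4) + Multiset.replicate q (-4) ∧
    HasTTSpectrum 𝔱 (Multiset.replicate p (((κ : ℝ) - (2 * m - 4)) / (κ + 4)) +
      Multiset.replicate q 1) := by
  obtain ⟨e, he⟩ := hb
  have hS := isSimplyLaced_of_isModel hL.isModel he
  obtain ⟨ψ, hψ⟩ := exists_equiv_of_isModel hL.isModel he hL.digits_injective hL.reach_iff
  replace hψ : ∀ α β : PosRoot b, (roots 𝔱).pairingIn ℤ α.1 β.1 =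
    IsRootList.gram C L (ψ α) (ψ β) := hψ
  -- The norms of the listed vectors are not part of the checked data; they are inherited from ⟨α,α⟩
  -- = 2 through the bijection with the positive roots.
  have hd : ∀ k, IsRootList.gram C L k k = 2 := fun k => by
    obtain ⟨α, rfl⟩ := ψ.surjective k
    rw [← hψ, RootPairing.pairingIn_same]
  have hv : HasValency b κ := hasValency_of_sum hS hψ fun k => by rw [hL.sum_gram_sq hd, hκ]
  have : Nonempty (Fin L.length) := ⟨⟨0, by omega⟩⟩
  have hκ₀ : (0 : ℝ) < κ + 4 := by positivity
  have hm₀ : (m : ℝ) ≠ 0 := by exact_mod_cast hm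
  have h₁ := spectrum_of_two hS hψ hv (r := 2 * m - 4) (s := -4) (m := p) (n := q)
    (fun h => hm₀ (by linarith)) hr (by linarith) (hL.relation hd) (by rw [Fintype.card_fin, hcard])
    hsum
  -- The eigenvalue -4 always gives the eigenvalue (κ + 4)/(κ + 4) = 1 of the Laplacian.
  rw [sub_neg_eq_add, div_self hκ₀.ne'] at h₁
  exact ⟨hasLichnerowiczFormula hS hv, h₁⟩

theorem spectrum_E₆ (hb : HasCartanMatrix b CartanMatrix.E₆) :
    HasLichnerowiczFormula b (1 / 12) 20 ∧
    (rootAdjMatrix b).charpoly.roots = {20} + Multiset.replicate 20 2 + Multiset.replicate 15 (-4) ∧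
    HasTTSpectrum 𝔱 (Multiset.replicate 20 (3 / 4) + Multiset.replicate 15 1) := by
  have h := isRootList_E₆.spectrum hb (κ := 20) (p := 20) (q := 15) (by norm_num) (by norm_num)
    (by norm_num) rfl (by norm_num)
  rwa [show (2 * (3 : ℤ) - 4 : ℝ) = 2 by norm_num, show ((20 : ℕ) : ℝ) = 20 by norm_num,
    show (2 / (20 + 4) : ℝ) = 1 / 12 by norm_num,
    show ((20 - 2) / (20 + 4) : ℝ) = 3 / 4 by norm_num] at h

theorem spectrum_E₇ (hb : HasCartanMatrix b CartanMatrix.E₇) :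
    HasLichnerowiczFormula b (1 / 18) 32 ∧
    (rootAdjMatrix b).charpoly.roots = {32} + Multiset.replicate 27 4 + Multiset.replicate 35 (-4) ∧
    HasTTSpectrum 𝔱 (Multiset.replicate 27 (7 / 9) + Multiset.replicate 35 1) := by
  have h := isRootList_E₇.spectrum hb (κ := 32) (p := 27) (q := 35) (by norm_num) (by norm_num)
    (by norm_num) rfl (by norm_num)
  rwa [show (2 * (4 : ℤ) - 4 : ℝ) = 4 by norm_num, show ((32 : ℕ) : ℝ) = 32 by norm_num,
    show (2 / (32 + 4) : ℝ) = 1 / 18 by norm_num,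
    show ((32 - 4) / (32 + 4) : ℝ) = 7 / 9 by norm_num] at h

theorem spectrum_E₈ (hb : HasCartanMatrix b CartanMatrix.E₈) :
    HasLichnerowiczFormula b (1 / 30) 56 ∧
    (rootAdjMatrix b).charpoly.roots = {56} + Multiset.replicate 35 8 + Multiset.replicate 84 (-4) ∧
    HasTTSpectrum 𝔱 (Multiset.replicate 35 (4 / 5) + Multiset.replicate 84 1) := by
  have h := isRootList_E₈.spectrum hb (κ := 56) (p := 35) (q := 84) (by norm_num) (by norm_num)
    (by norm_num) rfl (by norm_num)
  rwa [show (2 * (6 : ℤ) - 4 : ℝ) = 8 by norm_num, show ((56 : ℕ) : ℝ) = 56 by norm_num,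
    show (2 / (56 + 4) : ℝ) = 1 / 30 by norm_num,
    show ((56 - 8) / (56 + 4) : ℝ) = 4 / 5 by norm_num] at h

end TypeE

end FullFlag
end

noncomputable section
namespace FullFlag
open Module

/-! ### Smallest and largest eigenvalues -/

section Extremal

variable {𝔤 : Type*} [LieRing 𝔤] [LieAlgebra ℝ 𝔤] [FiniteDimensional ℝ 𝔤] [IsCompactSemisimple 𝔤]
  {𝔱 : LieSubalgebra ℝ 𝔤} {x y z : ℝ} {l m n : ℕ}

lemma HasTTSpectrum.extremal_three (h : HasTTSpectrum 𝔱 (Multiset.replicate l x +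
      Multiset.replicate m y + Multiset.replicate n z)) (hl : l ≠ 0) (hn : n ≠ 0) (hxy : x ≤ y)
    (hyz : y ≤ z) : IsLeast (ttEigenvalues 𝔱) x ∧ IsGreatest (ttEigenvalues 𝔱) z := by
  refine ⟨h.isLeast ?_ fun w hw => ?_, h.isGreatest ?_ fun w hw => ?_⟩
  · exact Multiset.mem_add.2 (Or.inl (Multiset.mem_add.2 (Or.inl
      (Multiset.mem_replicate.2 ⟨hl, rfl⟩))))
  · rw [Multiset.mem_add, Multiset.mem_add] at hw
    rcases hw with (hw | hw) | hw <;> rw [Multiset.eq_of_mem_replicate hw]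
    exacts [hxy, hxy.trans hyz]
  · exact Multiset.mem_add.2 (Or.inr (Multiset.mem_replicate.2 ⟨hn, rfl⟩))
  · rw [Multiset.mem_add, Multiset.mem_add] at hw
    rcases hw with (hw | hw) | hw <;> rw [Multiset.eq_of_mem_replicate hw]
    exacts [hxy.trans hyz, hyz]

lemma HasTTSpectrum.extremal_two (h : HasTTSpectrum 𝔱 (Multiset.replicate l x +
      Multiset.replicate n z)) (hl : l ≠ 0) (hn : n ≠ 0) (hxz : x ≤ z) :
    IsLeast (ttEigenvalues 𝔱) x ∧ IsGreatest (ttEigenvalues 𝔱) z :=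
  HasTTSpectrum.extremal_three (m := 0) (y := x) (by rwa [Multiset.replicate_zero, add_zero])
    hl hn le_rfl hxz

lemma HasTTSpectrum.extremal_one (h : HasTTSpectrum 𝔱 (Multiset.replicate l x)) (hl : l ≠ 0) :
    IsLeast (ttEigenvalues 𝔱) x ∧ IsGreatest (ttEigenvalues 𝔱) x :=
  have hx {w : ℝ} (hw : w ∈ Multiset.replicate l x) : w = x := Multiset.eq_of_mem_replicate hw
  ⟨h.isLeast (Multiset.mem_replicate.2 ⟨hl, rfl⟩) fun _ hw => (hx hw).ge,
    h.isGreatest (Multiset.mem_replicate.2 ⟨hl, rfl⟩) fun _ hw => (hx hw).le⟩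

end Extremal

end FullFlag
end

/-! ### The cases of the theorem -/

theorem mainTheorem11 {𝔤 : Type*} [LieRing 𝔤] [LieAlgebra ℝ 𝔤] [FiniteDimensional ℝ 𝔤]
    [FullFlag.IsCompactSemisimple 𝔤] (𝔱 : LieSubalgebra ℝ 𝔤) [FullFlag.IsMaximalTorus 𝔱]
    (b : (FullFlag.roots 𝔱).Base) :
    -- `SU(n)/T^{n-1}`
    (∀ n : ℕ, 2 ≤ n → FullFlag.HasCartanMatrix b (CartanMatrix.A (n - 1)) →
      FullFlag.HasLichnerowiczFormula b (1 / (n : ℝ)) (2 * (n - 2))) ∧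
    (FullFlag.HasCartanMatrix b (CartanMatrix.A 2) →
      (FullFlag.rootAdjMatrix b).charpoly.roots = {2} + Multiset.replicate 2 (-1) ∧
      FullFlag.HasTTSpectrum 𝔱 (Multiset.replicate 2 (1 / 2)) ∧
      IsLeast (FullFlag.ttEigenvalues 𝔱) (1 / 2) ∧
      IsGreatest (FullFlag.ttEigenvalues 𝔱) (1 / 2)) ∧
    (∀ n : ℕ, 4 ≤ n → FullFlag.HasCartanMatrix b (CartanMatrix.A (n - 1)) →
      (FullFlag.rootAdjMatrix b).charpoly.roots = {2 * ((n : ℝ) - 2)} +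
        Multiset.replicate (n - 1) ((n : ℝ) - 4) +
        Multiset.replicate (n * (n - 3) / 2) (-2) ∧
      FullFlag.HasTTSpectrum 𝔱 (Multiset.replicate (n - 1) (1 / 2) +
        Multiset.replicate (n * (n - 3) / 2) (((n : ℝ) - 1) / n)) ∧
      IsLeast (FullFlag.ttEigenvalues 𝔱) (1 / 2) ∧
      IsGreatest (FullFlag.ttEigenvalues 𝔱) (((n : ℝ) - 1) / n)) ∧
    -- `SO(2n)/T^n`
    (∀ n : ℕ, 3 ≤ n → FullFlag.HasCartanMatrix b (CartanMatrix.D n) →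
      FullFlag.HasLichnerowiczFormula b (1 / (2 * ((n : ℝ) - 1))) (4 * (n - 2))) ∧
    (FullFlag.HasCartanMatrix b (CartanMatrix.D 3) →
      (FullFlag.rootAdjMatrix b).charpoly.roots = {4} + Multiset.replicate 2 (-2) +
        Multiset.replicate 3 0 ∧
      FullFlag.HasTTSpectrum 𝔱 (Multiset.replicate 3 (1 / 2) + Multiset.replicate 2 (3 / 4)) ∧
      IsLeast (FullFlag.ttEigenvalues 𝔱) (1 / 2) ∧
      IsGreatest (FullFlag.ttEigenvalues 𝔱) (3 / 4)) ∧
    (∀ n : ℕ, 4 ≤ n → FullFlag.HasCartanMatrix b (CartanMatrix.D n) →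
      (FullFlag.rootAdjMatrix b).charpoly.roots = {4 * ((n : ℝ) - 2)} +
        Multiset.replicate (n - 1) (2 * ((n : ℝ) - 4)) +
        Multiset.replicate (n * (n - 3) / 2) (-4) +
        Multiset.replicate (n * (n - 1) / 2) 0 ∧
      FullFlag.HasTTSpectrum 𝔱 (Multiset.replicate (n - 1) ((n : ℝ) / (2 * ((n : ℝ) - 1))) +
        Multiset.replicate (n * (n - 1) / 2) (((n : ℝ) - 2) / ((n : ℝ) - 1)) +
        Multiset.replicate (n * (n - 3) / 2) 1) ∧
      IsLeast (FullFlag.ttEigenvalues 𝔱) ((n : ℝ) / (2 * ((n : ℝ) - 1))) ∧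
      IsGreatest (FullFlag.ttEigenvalues 𝔱) 1) ∧
    -- `E₆/T⁶`
    (FullFlag.HasCartanMatrix b CartanMatrix.E₆ →
      FullFlag.HasLichnerowiczFormula b (1 / 12) 20 ∧
      (FullFlag.rootAdjMatrix b).charpoly.roots = {20} + Multiset.replicate 20 2 +
        Multiset.replicate 15 (-4) ∧
      FullFlag.HasTTSpectrum 𝔱 (Multiset.replicate 20 (3 / 4) + Multiset.replicate 15 1) ∧
      IsLeast (FullFlag.ttEigenvalues 𝔱) (3 / 4) ∧
      IsGreatest (FullFlag.ttEigenvalues 𝔱) 1) ∧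
    -- `E₇/T⁷`
    (FullFlag.HasCartanMatrix b CartanMatrix.E₇ →
      FullFlag.HasLichnerowiczFormula b (1 / 18) 32 ∧
      (FullFlag.rootAdjMatrix b).charpoly.roots = {32} + Multiset.replicate 27 4 +
        Multiset.replicate 35 (-4) ∧
      FullFlag.HasTTSpectrum 𝔱 (Multiset.replicate 27 (7 / 9) + Multiset.replicate 35 1) ∧
      IsLeast (FullFlag.ttEigenvalues 𝔱) (7 / 9) ∧
      IsGreatest (FullFlag.ttEigenvalues 𝔱) 1) ∧
    -- `E₈/T⁸`
    (FullFlag.HasCartanMatrix b CartanMatrix.E₈ →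
      FullFlag.HasLichnerowiczFormula b (1 / 30) 56 ∧
      (FullFlag.rootAdjMatrix b).charpoly.roots = {56} + Multiset.replicate 35 8 +
        Multiset.replicate 84 (-4) ∧
      FullFlag.HasTTSpectrum 𝔱 (Multiset.replicate 35 (4 / 5) + Multiset.replicate 84 1) ∧
      IsLeast (FullFlag.ttEigenvalues 𝔱) (4 / 5) ∧
      IsGreatest (FullFlag.ttEigenvalues 𝔱) 1) := by
  refine ⟨fun n hn hb => ?_, fun hb => ?_, fun n hn hb => ?_, fun n hn hb => ?_, fun hb => ?_,
    fun n hn hb => ?_, fun hb => ?_, fun hb => ?_, fun hb => ?_⟩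
  -- The type A results are indexed by the rank m = n - 1.
  · obtain ⟨m, rfl⟩ := Nat.exists_eq_add_of_le' (show 1 ≤ n by omega)
    rw [Nat.add_sub_cancel] at hb
    have h := FullFlag.hasLichnerowiczFormula_A (show 1 ≤ m by omega) hb
    rwa [Nat.cast_add, Nat.cast_one]
  · obtain ⟨h₁, h₂⟩ := FullFlag.spectrum_A le_rfl hb
    -- In rank 2 the eigenvalue -2 has multiplicity zero.
    rw [show (2 + 1) * (2 - 2) / 2 = 0 from rfl, Multiset.replicate_zero, add_zero] at h₁ h₂
    refine ⟨?_, h₂, h₂.extremal_one two_ne_zero⟩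
    rw [h₁, Nat.cast_ofNat, show (2 * (2 - 1) : ℝ) = 2 by norm_num,
      show (2 - 3 : ℝ) = -1 by norm_num]
  · obtain ⟨m, rfl⟩ := Nat.exists_eq_add_of_le' (show 1 ≤ n by omega)
    rw [Nat.add_sub_cancel] at hb ⊢
    obtain ⟨h₁, h₂⟩ := FullFlag.spectrum_A (show 2 ≤ m by omega) hb
    have hm : (3 : ℝ) ≤ m := by exact_mod_cast (show 3 ≤ m by omega)
    have h₃ : (m + 1) * (m - 2) / 2 ≠ 0 :=
      (Nat.div_pos (by nlinarith [show 1 ≤ m - 2 by omega]) two_pos).ne'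
    rw [show m + 1 - 3 = m - 2 by omega, Nat.cast_add, Nat.cast_one, add_sub_cancel_right,
      show 2 * ((m : ℝ) + 1 - 2) = 2 * ((m : ℝ) - 1) by ring,
      show (m : ℝ) + 1 - 4 = (m : ℝ) - 3 by ring]
    refine ⟨h₁, h₂, h₂.extremal_two (by omega) h₃ ?_⟩
    rw [div_le_div_iff₀ two_pos (by linarith)]
    linarith
  · exact FullFlag.hasLichnerowiczFormula_D hn hb
  · obtain ⟨h₁, h₂⟩ := FullFlag.spectrum_D le_rfl hb
    -- For n = 3 the eigenvalue -4, and with it the eigenvalue 1 of the Laplacian, has multiplicity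
    -- zero.
    rw [show 3 * (3 - 3) / 2 = 0 from rfl, Multiset.replicate_zero, add_zero] at h₁ h₂
    rw [show 3 * (3 - 1) / 2 = 3 from rfl, show 3 - 1 = 2 from rfl, Nat.cast_ofNat] at h₁ h₂
    rw [show (4 * (3 - 2) : ℝ) = 4 by norm_num, show (2 * (3 - 4) : ℝ) = -2 by norm_num] at h₁
    -- The two remaining eigenvalues are exchanged: n/(2(n - 1)) exceeds (n - 2)/(n - 1) for n = 3,
    -- in contrast to n ≥ 4.
    rw [show (3 / (2 * (3 - 1)) : ℝ) = 3 / 4 by norm_num,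
      show ((3 - 2) / (3 - 1) : ℝ) = 1 / 2 by norm_num, add_comm] at h₂
    exact ⟨h₁, h₂, h₂.extremal_two three_ne_zero two_ne_zero (by norm_num)⟩
  · obtain ⟨h₁, h₂⟩ := FullFlag.spectrum_D (show 3 ≤ n by omega) hb
    have hn' : (4 : ℝ) ≤ n := by exact_mod_cast hn
    have h₃ : n * (n - 3) / 2 ≠ 0 :=
      (Nat.div_pos (by nlinarith [show 1 ≤ n - 3 by omega]) two_pos).ne'
    rw [add_right_comm] at h₂
    refine ⟨h₁, h₂, h₂.extremal_three (by omega) h₃ ?_ ?_⟩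
    -- n/(2(n - 1)) ≤ (n - 2)/(n - 1) amounts to n ≥ 4.
    · rw [div_le_div_iff₀ (by linarith) (by linarith)]
      nlinarith
    · rw [div_le_one (by linarith)]
      linarith
  · obtain ⟨h₁, h₂, h₃⟩ := FullFlag.spectrum_E₆ hb
    exact ⟨h₁, h₂, h₃, h₃.extremal_two (by norm_num) (by norm_num) (by norm_num)⟩
  · obtain ⟨h₁, h₂, h₃⟩ := FullFlag.spectrum_E₇ hb
    exact ⟨h₁, h₂, h₃, h₃.extremal_two (by norm_num) (by norm_num) (by norm_num)⟩
  · obtain ⟨h₁, h₂, h₃⟩ := FullFlag.spectrum_E₈ hb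
    exact ⟨h₁, h₂, h₃, h₃.extremal_two (by norm_num) (by norm_num) (by norm_num)⟩
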